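/- Fix an integer $n\ge 3$ and put $m=\lfloor n/2\rfloor$. Let $\mathcal A$ be the $n\times n$ anti-diagonal matrix with all anti-diagonal entries $1$. For a commutative ring $R$, let $W(R)$ be the set of symmetric $n\times n$ matrices $B=[b_{ij}]$ over $R$, let $W_0(R)\subset W(R)$ be the subset where $b_{ij}=0$ whenever $i+j<n$, let $U(R)$ be the set of monic polynomials of degree $n$ over $R$ (identified with $R^n$ through the non-leading coefficients), and let $\operatorname{inv}(B)=(-1)^{m}\det(x\mathcal A+B)\in U(R)$. For $f\in U(R)$ write $\operatorname{inv}^{-1}(f)_0=\{B\in W_0(R):\operatorname{inv}(B)=f\}$. Define $$\lambda(B)=\prod_{i=1}^{m}b_{i(n-i)}^{\,2i-1}\ (n\text{ odd}),\qquad \lambda(B)=b_{mm}^{\,m-1}\prod_{i=1}^{m-1}b_{i(n-i)}^{\,2i-1}\ (n\text{ even}).$$ Let $R=\mathbb R$ or $R=\mathbb Z_p$ for a prime $p$. If $n$ is odd, let $G(R)=\{g\in \mathrm{SL}_n(R): g^t\mathcal A g=\mathcal A\}$, acting on $W(R)$ by $g\cdot B=gBg^t$. If $n$ is even, let $G=\mathrm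 O_{\mathcal A}/\mu_2$; concretely, $G(R)$ is the group of $g\in \mathrm{GL}_n(R)$ with $g^t\mathcal A g=c\,\mathcal A$ for some $c\in R^\times$, modulo scalars $R^\times$, acting by $g\cdot B=c^{-1}gBg^t$. Let $\mathcal P(R)\subset G(R)$ be the subgroup of lower-triangular elements; it preserves $W_0(R)$ and each $\operatorname{inv}^{-1}(f)_0$. Every $h\in\mathcal P(R)$ is uniquely $h=su$ with $u=(u_{ij})$ in the group $N(R)$ of lower-triangular unipotent matrices with $u^t\mathcal A u=\mathcal A$, and with $s=(s_1,\dots,s_m)\in (R^\times)^m$ standing for the diagonal element $\mathrm{diag}(t_1,\dots,t_n)$, where: for $n$ odd, $t_i=\prod_{k=i}^{m}s_k^{-1}$ for $i\le m$, $t_{m+1}=1$ and $t_{n+1-i}=t_i^{-1}$; for $n$ even (modulo scalars), $t_i=\prod_{k=i}^{m-2}s_k^{-1}$ for $i\le m-1$, $t_m=s_{m-1}$, and $t_{n+1-i}=s_{m-1}s_m\,t_i^{-1}$ for $i\le m$. Let $\delta(s)=\prod_{i=1}^{m}s_i^{\,i^2-2im}$ if $n$ is odd, and $\delta(s)=(s_{m-1}s_m)^{-(n^2-2n)/8}\prod_{i=1}^{m-2}s_i^{\,i^2-i(n-1)}$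 if $n$ is even. Let $|\cdot|$ be the usual absolute value on $\mathbb R$, respectively the $p$-adic absolute value. Let $d^\times s=\prod_{i=1}^m ds_i/|s_i|$, let $du$ be the multiple of the measure $\prod du_{ij}$ (over the free coordinates $u_{ij}$, $j<i$, $i+j\le n$) normalized so that $N(\mathbb Z)$ has covolume $1$ in $N(\mathbb R)$, respectively $N(\mathbb Z_p)$ has volume $1$, and put $dh=|\delta(s)|^{-1}\,du\,d^\times s$. Let $dB$ and $df$ be the Euclidean measures on $W_0(R)$ (coordinates $b_{ij}$, $i\le j$, $i+j\ge n$) and on $U(R)$; that is, products of Lebesgue measure on $\mathbb R$, respectively of the Haar measure of total mass $1$ on $\mathbb Z_p$. Then there is a nonzero rational number $\mathcal J$, depending only on $n$, such that for $R=\mathbb R$ and for $R=\mathbb Z_p$ with any prime $p$, the measure $dh$ is right-invariant on $\mathcal P(R)$, and $$\int_{W_0(R)}\phi(B)\,|\lambda(B)|\,dB=|\mathcal J|\int_{\substack{f\in U(R)\\ \operatorname{disc}(f)\ne0}}\Bigl(\sum_{B\in \operatorname{inv}^{-1}(f)_0/\mathcal P(R)}\int_{\mathcal P(R)}\phi(h\cdot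 B)\,dh\Bigr)df$$ for every measurable $\phi:W_0(R)\to[0,\infty]$, and for every measurable $\phi:W_0(R)\to\mathbb R$ for which the left-hand side converges absolutely (in which case, for almost every $f$, the inner integrals converge absolutely and the sum converges, and the outer integral converges absolutely). -/

import Mathlib

open MeasureTheory Polynomial
open scoped ENNReal NNReal Matrix MatrixGroups

namespace ReducibleOrbits

/-- Matrices carry the product sigma-algebra. -/
instance instMeasurableSpaceMatrix {m n R : Type*} [MeasurableSpace R] :
    MeasurableSpace (Matrix m n R) :=
  inferInstanceAs (MeasurableSpace (m → n → R))

/-- The `p`-adic integers carry their Borel sigma-algebra. -/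
noncomputable instance instMeasurableSpacePadicInt (p : ℕ) [Fact p.Prime] : MeasurableSpace ℤ_[p] :=
  borel ℤ_[p]

instance instBorelSpacePadicInt (p : ℕ) [Fact p.Prime] : BorelSpace ℤ_[p] := ⟨rfl⟩

/-- The Haar measure on the additive group `ℤ_p` of total mass `1`. -/
noncomputable def padicHaar (p : ℕ) [Fact p.Prime] : Measure ℤ_[p] :=
  Measure.addHaarMeasure ⊤

section Algebra

variable (n : ℕ) (R : Type*) [CommRing R]

/-- The anti-diagonal `n × n` matrix `𝒜` with all anti-diagonal entries equal to `1`. -/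
def antiDiag : Matrix (Fin n) (Fin n) R :=
  Matrix.of fun i j => if j = i.rev then 1 else 0

variable {n R} in
lemma antiDiag_mul_self : antiDiag n R * antiDiag n R = 1 := by
  ext i j
  simp only [antiDiag, Matrix.mul_apply, Matrix.of_apply, Matrix.one_apply, mul_ite, mul_one,
    mul_zero]
  rw [Finset.sum_eq_single i.rev]
  · simp [eq_comm]
  · intro k _ hk
    simp [hk]
  · simp

/-- For odd `n`, this is the special orthogonal group
`{g ∈ SL_n(R) : gᵀ 𝒜 g = 𝒜}` (with `c = 1` recorded in the second component).
For even `n`, it is the group of orthogonal similitudes of `𝒜`, i.e. pairs `(g, c)` with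
`gᵀ 𝒜 g = c 𝒜`. -/
def similitudes : Subgroup (GL (Fin n) R × Rˣ) where
  carrier := {x | x.1.valᵀ * antiDiag n R * x.1.val
      = (x.2 : R) • antiDiag n R ∧ (Odd n → x.2 = 1 ∧ x.1.val.det = 1)}
  mul_mem' := by
    rintro ⟨g, c⟩ ⟨h, d⟩ ⟨hg, hg'⟩ ⟨hh, hh'⟩
    refine ⟨?_, fun ho => ⟨?_, ?_⟩⟩
    · simp only [Prod.mk_mul_mk, Units.val_mul, Matrix.transpose_mul] at *
      calc _ = h.valᵀ * (g.valᵀ * antiDiag n R * g.val)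
              * h.val := by simp only [Matrix.mul_assoc]
        _ = _ := by rw [hg, Matrix.mul_smul, Matrix.smul_mul, hh, smul_smul]
    · have h1 : c = 1 := (hg' ho).1
      have h2 : d = 1 := (hh' ho).1
      change c * d = 1
      rw [h1, h2, one_mul]
    · have h1 := (hg' ho).2
      have h2 := (hh' ho).2
      simp only [Prod.mk_mul_mk, Units.val_mul, Matrix.det_mul] at *
      rw [h1, h2, one_mul]
  one_mem' := by simp
  inv_mem' := by
    rintro ⟨g, c⟩ ⟨hg, hg'⟩
    have hgi : g.val * (g⁻¹).val = 1 := by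
      rw [← Units.val_mul, mul_inv_cancel, Units.val_one]
    refine ⟨?_, fun ho => ⟨?_, ?_⟩⟩
    · simp only [Prod.inv_mk] at *
      have hgt : (g⁻¹).valᵀ * g.valᵀ = 1 := by
        rw [← Matrix.transpose_mul, hgi, Matrix.transpose_one]
      have key : antiDiag n R = (c : R) •
          ((g⁻¹).valᵀ * antiDiag n R *
            (g⁻¹).val) := by
        calc antiDiag n R
            = ((g⁻¹).valᵀ * g.valᵀ) * antiDiag n R *
              (g.val * (g⁻¹).val) := by
              rw [hgi, hgt, one_mul, mul_one]
          _ = (g⁻¹).valᵀ *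
              (g.valᵀ * antiDiag n R * g.val) *
              (g⁻¹).val := by simp only [Matrix.mul_assoc]
          _ = _ := by rw [hg, Matrix.mul_smul, Matrix.smul_mul]
      conv_rhs => rw [key]
      rw [smul_smul, Units.inv_mul, one_smul]
    · simp only [Prod.inv_mk, inv_eq_one]
      exact (hg' ho).1
    · have h1 := (hg' ho).2
      have h2 := congrArg Matrix.det hgi
      simp only [Matrix.det_mul, Matrix.det_one, Prod.inv_mk] at *
      rwa [h1, one_mul] at h2

variable {n R} in
lemma mem_similitudes (g : GL (Fin n) R) (c : Rˣ) : (g, c) ∈ similitudes n R ↔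
    g.valᵀ * antiDiag n R * g.val = (c : R) • antiDiag n R ∧
      (Odd n → c = 1 ∧ g.val.det = 1) := Iff.rfl

/-- The scalar similitudes `(r · 1, r²)`. For odd `n` this is the trivial subgroup,
since `r² = 1` and `rⁿ = 1` force `r = 1`. -/
def scalars : Subgroup (similitudes n R) where
  carrier := {x | ∃ r : Rˣ, x.1.1.val = (r : R) • 1 ∧ x.1.2 = r ^ 2}
  mul_mem' := by
    rintro x y ⟨r, hr, hr'⟩ ⟨t, ht, ht'⟩
    refine ⟨r * t, ?_, ?_⟩
    · simp [hr, ht, smul_smul, mul_comm]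
    · simp [hr', ht', mul_pow]
  one_mem' := ⟨1, by simp, by simp⟩
  inv_mem' := by
    rintro x ⟨r, hr, hr'⟩
    refine ⟨r⁻¹, ?_, ?_⟩
    · have h1 : x.1.1.val * (x.1.1⁻¹).val = 1 := by
        rw [← Units.val_mul, mul_inv_cancel, Units.val_one]
      rw [hr, Matrix.smul_mul, one_mul] at h1
      simp only [InvMemClass.coe_inv, Prod.fst_inv]
      rw [← h1, smul_smul, Units.inv_mul, one_smul]
    · simp [hr']

instance scalars_normal : (scalars n R).Normal where
  conj_mem := by
    rintro x ⟨r, hr, hr'⟩ y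
    refine ⟨r, ?_, ?_⟩
    · have h1 : y.1.1.val * (y.1.1⁻¹).val = 1 := by
        rw [← Units.val_mul, mul_inv_cancel, Units.val_one]
      simp only [Subgroup.coe_mul, InvMemClass.coe_inv, Prod.fst_mul, Prod.fst_inv, Units.val_mul,
        hr, Matrix.mul_smul, Matrix.smul_mul, mul_one, h1]
    · simp [hr', mul_comm]

/-- The group `G(R)`. For odd `n` it is `SO_𝒜(R)`. For even `n` it is the group of `R`-points of
`O_𝒜/μ₂`, for rings `R` with trivial Picard group (such as `ℝ` and `ℤ_p`): every such point is
`g / √c` for an orthogonal similitude `g` over `R` with multiplier `c`, and `g` is unique up to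
scalars in `Rˣ`. -/
abbrev G : Type _ := similitudes n R ⧸ scalars n R

/-- `W(R)`: symmetric `n × n` matrices over `R`. -/
abbrev W : Type _ := {B : Matrix (Fin n) (Fin n) R // B.IsSymm}

/-- `(g, c)` acts on `W` by `B ↦ c⁻¹ g B gᵀ`, i.e. by `B ↦ γ B γᵀ` with `γ = g / √c`.
Since `(γ⁻¹)ᵀ = 𝒜 γ 𝒜`, this differs from `B ↦ (γ⁻¹)ᵀ B γ⁻¹` only by the automorphism
`γ ↦ 𝒜 γ 𝒜` of `G`; it is the form for which the lower-triangular subgroup preserves `W₀`. -/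
instance actSimilitudes : MulAction (similitudes n R) (W n R) where
  smul x B := ⟨((x.1.2⁻¹ : Rˣ) : R) • (x.1.1.val * B.1 * x.1.1.valᵀ), by
    have := B.2
    simp only [Matrix.IsSymm, Matrix.transpose_smul, Matrix.transpose_mul,
      Matrix.transpose_transpose] at *
    rw [this, Matrix.mul_assoc]⟩
  one_smul B := by
    apply Subtype.ext
    change ((((1 : similitudes n R).1.2⁻¹ : Rˣ) : R)) • (_ * _ * _) = _
    simp
  mul_smul x y B := by
    apply Subtype.ext
    change (((x * y).1.2⁻¹ : Rˣ) : R) • (((x * y).1.1 : Matrix _ _ R) * B.1 *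
      ((x * y).1.1 : Matrix _ _ R)ᵀ) = ((x.1.2⁻¹ : Rˣ) : R) • (x.1.1.val *
      (((y.1.2⁻¹ : Rˣ) : R) • (y.1.1.val * B.1 * y.1.1.valᵀ)) *
      x.1.1.valᵀ)
    simp [smul_smul, Matrix.mul_assoc, Matrix.transpose_mul, mul_comm]

variable {n R} in
lemma coe_smul_similitudes (x : similitudes n R) (B : W n R) :
    ((x • B : W n R) : Matrix (Fin n) (Fin n) R) =
      ((x.1.2⁻¹ : Rˣ) : R) • (x.1.1.val * B.1 * x.1.1.valᵀ) := rfl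

/-- The action of `G(R)` on `W(R)`, as a homomorphism to permutations. -/
def actHom : G n R →* Equiv.Perm (W n R) :=
  QuotientGroup.lift (scalars n R) (MulAction.toPermHom (similitudes n R) (W n R)) (by
    rintro x ⟨r, hr, hr'⟩
    ext1 B
    apply Subtype.ext
    rw [MulAction.toPermHom_apply, MulAction.toPerm_apply, coe_smul_similitudes, hr, hr']
    simp only [Matrix.smul_mul, one_mul, Matrix.transpose_smul, Matrix.transpose_one,
      Matrix.mul_smul, mul_one, smul_smul, Equiv.Perm.coe_one, id_eq]
    rw [← Units.val_mul, ← Units.val_mul, sq]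
    simp)

instance actG : MulAction (G n R) (W n R) := MulAction.compHom (W n R) (actHom n R)

variable {n R} in
lemma mk_smul (x : similitudes n R) (B : W n R) : ((x : G n R) • B : W n R) = x • B := rfl

/-- The lower-triangular similitudes. -/
def lowerTriangular : Subgroup (similitudes n R) where
  carrier := {x | ∀ i j, i < j → x.1.1.val i j = 0}
  mul_mem' := by
    intro x y hx hy i j hij
    simp only [Subgroup.coe_mul, Prod.fst_mul, Units.val_mul, Matrix.mul_apply]
    refine Finset.sum_eq_zero fun k _ => ?_
    rcases lt_or_ge i k with h | h
    · rw [hx i k h, zero_mul]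
    · rw [hy k j (h.trans_lt hij), mul_zero]
  one_mem' := by
    intro i j hij
    simp [hij.ne]
  inv_mem' := by
    intro x hx i j hij
    have h1 : Matrix.BlockTriangular x.1.1.val OrderDual.toDual :=
      fun i j hij => hx i j hij
    have : Invertible x.1.1.val := x.1.1.invertible
    have h2 := Matrix.blockTriangular_inv_of_blockTriangular h1
    simp only [InvMemClass.coe_inv, Prod.fst_inv, Matrix.coe_units_inv]
    exact h2 hij

/-- The lower-triangular subgroup `𝒫(R)` of `G(R)`. -/
def P : Subgroup (G n R) := (lowerTriangular n R).map (QuotientGroup.mk' (scalars n R))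

/-- The reducible hyperplane `W₀(R)`: the symmetric matrices `[b_ij]` with `b_ij = 0` whenever
`i + j < n` (indices starting at `1`), with the action of `𝒫(R)` on it. -/
def W₀ : SubMulAction (P n R) (W n R) where
  carrier := {B | ∀ i j : Fin n, (i + 1 : ℕ) + (j + 1) < n → B.1 i j = 0}
  smul_mem' := by
    rintro ⟨_, x, hx, rfl⟩ B hB i j hij
    change ((x • B : W n R) : Matrix (Fin n) (Fin n) R) i j = 0
    rw [coe_smul_similitudes]
    simp only [Matrix.smul_apply, smul_eq_mul, Matrix.mul_apply, Matrix.transpose_apply]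
    rw [Finset.sum_eq_zero, mul_zero]
    intro k _
    rcases lt_or_ge j k with h | h
    · rw [hx j k h, mul_zero]
    rw [Finset.sum_eq_zero, zero_mul]
    intro l _
    rcases lt_or_ge i l with h' | h'
    · rw [hx i l h', zero_mul]
    · rw [hB l k (by rw [Fin.le_def] at h h'; omega), mul_zero]

variable {n R}

/-- The invariant polynomial `inv(B) = (-1)^⌊n/2⌋ det(x𝒜 + B)`. -/
noncomputable def inv (B : W n R) : R[X] :=
  (-1) ^ (n / 2) * ((X : R[X]) • (antiDiag n R).map C + B.1.map C).det

lemma inv_smul (x : similitudes n R) (B : W n R) : inv (x • B) = inv B := by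
  obtain ⟨⟨g, c⟩, hx⟩ := x
  obtain ⟨hg, hg'⟩ := (mem_similitudes g c).mp hx
  have hd : ((c⁻¹ : Rˣ) : R) ^ n * g.val.det ^ 2 = 1 := by
    have hA : (antiDiag n R).det * (antiDiag n R).det = 1 := by
      rw [← Matrix.det_mul, antiDiag_mul_self, Matrix.det_one]
    have h := congrArg Matrix.det hg
    simp only [Matrix.det_mul, Matrix.det_transpose, Matrix.det_smul, Fintype.card_fin] at h
    have h2 : g.val.det ^ 2 = (c : R) ^ n := by
      linear_combination (antiDiag n R).det * h +
        ((c : R) ^ n - g.val.det ^ 2) * hA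
    rw [h2, ← mul_pow, Units.inv_mul, one_pow]
  have hgA : ((c⁻¹ : Rˣ) : R) • (g.val * antiDiag n R * g.valᵀ)
      = antiDiag n R := by
    have h1 : (((c⁻¹ : Rˣ) : R) • (antiDiag n R * g.valᵀ * antiDiag n R)) *
        g.val = 1 := by
      rw [Matrix.smul_mul, Matrix.mul_assoc, Matrix.mul_assoc, ← Matrix.mul_assoc _ᵀ, hg,
        Matrix.mul_smul, antiDiag_mul_self, smul_smul, Units.inv_mul, one_smul]
    have h2 := mul_eq_one_comm.mp h1
    have h3 := congrArg (· * antiDiag n R) h2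
    simp only [Matrix.mul_smul, Matrix.smul_mul, one_mul] at h3
    refine Eq.trans ?_ h3
    congr 1
    simp only [Matrix.mul_assoc, antiDiag_mul_self, mul_one]
  unfold inv
  congr 1
  rw [coe_smul_similitudes]
  simp only
  have key : (X : R[X]) • (antiDiag n R).map C +
      (((c⁻¹ : Rˣ) : R) • (g.val * B.1 * g.valᵀ)).map C =
      C ((c⁻¹ : Rˣ) : R) • (g.val.map C * ((X : R[X]) • (antiDiag n R).map C +
        B.1.map C) * (g.valᵀ).map C) := by
    have hm : ∀ M : Matrix (Fin n) (Fin n) R,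
        (((c⁻¹ : Rˣ) : R) • (g.val * M * g.valᵀ)).map C =
        C ((c⁻¹ : Rˣ) : R) • (g.val.map C * M.map C *
          (g.valᵀ).map C) := by
      intro M
      rw [Matrix.map_smul' _ _ _ (fun a b => C_mul), Matrix.map_mul, Matrix.map_mul]
    conv_lhs => rw [← hgA]
    rw [hm, hm]
    simp only [Matrix.mul_add, Matrix.add_mul, Matrix.mul_smul, Matrix.smul_mul, smul_add]
    rw [smul_comm]
  rw [key, Matrix.det_smul, Matrix.det_mul, Matrix.det_mul, Fintype.card_fin,
    Matrix.transpose_map, Matrix.det_transpose]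
  have h4 : (g.val.map (C : R → R[X])).det = C g.val.det :=
    (RingHom.map_det (C : R →+* R[X]) g.val).symm
  rw [h4]
  have h5 := congrArg (C : R → R[X]) hd
  simp only [C_mul, C_pow, C_1] at h5
  linear_combination ((X : R[X]) • (antiDiag n R).map C + B.1.map C).det * h5

/-- The fibre `inv⁻¹(f)₀ = inv⁻¹(f) ∩ W₀(R)`, with the action of `𝒫(R)` on it. -/
def fiber₀ (f : R[X]) : SubMulAction (P n R) (W₀ n R) where
  carrier := {B | inv B.1 = f}
  smul_mem' := by
    rintro ⟨_, x, hx, rfl⟩ B hB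
    change inv (x • B.1) = f
    rw [inv_smul]
    exact hB

/-- The set of orbits `inv⁻¹(f)₀ / 𝒫(R)`. -/
abbrev Orbits₀ (n : ℕ) {R : Type*} [CommRing R] (f : R[X]) : Type _ :=
  MulAction.orbitRel.Quotient (P n R) (fiber₀ (n := n) f)

/-- A representative in `W₀(R)` of an orbit in `inv⁻¹(f)₀ / 𝒫(R)`. -/
noncomputable def rep {f : R[X]} (ω : Orbits₀ n f) : W₀ n R := (Quotient.out ω : fiber₀ f).1

/-- The entry `b_ij` of `B`, with indices `1 ≤ i, j ≤ n` starting at `1`. -/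
def b (B : W n R) (i j : ℕ) : R :=
  if h : (1 ≤ i ∧ i ≤ n) ∧ (1 ≤ j ∧ j ≤ n) then
    B.1 ⟨i - 1, by omega⟩ ⟨j - 1, by omega⟩ else 0

/-- The polynomial function `λ` on `W₀`. -/
def lam (B : W₀ n R) : R :=
  if Odd n then ∏ i ∈ Finset.Icc 1 (n / 2), b B.1 i (n - i) ^ (2 * i - 1)
  else b B.1 (n / 2) (n / 2) ^ ((n - 2) / 2) *
    ∏ i ∈ Finset.Icc 1 ((n - 2) / 2), b B.1 i (n - i) ^ (2 * i - 1)

/-- The monic polynomial `xⁿ + ∑_{i < n} a_i xⁱ`; this identifies `U(R)` with `Rⁿ`. -/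
noncomputable def monicPoly (a : Fin n → R) : R[X] :=
  X ^ n + ∑ i : Fin n, C (a i) * X ^ (i : ℕ)

/-- The coordinate `s_k`, with index `1 ≤ k ≤ ⌊n/2⌋` starting at `1`. -/
def sc (s : Fin (n / 2) → Rˣ) (k : ℕ) : Rˣ :=
  if h : 1 ≤ k ∧ k ≤ n / 2 then s ⟨k - 1, by omega⟩ else 1

/-- The multiplier of the similitude `torusEntry s`: it is `1` if `n` is odd and
`s_{(n-2)/2} s_{n/2}` if `n` is even. -/
def torusMult (s : Fin (n / 2) → Rˣ) : Rˣ :=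
  if Odd n then 1 else sc s (n / 2 - 1) * sc s (n / 2)

/-- The first `⌈n/2⌉` diagonal entries of the torus element with coordinates `s`. For odd `n`,
the `i`-th entry is `∏_{k=i}^{⌊n/2⌋} s_k⁻¹`. For even `n` the entries
`𝔰⁻¹ ∏_{k=i}^{(n-4)/2} s_k⁻¹` (`i < n/2`) and `𝔰⁻¹ s_{(n-2)/2}` (`i = n/2`), where
`𝔰² = s_{(n-2)/2} s_{n/2}`, are all multiplied by `𝔰`, which does not change
the class in `G`. -/
def torusHalf (s : Fin (n / 2) → Rˣ) (i : ℕ) : Rˣ :=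
  if Odd n then ∏ k ∈ Finset.Icc i (n / 2), (sc s k)⁻¹
  else if i < n / 2 then ∏ k ∈ Finset.Icc i ((n - 4) / 2), (sc s k)⁻¹
  else sc s (n / 2 - 1)

/-- The diagonal entries `t_1, …, t_n` (with `t_i t_{n+1-i}` equal to the multiplier). -/
def torusEntry (s : Fin (n / 2) → Rˣ) (i : Fin n) : Rˣ :=
  if 2 * (i + 1 : ℕ) ≤ n + 1 then torusHalf s (i + 1)
  else torusMult s * (torusHalf s (n - i))⁻¹

lemma torusEntry_mul_rev (s : Fin (n / 2) → Rˣ) (i : Fin n) :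
    torusEntry s i * torusEntry s i.rev = torusMult s := by
  have hi := i.2
  have hr : (i.rev : ℕ) = n - (i + 1) := Fin.val_rev i
  unfold torusEntry
  rw [hr]
  rcases lt_trichotomy (2 * (i + 1 : ℕ)) (n + 1) with h | h | h
  · rw [if_pos h.le, if_neg (by omega), show n - (n - (i + 1 : ℕ)) = i + 1 by omega]
    rw [mul_comm, inv_mul_cancel_right]
  · have ho : Odd n := ⟨i, by omega⟩
    rw [if_pos h.le, if_pos (by omega)]
    simp only [torusHalf, torusMult, if_pos ho]
    rw [Finset.Icc_eq_empty (by omega), Finset.Icc_eq_empty (by omega)]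
    simp
  · rw [if_neg (by omega), if_pos (by omega), show n - (i + 1 : ℕ) + 1 = n - i by omega]
    rw [inv_mul_cancel_right]

/-- The diagonal matrix with coordinates `s`, as an element of `GL_n(R)`. -/
def torusGL (s : Fin (n / 2) → Rˣ) : GL (Fin n) R where
  val := Matrix.diagonal fun i => (torusEntry s i : R)
  inv := Matrix.diagonal fun i => (((torusEntry s i)⁻¹ : Rˣ) : R)
  val_inv := by simp
  inv_val := by simp

/-- The torus element with coordinates `s`. -/
def torus (s : Fin (n / 2) → Rˣ) : similitudes n R :=
  ⟨(torusGL s, torusMult s), by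
    refine (mem_similitudes _ _).mpr ⟨?_, fun ho => ⟨by simp [torusMult, ho], ?_⟩⟩
    · ext i j
      simp only [torusGL, Matrix.diagonal_transpose, Matrix.mul_diagonal, Matrix.diagonal_mul,
        Matrix.smul_apply, smul_eq_mul, antiDiag, Matrix.of_apply]
      split_ifs with h
      · subst h
        rw [mul_one, mul_one, ← Units.val_mul, torusEntry_mul_rev]
      · simp
    · simp only [torusGL, Matrix.det_diagonal]
      have hm : torusMult s = 1 := by simp [torusMult, ho]
      refine Finset.prod_involution (fun i _ => i.rev) ?_ ?_ (fun _ _ => Finset.mem_univ _)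
        (fun _ _ => Fin.rev_rev _)
      · intro i _
        rw [← Units.val_mul, torusEntry_mul_rev, hm, Units.val_one]
      · intro i _ hi hrev
        apply hi
        have h1 := congrArg Fin.val hrev
        rw [Fin.val_rev] at h1
        have h2 := i.2
        rw [torusEntry, if_pos (by omega), torusHalf, if_pos ho,
          Finset.Icc_eq_empty (by omega)]
        simp⟩

/-- The modulus character `δ(s)`. -/
def delta (s : Fin (n / 2) → Rˣ) : Rˣ :=
  if Odd n then ∏ k ∈ Finset.Icc 1 (n / 2), sc s k ^ ((k : ℤ) ^ 2 - 2 * k * (n / 2 : ℕ))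
  else (sc s (n / 2 - 1) * sc s (n / 2)) ^ (-(((n : ℤ) ^ 2 - 2 * n) / 8)) *
    ∏ k ∈ Finset.Icc 1 ((n - 4) / 2), sc s k ^ ((k : ℤ) ^ 2 - k * ((n : ℤ) - 1))

variable (n R)

/-- `N(R)`: the lower-triangular unipotent matrices `u` with `uᵀ 𝒜 u = 𝒜`. -/
abbrev N : Type _ := {u : Matrix (Fin n) (Fin n) R //
  uᵀ * antiDiag n R * u = antiDiag n R ∧ (∀ i, u i i = 1) ∧ ∀ i j, i < j → u i j = 0}

/-- Index set of the free coordinates `u_ij` on `N`: `2 ≤ i ≤ n - 1` and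
`1 ≤ j ≤ min (i - 1) (n - i)`, with indices starting at `1`. -/
abbrev NIndex : Type := {ij : Fin n × Fin n // ij.2 < ij.1 ∧ (ij.1 + 1 : ℕ) + (ij.2 + 1) ≤ n}

/-- Index set of the coordinates `b_ij` on `W₀`: `i ≤ j` and `n ≤ i + j`, with indices starting
at `1`. -/
abbrev W₀Index : Type := {ij : Fin n × Fin n // ij.1 ≤ ij.2 ∧ n ≤ (ij.1 + 1 : ℕ) + (ij.2 + 1)}

variable {n R}

lemma N_det (u : N n R) : u.1.det = 1 := by
  have h1 : Matrix.BlockTriangular u.1 OrderDual.toDual := fun i j hij => u.2.2.2 i j hij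
  refine (Matrix.det_of_isLowerTriangular u.1 h1).trans ?_
  exact Finset.prod_eq_one fun i _ => u.2.2.1 i

/-- `N(R)` inside the (special) orthogonal group. -/
def unip (u : N n R) : similitudes n R :=
  ⟨(Matrix.SpecialLinearGroup.toGL ⟨u.1, N_det u⟩, 1), by
    refine (mem_similitudes _ _).mpr ⟨?_, fun _ => ⟨rfl, N_det u⟩⟩
    rw [Units.val_one, one_smul]
    exact u.2.1⟩

/-- The coordinates `u_ij` on `N(R)`. -/
def NCoord (u : N n R) : NIndex n → R := fun ij => u.1 ij.1.1 ij.1.2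

/-- The element `s u` of `𝒫(R)`. -/
def toP (x : (Fin (n / 2) → Rˣ) × N n R) : P n R :=
  ⟨QuotientGroup.mk' _ (torus x.1 * unip x.2), Subgroup.mem_map_of_mem _ (by
    refine (lowerTriangular n R).mul_mem ?_ x.2.2.2.2
    intro i j hij
    exact Matrix.diagonal_apply_ne _ hij.ne)⟩

/-- The element of `W₀(R)` with coordinates `b_ij`. -/
def W₀ofCoord (x : W₀Index n → R) : W₀ n R :=
  ⟨⟨Matrix.of fun i j => if h : n ≤ (i + 1 : ℕ) + (j + 1) then
      x ⟨(min i j, max i j), min_le_max, by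
        rcases le_total i j with h' | h' <;> simp [h'] <;> omega⟩ else 0, by
    ext i j
    simp only [Matrix.transpose_apply, Matrix.of_apply, min_comm j i, max_comm j i,
      add_comm (j + 1 : ℕ)]⟩, by
    intro i j hij
    simp only [Matrix.of_apply]
    rw [dif_neg (by omega)]⟩

end Algebra

section Measures

/-! Throughout, `μ` is the standard additive Haar measure on `R`: Lebesgue measure on `ℝ`, and
the Haar measure of total mass `1` on `ℤ_p`. -/

variable (n : ℕ) {R : Type*} [NormedCommRing R] [MeasurableSpace R] (μ : Measure R)

/-- The Euclidean measure `dB` on `W₀(R)`. -/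
noncomputable def dB : Measure (W₀ n R) :=
  (Measure.pi fun _ : W₀Index n => μ).map W₀ofCoord

/-- The Euclidean measure `df` on `U(R) = Rⁿ`. -/
noncomputable def df : Measure (Fin n → R) := Measure.pi fun _ => μ

/-- The multiplicative measure `ds / |s|` on `Rˣ`. -/
noncomputable def dUnits : Measure Rˣ :=
  (μ.comap Units.val).withDensity fun s => ENNReal.ofReal ‖(s : R)‖⁻¹

/-- The measure `d^×s = ∏ ds_i / |s_i|`. -/
noncomputable def ds : Measure (Fin (n / 2) → Rˣ) := Measure.pi fun _ => dUnits μ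

/-- The Haar measure `du = ∏ du_ij` on `N(R)`, normalized so that `N(ℤ)` has covolume `1` in
`N(ℝ)` and `N(ℤ_p)` has volume `1`. For even `n` all `u_ij` are free integral coordinates on
`N(ℤ)`. For odd `n` the `⌊n/2⌋` coordinates `u_ij` with `i = (n+1)/2` are even on `N(ℤ)` (and
the only constraint is this), whence the factor `|2|^{-⌊n/2⌋}`. -/
noncomputable def du : Measure (N n R) :=
  (if Odd n then ENNReal.ofReal (‖(2 : R)‖ ^ (n / 2))⁻¹ else 1) •
    (Measure.pi fun _ : NIndex n => μ).comap NCoord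

/-- The right Haar measure `dh = |δ(s)|⁻¹ du d^×s` on `𝒫(R)`, where `h = s u`. -/
noncomputable def dh : Measure (P n R) :=
  (((ds n μ).prod (du n μ)).withDensity
    fun x => ENNReal.ofReal ‖(((delta x.1)⁻¹ : Rˣ) : R)‖).map toP

/-- The change-of-variables formula
`∫_{W₀(R)} φ(B) |λ(B)| dB
  = κ ∫_{f ∈ U(R), disc f ≠ 0} ∑_{B ∈ inv⁻¹(f)₀ / 𝒫(R)} ∫_{𝒫(R)} φ(h · B) dh df`,
for all measurable functions `φ` on `W₀(R)` with values in `[0, ∞]`, and for all measurable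
real-valued `φ` for which the left-hand side converges absolutely (in which case all the
integrals and sums on the right-hand side converge as well). -/
def ChangeOfVariables (κ : ℝ≥0) : Prop :=
  (∀ φ : W₀ n R → ℝ≥0∞, AEMeasurable φ (dB n μ) →
    ∫⁻ B, φ B * ‖lam B‖ₑ ∂(dB n μ) =
      κ * ∫⁻ a in {a | (monicPoly a).discr ≠ 0},
        (∑' ω : Orbits₀ n (monicPoly a), ∫⁻ h, φ (h • rep ω) ∂(dh n μ)) ∂(df n μ)) ∧
  (∀ φ : W₀ n R → ℝ, AEMeasurable φ (dB n μ) →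
    Integrable (fun B => φ B * ‖lam B‖) (dB n μ) →
    (∀ᵐ a ∂(df n μ).restrict {a | (monicPoly a).discr ≠ 0},
      (∀ ω : Orbits₀ n (monicPoly a), Integrable (fun h => φ (h • rep ω)) (dh n μ)) ∧
      Summable fun ω : Orbits₀ n (monicPoly a) => ∫ h, φ (h • rep ω) ∂(dh n μ)) ∧
    IntegrableOn (fun a => ∑' ω : Orbits₀ n (monicPoly a), ∫ h, φ (h • rep ω) ∂(dh n μ))
      {a | (monicPoly a).discr ≠ 0} (df n μ) ∧
    ∫ B, φ B * ‖lam B‖ ∂(dB n μ) =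
      κ * ∫ a in {a | (monicPoly a).discr ≠ 0},
        (∑' ω : Orbits₀ n (monicPoly a), ∫ h, φ (h • rep ω) ∂(dh n μ)) ∂(df n μ))

end Measures

end ReducibleOrbits

/-!
# The change of variables on `W₀`

The formula is proved over a field `K` (`ℝ` or `ℚ_p`) and then descends to the ring `R` (`ℝ` or
`ℤ_p`) inside `K`.

**The slice.** Let `B ∈ W₀` have ones on the line `i + j = n`, and let `T = 𝒜B`. Then `T` is a
Hessenberg matrix with ones below the diagonal, and it is self-adjoint for the form `𝒜`. The vectors
`e₁, Te₁, …, Tⁿ⁻¹e₁` form a unipotent matrix, whose Gram matrix with respect to `𝒜` is a Hankel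
matrix determined by the characteristic polynomial of `T`, which is `inv B` up to signs of the
coefficients (`krylov_gram_congr`). Carrying the vectors of `B` to those of `B'` is therefore an
isometry if `inv B = inv B'`: the group `N` acts simply transitively on the elements of the slice
with a given invariant polynomial (`exists_unip_smul_eq`, `unip_smul_injective`).

**The Jacobian on the slice.** The map `theta` sends `B` to the free entries of the vectors `Tᵏe₁`
and to the coefficients of `inv B`. With the coordinates ordered by their distance from the line
`i + j = n`, it is triangular with constant diagonal: an entry of a vector contributes `1`, and the
coefficient of `xᵏ` contributes `±1` for even `k` and `±2` for odd `k`, because a symmetric matrix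
has either one entry `(i, i)` or two equal entries `(i, i + 1)`, `(i + 1, i)` in the middle of a
line `i + j = const` (`theta_triangular`). Hence Lebesgue measure on the slice is
`|2|^{-⌊n/2⌋} ∏ du_ij df` (`lintegral_slice`).

**The torus.** The torus acts simply transitively on the invertible values of the entries on the
line `i + j = n` (`chi_bijective`). The exponents in `λ` are those for which scaling by `s` turns
`|λ| dB` into `|δ(s)|⁻¹` times the measure on the slice times `d^×s` (`prod_chi_mul_prod_wt`).
This gives the formula over `K` (`lintegral_W₀_eq`), with a single free orbit for each polynomial.
For odd `n` the factor `|2|^{-⌊n/2⌋}` belongs to the normalization of `du`, and for even `n` it is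
`|𝒥|`; so `𝒥 = 1` or `𝒥 = 2^{-n/2}`, see `jacobian`.

**Descent to the ring.** All measures over `R` are restrictions of those over `K` (`IsRestriction`).
If `disc f ≠ 0`, then no entry of `B ∈ inv⁻¹(f)₀` on the line `i + j = n` vanishes, since otherwise
`T` would be block triangular and `inv B` would have a square factor (`exists_sq_dvd_inv`). So
`inv⁻¹(f)₀` lies in one free orbit of `𝒫(K)`, in which the orbits of `𝒫(R)` correspond to disjoint
open cosets of `𝒫(R)`; the sum over the orbits is the integral over `𝒫(K)` of the function extended
by zero (`tsum_orbits_eq`). The polynomials with `disc f = 0` form a null set (`ae_separable`).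
Right invariance of `dh` is inherited from `𝒫(K)` too; there it holds because conjugation by `s`
scales `∏ du_ij` by `|δ(s)|⁻¹` (`measurePreserving_mulTN`).
-/

namespace ReducibleOrbits

set_option linter.unusedSectionVars false

/-! ### Triangular maps on product spaces -/

section Shear

variable {ι X : Type*} [Fintype ι] [DecidableEq ι] [MeasurableSpace X] [Nonempty X]

/-- One layer of a triangular map: the coordinates satisfying `p` are kept, and each of the other
ones is moved by a map of one variable which depends on the coordinates satisfying `p`. -/
lemma measurePreserving_pi_layer (p : ι → Prop) [DecidablePred p] (G : (ι → X) → ι → X)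
    (hG : Measurable G) (hp : ∀ i x, p i → G x i = x i)
    (hdep : ∀ i x y, ¬ p i → (∀ j, p j → x j = y j) → x i = y i → G x i = G y i)
    (μ ν : ι → Measure X) [∀ i, SigmaFinite (μ i)] [∀ i, SigmaFinite (ν i)]
    (hμν : ∀ i, p i → ν i = μ i)
    (hmap : ∀ i x, ¬ p i →
      Measure.map (fun t => G (Function.update x i t) i) (μ i) = ν i) :
    MeasurePreserving G (Measure.pi μ) (Measure.pi ν) := by
  -- Over fixed values of the kept coordinates, the layer is a product of maps of one variable.
  set e := MeasurableEquiv.piEquivPiSubtypeProd (fun _ : ι => X) p with he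
  let H : ({i // p i} → X) → ({i // ¬ p i} → X) → ({i // ¬ p i} → X) :=
    fun a b => (e (G (e.symm (a, b)))).2
  have hsymm1 : ∀ (a) (b) (i : ι) (hi : p i), e.symm (a, b) i = a ⟨i, hi⟩ := by
    intro a b i hi
    simp [he, MeasurableEquiv.piEquivPiSubtypeProd, Equiv.piEquivPiSubtypeProd, hi]
  have hsymm2 : ∀ (a) (b) (i : ι) (hi : ¬ p i), e.symm (a, b) i = b ⟨i, hi⟩ := by
    intro a b i hi
    simp [he, MeasurableEquiv.piEquivPiSubtypeProd, Equiv.piEquivPiSubtypeProd, hi]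
  have hHm : Measurable (Function.uncurry H) :=
    measurable_snd.comp (e.measurable.comp (hG.comp e.symm.measurable))
  have hH : ∀ a, Measure.map (H a) (Measure.pi fun i : {i // ¬ p i} => μ i)
      = Measure.pi fun i : {i // ¬ p i} => ν i := by
    intro a
    obtain ⟨x₀⟩ : Nonempty X := inferInstance
    have h1 : H a = fun b i => G (Function.update (e.symm (a, fun _ => x₀)) i.1 (b i)) i.1 := by
      ext b i
      refine hdep i.1 _ _ i.2 (fun j hj => ?_) ?_
      · rw [Function.update_of_ne (by rintro rfl; exact i.2 hj), hsymm1 _ _ _ hj, hsymm1 _ _ _ hj]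
      · rw [Function.update_self, hsymm2 _ _ _ i.2]
    have h2 : ∀ i : {i // ¬ p i}, Measurable
        fun t => G (Function.update (e.symm (a, fun _ => x₀)) i.1 t) i.1 := fun i =>
      (measurable_pi_apply _).comp (hG.comp (measurable_update _))
    have h3 : ∀ i : {i // ¬ p i}, Measure.map
        (fun t => G (Function.update (e.symm (a, fun _ => x₀)) i.1 t) i.1) (μ i) = ν i := by
      intro i
      convert! hmap i.1 (e.symm (a, fun _ => x₀)) i.2
    have : ∀ i : {i // ¬ p i}, SigmaFinite (Measure.map
        (fun t => G (Function.update (e.symm (a, fun _ => x₀)) i.1 t) i.1) (μ i)) := by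
      intro i; rw [h3 i]; infer_instance
    rw [h1, Measure.pi_map_pi fun i => (h2 i).aemeasurable]
    exact congrArg _ (funext h3)
  -- Fubini's theorem over the kept coordinates.
  have key := MeasurePreserving.skew_product
    (MeasurePreserving.id (Measure.pi fun i : {i // p i} => μ i)) hHm
    (Filter.Eventually.of_forall hH)
  have h1 := measurePreserving_piEquivPiSubtypeProd μ p
  have h2 := (measurePreserving_piEquivPiSubtypeProd ν p).symm
  have h3 : (Measure.pi fun i : {i // p i} => ν i) = Measure.pi fun i : {i // p i} => μ i :=
    congrArg _ (funext fun i => hμν i.1 i.2)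
  rw [h3] at h2
  have h4 := h2.comp (key.comp h1)
  convert! h4 using 1
  ext x i
  simp only [Function.comp_apply, id]
  by_cases hi : p i
  · rw [hp i x hi, ← he, hsymm1 _ _ i hi]
    rfl
  · refine Eq.trans ?_ (hsymm2 _ _ i hi).symm
    change G x i = G (e.symm (e x)) i
    rw [e.symm_apply_apply]

/-- A map on a product space whose `i`-th component depends only on the `i`-th coordinate and on
the coordinates of smaller rank carries product measure to product measure, if each of its
components does so in its own coordinate. -/
theorem measurePreserving_pi_of_triangular (r : ι → ℕ) (F : (ι → X) → ι → X) (hF : Measurable F)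
    (hdep : ∀ i x y, (∀ j, r j < r i → x j = y j) → x i = y i → F x i = F y i)
    (μ ν : ι → Measure X) [∀ i, SigmaFinite (μ i)] [∀ i, SigmaFinite (ν i)]
    (hmap : ∀ i x, Measure.map
      (fun t => F (Function.update x i t) i) (μ i) = ν i) :
    MeasurePreserving F (Measure.pi μ) (Measure.pi ν) := by
  -- `F` is the composition of its layers; the coordinates of rank `< k` are treated last
  have step : ∀ k : ℕ, ∀ (μ : ι → Measure X) [∀ i, SigmaFinite (μ i)],
      (∀ i x, r i < k → Measure.map (fun t => F (Function.update x i t) i) (μ i) = ν i) →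
      MeasurePreserving (fun x i => if r i < k then F x i else x i) (Measure.pi μ)
        (Measure.pi fun i => if r i < k then ν i else μ i) := by
    intro k
    induction k with
    | zero =>
      intro μ _ _
      simpa using! MeasurePreserving.id (Measure.pi μ)
    | succ k ih =>
      intro μ _ h
      let μ' : ι → Measure X := fun i => if r i = k then ν i else μ i
      have : ∀ i, SigmaFinite (μ' i) := by
        intro i; simp only [μ']; split_ifs <;> infer_instance
      have hL : MeasurePreserving (fun x i => if r i = k then F x i else x i) (Measure.pi μ)
          (Measure.pi μ') := by
        refine measurePreserving_pi_layer (fun i => r i ≠ k) _ ?_ ?_ ?_ μ μ' ?_ ?_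
        · refine measurable_pi_lambda _ fun i => ?_
          split_ifs
          · exact (measurable_pi_apply i).comp hF
          · exact measurable_pi_apply i
        · intro i x hi
          simp [hi]
        · intro i x y hi hxy hi'
          rw [not_not] at hi
          simp only [hi, if_true]
          exact hdep i x y (fun j hj => hxy j (by omega)) hi'
        · intro i hi
          simp [μ', hi]
        · intro i x hi
          rw [not_not] at hi
          simp only [hi, if_true, μ']
          convert! h i x (by omega)
      have hk := ih μ' (fun i x hi => by
        simp only [μ', if_neg hi.ne]
        exact h i x (by omega))
      have hc := hk.comp hL
      convert! hc using 1
      · ext x i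
        simp only [Function.comp_apply]
        by_cases h1 : r i < k
        · rw [if_pos h1, if_pos (by omega)]
          refine hdep i _ _ (fun j hj => ?_) ?_
          · rw [if_neg (by omega)]
          · rw [if_neg (by omega)]
        · rw [if_neg h1]
          by_cases h2 : r i = k
          · rw [if_pos h2, if_pos (by omega)]
          · rw [if_neg h2, if_neg (by omega)]
      · congr 1
        ext1 i
        simp only [μ']
        by_cases h1 : r i < k
        · rw [if_pos h1, if_pos (by omega)]
        · rw [if_neg h1]
          by_cases h2 : r i = k
          · rw [if_pos h2, if_pos (by omega)]
          · rw [if_neg h2, if_neg (by omega)]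
  obtain ⟨k, hk⟩ : ∃ k, ∀ i, r i < k :=
    ⟨Finset.univ.sup r + 1, fun i => Nat.lt_succ_of_le (Finset.le_sup (Finset.mem_univ i))⟩
  have h := step k μ (fun i x _ => by convert! hmap i x)
  simpa [hk] using h

end Shear

section Triangular

variable {ι K : Type*} [Finite ι] [Field K]

/-- `F` is triangular with constant diagonal `c` with respect to the rank `r`:
`F x i = c i * x i + (a function of the coordinates of rank smaller than r i)`. -/
def IsTriangular (r : ι → ℕ) (c : ι → K) (F : (ι → K) → ι → K) : Prop :=
  ∀ i x y, (∀ j, r j < r i → x j = y j) → F x i - F y i = c i * (x i - y i)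

/-- The equation `F x = y` is solved coordinate by coordinate, in order of increasing rank. -/
lemma IsTriangular.bijective {r : ι → ℕ} {c : ι → K} {F : (ι → K) → ι → K}
    (h : IsTriangular r c F) (hc : ∀ i, c i ≠ 0) : Function.Bijective F := by
  classical
  have := Fintype.ofFinite ι
  constructor
  · intro x y hxy
    have : ∀ k i, r i < k → x i = y i := by
      intro k
      induction k with
      | zero => intro i hi; omega
      | succ k ih =>
        intro i hi
        have h1 := h i x y (fun j hj => ih j (by omega))
        rw [hxy, sub_self, eq_comm, mul_eq_zero] at h1
        exact sub_eq_zero.mp (h1.resolve_left (hc i))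
    exact funext fun i => this (r i + 1) i (Nat.lt_succ_self _)
  · intro y
    have : ∀ k, ∃ x, ∀ i, r i < k → F x i = y i := by
      intro k
      induction k with
      | zero => exact ⟨y, fun i hi => by omega⟩
      | succ k ih =>
        obtain ⟨x, hx⟩ := ih
        refine ⟨fun i => if r i = k then x i + (c i)⁻¹ * (y i - F x i) else x i, fun i hi => ?_⟩
        have h1 := h i (fun i => if r i = k then x i + (c i)⁻¹ * (y i - F x i) else x i) x
          (fun j hj => by rw [if_neg (by omega)])
        rcases Nat.lt_succ_iff_lt_or_eq.mp hi with h2 | h2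
        · rw [← hx i h2, ← sub_eq_zero, h1, if_neg (by omega)]
          ring
        · simp only [h2, if_true] at h1
          have h3 : c i * (c i)⁻¹ = 1 := mul_inv_cancel₀ (hc i)
          linear_combination h1 + (y i - F x i) * h3
    obtain ⟨x, hx⟩ := this (Finset.univ.sup r + 1)
    exact ⟨x, funext fun i => hx i (Nat.lt_succ_of_le (Finset.le_sup (Finset.mem_univ i)))⟩

end Triangular


/-! ### The anti-diagonal matrix and the invariant polynomial -/

section Antidiagonal

variable {n : ℕ} {R : Type*} [CommRing R]

@[simp] lemma antiDiag_mul_apply (M : Matrix (Fin n) (Fin n) R) (i j : Fin n) :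
    (antiDiag n R * M) i j = M i.rev j := by
  rw [Matrix.mul_apply, Finset.sum_eq_single i.rev]
  · simp [antiDiag]
  · intro k _ hk
    simp [antiDiag, hk]
  · simp

@[simp] lemma mul_antiDiag_apply (M : Matrix (Fin n) (Fin n) R) (i j : Fin n) :
    (M * antiDiag n R) i j = M i j.rev := by
  rw [Matrix.mul_apply, Finset.sum_eq_single j.rev]
  · simp [antiDiag]
  · intro k _ hk
    have : j ≠ k.rev := fun h => hk (by rw [h, Fin.rev_rev])
    simp [antiDiag, this]
  · simp

lemma antiDiag_transpose : (antiDiag n R)ᵀ = antiDiag n R := by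
  ext i j
  simp only [antiDiag, Matrix.transpose_apply, Matrix.of_apply]
  congr 1
  rw [eq_iff_iff]
  constructor
  · rintro rfl; simp
  · rintro rfl; simp

lemma det_antiDiag (n : ℕ) (R : Type*) [CommRing R] : (antiDiag n R).det = (-1) ^ (n / 2) := by
  induction n with
  | zero => simp
  | succ n ih =>
    rw [Matrix.det_succ_row_zero, Finset.sum_eq_single (Fin.last n)]
    · have h : (antiDiag (n + 1) R).submatrix Fin.succ (Fin.last n).succAbove = antiDiag n R := by
        ext i j
        simp only [antiDiag, Matrix.submatrix_apply, Matrix.of_apply, Fin.succAbove_last,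
          Fin.rev_succ, Fin.castSucc_inj]
      rw [h, ih]
      simp only [antiDiag, Matrix.of_apply, Fin.rev_zero, if_true, mul_one, Fin.val_last]
      rcases Nat.even_or_odd' n with ⟨k, rfl | rfl⟩
      · rw [show 2 * k / 2 = k by omega, show (2 * k + 1) / 2 = k by omega]
        simp
      · rw [show (2 * k + 1) / 2 = k by omega, show (2 * k + 1 + 1) / 2 = k + 1 by omega]
        simp [pow_add, pow_mul]
    · intro j _ hj
      simp [antiDiag, hj]
    · simp

/-- Up to the symmetry `𝒜`, the invariant polynomial is a characteristic polynomial. -/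
lemma inv_eq_charpoly (B : W n R) : inv B = (-(antiDiag n R * B.1)).charpoly := by
  have hA : ((antiDiag n R).map (C : R → R[X])).det = (-1) ^ (n / 2) := by
    have := (RingHom.map_det (C : R →+* R[X]) (antiDiag n R)).symm
    rw [det_antiDiag] at this
    simpa using this
  have hAA : (antiDiag n R).map (C : R → R[X]) * (antiDiag n R).map (C : R → R[X]) = 1 := by
    rw [← Matrix.map_mul, antiDiag_mul_self]
    simp
  unfold inv
  rw [← hA, ← Matrix.det_mul, Matrix.charpoly, Matrix.charmatrix, Matrix.mul_add, Matrix.mul_smul,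
    hAA]
  have hAB : (antiDiag n R).map (C : R → R[X]) * B.1.map C = (antiDiag n R * B.1).map C :=
    (Matrix.map_mul (f := (C : R →+* R[X]))).symm
  rw [hAB]
  congr 1
  ext i j : 2
  simp [Matrix.smul_apply, Matrix.one_apply, Matrix.diagonal_apply, -Matrix.map_mul]

lemma inv_monic (B : W n R) : (inv B).Monic := by
  rw [inv_eq_charpoly]; exact Matrix.charpoly_monic _

lemma inv_natDegree [Nontrivial R] (B : W n R) : (inv B).natDegree = n := by
  rw [inv_eq_charpoly, Matrix.charpoly_natDegree_eq_dim, Fintype.card_fin]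

lemma monicPoly_coeff (a : Fin n → R) (k : Fin n) : (monicPoly a).coeff k = a k := by
  unfold monicPoly
  rw [coeff_add, coeff_X_pow, if_neg k.2.ne, zero_add, finsetSum_coeff,
    Finset.sum_eq_single k]
  · simp
  · intro j _ hj
    rw [coeff_C_mul, coeff_X_pow, if_neg (fun h => hj (Fin.ext h.symm)), mul_zero]
  · simp

lemma inv_eq_monicPoly [Nontrivial R] (B : W n R) :
    inv B = monicPoly fun k : Fin n => (inv B).coeff k := by
  conv_lhs => rw [(inv_monic B).as_sum, inv_natDegree]
  rw [monicPoly, Finset.sum_range]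

lemma inv_eq_monicPoly_iff [Nontrivial R] (B : W n R) (a : Fin n → R) :
    inv B = monicPoly a ↔ (fun k : Fin n => (inv B).coeff k) = a := by
  constructor
  · intro h
    ext k
    rw [h, monicPoly_coeff]
  · intro h
    conv_lhs => rw [inv_eq_monicPoly]
    rw [h]

end Antidiagonal

/-! ### Krylov vectors of Hessenberg matrices -/

section Krylov

variable {n : ℕ} {R : Type*} [CommRing R]

/-- `T` is a Hessenberg matrix with unit subdiagonal: it vanishes below the subdiagonal and has all
subdiagonal entries equal to `1`. -/
def IsHess (T : Matrix (Fin n) (Fin n) R) : Prop :=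
  ∀ i j : Fin n, (j + 1 : ℕ) ≤ i → T i j = if (j + 1 : ℕ) = i then 1 else 0

/-- The vectors `Tᵏ e₁`. -/
def krylov (T : Matrix (Fin n) (Fin n) R) : ℕ → Fin n → R
  | 0 => fun i => if (i : ℕ) = 0 then 1 else 0
  | k + 1 => T *ᵥ krylov T k

lemma krylov_succ (T : Matrix (Fin n) (Fin n) R) (k : ℕ) :
    krylov T (k + 1) = T *ᵥ krylov T k := rfl

lemma krylov_eq_pow (T : Matrix (Fin n) (Fin n) R) (k : ℕ) :
    krylov T k = (T ^ k) *ᵥ krylov T 0 := by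
  induction k with
  | zero => simp
  | succ k ih => rw [krylov_succ, ih, pow_succ', Matrix.mulVec_mulVec]

lemma krylov_triangular {T : Matrix (Fin n) (Fin n) R} (hT : IsHess T) (k : ℕ) (i : Fin n)
    (hi : k ≤ i) : krylov T k i = if k = i then 1 else 0 := by
  induction k generalizing i with
  | zero => simp [krylov, eq_comm]
  | succ k ih =>
    rw [krylov_succ, Matrix.mulVec, dotProduct]
    have hlt : (i : ℕ) - 1 < n := by omega
    rw [Finset.sum_eq_single (⟨i - 1, hlt⟩ : Fin n)]
    · rw [hT _ _ (by simp; omega), ih _ (by simp; omega)]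
      have h1 : (i : ℕ) - 1 + 1 = i := by omega
      by_cases h : k + 1 = (i : ℕ)
      · rw [if_pos h1, if_pos h, if_pos (by simp; omega), one_mul]
      · rw [if_neg h, if_neg (c := k = _) (by simp; omega), mul_zero]
    · intro j _ hj
      have hj' : (j : ℕ) ≠ i - 1 := fun h => hj (Fin.ext h)
      rcases lt_or_ge (j : ℕ) i with h | h
      · rw [hT _ _ (by omega), if_neg (by omega), zero_mul]
      · rw [ih _ (by omega), if_neg (by omega), mul_zero]
    · simp

lemma krylov_self {T : Matrix (Fin n) (Fin n) R} (hT : IsHess T) (i : Fin n) :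
    krylov T i i = 1 := by rw [krylov_triangular hT _ _ le_rfl, if_pos rfl]

lemma krylov_of_lt {T : Matrix (Fin n) (Fin n) R} (hT : IsHess T) {k : ℕ} {i : Fin n}
    (h : k < i) : krylov T k i = 0 := by rw [krylov_triangular hT _ _ h.le, if_neg h.ne]

/-- The entry `(Tᵏ e₁)_i` depends on the entries of `T` of level `j - i' + 1 ≤ k - i` only, and the
dependence on the ones of top level `h = k - i` is additive. -/
lemma krylov_sub {T T' : Matrix (Fin n) (Fin n) R} (hT : IsHess T) (hT' : IsHess T') {h : ℕ}
    (hTT : ∀ i j : Fin n, (j + 1 : ℕ) < i + h → T i j = T' i j) (k : ℕ) :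
    (∀ i : Fin n, k < i + h → krylov T k i = krylov T' k i) ∧
    ∀ i : Fin n, k = i + h → krylov T k i - krylov T' k i =
      ∑ i' : Fin n, ∑ j : Fin n, if i' ≤ i ∧ (j + 1 : ℕ) = i' + h then T i' j - T' i' j else 0 := by
  induction k with
  | zero =>
    refine ⟨fun i _ => rfl, fun i hi => ?_⟩
    rw [show krylov T 0 i = krylov T' 0 i from rfl, sub_self, eq_comm]
    refine Finset.sum_eq_zero fun i' _ => Finset.sum_eq_zero fun j _ => ?_
    rw [if_neg]
    rintro ⟨h1, h2⟩
    rw [Fin.le_def] at h1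
    omega
  | succ k ih =>
    obtain ⟨ih1, ih2⟩ := ih
    constructor
    · intro i hi
      simp only [krylov_succ, Matrix.mulVec, dotProduct]
      refine Finset.sum_congr rfl fun j _ => ?_
      rcases lt_or_ge (j + 1 : ℕ) i with h1 | h1
      · rw [hT _ _ h1.le, hT' _ _ h1.le, if_neg h1.ne, zero_mul, zero_mul]
      · rw [ih1 j (by omega)]
        rcases lt_or_ge (j + 1 : ℕ) (i + h) with h2 | h2
        · rw [hTT _ _ h2]
        · rw [krylov_of_lt hT' (by omega), mul_zero, mul_zero]
    · intro i hi
      simp only [krylov_succ, Matrix.mulVec, dotProduct]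
      rw [← Finset.sum_sub_distrib]
      have h1 : ∀ j : Fin n, T i j * krylov T k j - T' i j * krylov T' k j =
          (if (j + 1 : ℕ) = i + h then T i j - T' i j else 0) +
          ∑ i' : Fin n, ∑ j' : Fin n, if (j + 1 : ℕ) = i ∧ i' ≤ j ∧ (j' + 1 : ℕ) = i' + h then
            T i' j' - T' i' j' else 0 := by
        intro j
        -- The subdiagonal entry `j + 1 = i` passes on the sum for the row `i - 1`; the entry
        -- `j + 1 = i + h` adds the term of the row `i`; all other terms of the two sums agree.
        rcases lt_trichotomy (j + 1 : ℕ) i with h1 | h1 | h1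
        · rw [hT _ _ h1.le, hT' _ _ h1.le]
          simp [h1.ne, show ¬ (j + 1 : ℕ) = i + h by omega]
        · rw [hT _ _ h1.le, hT' _ _ h1.le]
          simp only [h1, if_true, one_mul, true_and]
          rw [ih2 j (by omega)]
          split_ifs <;> simp
        · rw [ih1 j (by omega)]
          simp only [h1.ne', false_and, if_false, Finset.sum_const_zero, add_zero]
          rcases lt_trichotomy (j + 1 : ℕ) (i + h) with h2 | h2 | h2
          · rw [hTT _ _ h2]
            simp
          · rw [if_pos h2, show k = (j : ℕ) by omega, krylov_self hT']
            ring
          · rw [if_neg h2.ne', krylov_of_lt hT' (by omega)]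
            simp
      rw [Finset.sum_congr rfl fun j _ => h1 j, Finset.sum_add_distrib]
      have h2 : ∑ j : Fin n, ∑ i' : Fin n, ∑ j' : Fin n,
          (if (j + 1 : ℕ) = i ∧ i' ≤ j ∧ (j' + 1 : ℕ) = i' + h then
            T i' j' - T' i' j' else 0) = ∑ i' : Fin n, ∑ j' : Fin n,
            if i' < i ∧ (j' + 1 : ℕ) = i' + h then T i' j' - T' i' j' else 0 := by
        rw [Finset.sum_comm]
        refine Finset.sum_congr rfl fun i' _ => ?_
        rw [Finset.sum_comm]
        refine Finset.sum_congr rfl fun j' _ => ?_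
        by_cases h0 : i' < i
        · rw [Fin.lt_def] at h0
          rw [Finset.sum_eq_single (⟨i - 1, by omega⟩ : Fin n)]
          · congr 1
            rw [eq_iff_iff, Fin.le_def, Fin.lt_def]
            simp only
            omega
          · intro j _ hj
            rw [if_neg]
            rintro ⟨h3, -, -⟩
            exact hj (Fin.ext (by simp only; omega))
          · simp
        · rw [if_neg (fun h => h0 h.1)]
          refine Finset.sum_eq_zero fun j _ => ?_
          rw [if_neg]
          rintro ⟨h3, h4, -⟩
          rw [Fin.le_def] at h4
          rw [Fin.lt_def] at h0
          omega
      have h3 : ∑ j : Fin n, (if (j + 1 : ℕ) = i + h then T i j - T' i j else 0) =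
          ∑ i' : Fin n, ∑ j' : Fin n,
            if i' = i ∧ (j' + 1 : ℕ) = i' + h then T i' j' - T' i' j' else 0 := by
        symm
        rw [Finset.sum_eq_single i]
        · simp
        · intro i' _ h4
          simp [h4]
        · simp
      rw [h2, h3, ← Finset.sum_add_distrib]
      refine Finset.sum_congr rfl fun i' _ => ?_
      rw [← Finset.sum_add_distrib]
      refine Finset.sum_congr rfl fun j' _ => ?_
      rcases lt_trichotomy i' i with h4 | h4 | h4
      · simp [h4, h4.le, h4.ne]
      · simp [h4]
      · simp [h4.not_ge, h4.not_gt, h4.ne']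

end Krylov


/-! ### Coordinates on `W₀` and the slice -/

section Coordinates

variable {n : ℕ} {R : Type*} [CommRing R]

/-- The positions `i ≤ j` of the coordinates on `W₀`: the ones with `i + j = n`, the ones that
correspond to coordinates on `N`, and one for each coefficient of the invariant polynomial, on the
diagonal or next to it. -/
def posW₀ : Fin (n / 2) ⊕ (NIndex n ⊕ Fin n) → W₀Index n
  | .inl k => ⟨(⟨k, by omega⟩, ⟨n - 2 - k, by omega⟩), by
      refine ⟨?_, ?_⟩
      · rw [Fin.le_def]; simp only; omega
      · simp only; omega⟩
  | .inr (.inl ij) => ⟨(⟨ij.1.1 - 1, by omega⟩, ⟨n - 1 - ij.1.2, by omega⟩), by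
      have h := ij.2
      rw [Fin.lt_def] at h
      refine ⟨?_, ?_⟩
      · rw [Fin.le_def]; simp only; omega
      · simp only; omega⟩
  | .inr (.inr k) => ⟨(⟨(2 * n - k - 2) / 2, by omega⟩, ⟨(2 * n - k - 1) / 2, by omega⟩), by
      refine ⟨?_, ?_⟩
      · rw [Fin.le_def]; simp only; omega
      · simp only; omega⟩

lemma posW₀_bijective : Function.Bijective (posW₀ (n := n)) := by
  constructor
  · have hN : ∀ x : NIndex n, (x.1.2 : ℕ) < x.1.1 ∧ (x.1.1 + 1 : ℕ) + (x.1.2 + 1) ≤ n :=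
      fun x => ⟨Fin.lt_def.mp x.2.1, x.2.2⟩
    rintro (k | x | k) (k' | x' | k') h <;>
      simp only [posW₀, Subtype.mk.injEq, Prod.mk.injEq, Fin.mk.injEq] at h
    · exact congrArg _ (Fin.ext (by omega))
    · have := hN x'; omega
    · omega
    · have := hN x; omega
    · have := hN x
      have := hN x'
      exact congrArg _ (congrArg _ (Subtype.ext (Prod.ext (Fin.ext (by omega))
        (Fin.ext (by omega)))))
    · have := hN x; omega
    · omega
    · have := hN x'; omega
    · exact congrArg _ (congrArg _ (Fin.ext (by omega)))
  · rintro ⟨⟨i, j⟩, h1, h2⟩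
    simp only [Fin.le_def] at h1 h2
    by_cases h3 : (i : ℕ) + j + 2 = n
    · exact ⟨.inl ⟨i, by omega⟩, Subtype.ext (Prod.ext (Fin.ext (by simp [posW₀]))
        (Fin.ext (by simp only [posW₀]; omega)))⟩
    by_cases h4 : (i : ℕ) + 2 ≤ j
    · exact ⟨.inr (.inl ⟨(⟨i + 1, by omega⟩, ⟨n - 1 - j, by omega⟩), by
        refine ⟨?_, ?_⟩
        · rw [Fin.lt_def]; simp only; omega
        · simp only; omega⟩), Subtype.ext (Prod.ext (Fin.ext (by simp [posW₀]))
        (Fin.ext (by simp only [posW₀]; omega)))⟩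
    · exact ⟨.inr (.inr ⟨2 * n - i - j - 2, by omega⟩),
        Subtype.ext (Prod.ext (Fin.ext (by simp only [posW₀]; omega))
        (Fin.ext (by simp only [posW₀]; omega)))⟩

/-- The coordinates on `W₀`, sorted by their role. -/
noncomputable def idxW₀ : Fin (n / 2) ⊕ (NIndex n ⊕ Fin n) ≃ W₀Index n :=
  Equiv.ofBijective posW₀ posW₀_bijective

/-- The element of `W₀` with entries `z` on the line `i + j = n` and the entries `y` on the lines
`i + j > n`. -/
noncomputable def mat (z : Fin (n / 2) → R) (y : NIndex n ⊕ Fin n → R) : W₀ n R :=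
  W₀ofCoord fun x => Sum.elim z y (idxW₀.symm x)

lemma mat_posW₀ (z : Fin (n / 2) → R) (y : NIndex n ⊕ Fin n → R)
    (t : Fin (n / 2) ⊕ (NIndex n ⊕ Fin n)) :
    (mat z y).1.1 (posW₀ t).1.1 (posW₀ t).1.2 = Sum.elim z y t := by
  simp only [mat, W₀ofCoord, Matrix.of_apply]
  rw [dif_pos (posW₀ t).2.2]
  congr 1
  rw [Equiv.symm_apply_eq]
  exact Subtype.ext (Prod.ext (min_eq_left (posW₀ t).2.1) (max_eq_right (posW₀ t).2.1))

lemma mat_symm (z : Fin (n / 2) → R) (y : NIndex n ⊕ Fin n → R) (i j : Fin n) :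
    (mat z y).1.1 i j = (mat z y).1.1 j i := (mat z y).1.2.apply j i

lemma mat_apply_inl (z : Fin (n / 2) → R) (y : NIndex n ⊕ Fin n → R) (k : Fin (n / 2))
    {a b : Fin n} (ha : (a : ℕ) = k) (hb : (b : ℕ) = n - 2 - k) : (mat z y).1.1 a b = z k := by
  obtain rfl : a = (posW₀ (.inl k)).1.1 := Fin.ext ha
  obtain rfl : b = (posW₀ (.inl k)).1.2 := Fin.ext hb
  exact mat_posW₀ z y (.inl k)

lemma mat_apply_inr_inl (z : Fin (n / 2) → R) (y : NIndex n ⊕ Fin n → R) (x : NIndex n)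
    {a b : Fin n} (ha : (a : ℕ) = x.1.1 - 1) (hb : (b : ℕ) = n - 1 - x.1.2) :
    (mat z y).1.1 a b = y (.inl x) := by
  obtain rfl : a = (posW₀ (.inr (.inl x))).1.1 := Fin.ext ha
  obtain rfl : b = (posW₀ (.inr (.inl x))).1.2 := Fin.ext hb
  exact mat_posW₀ z y (.inr (.inl x))

lemma mat_apply_inr_inr (z : Fin (n / 2) → R) (y : NIndex n ⊕ Fin n → R) (k : Fin n)
    {a b : Fin n} (ha : (a : ℕ) = (2 * n - k - 2) / 2) (hb : (b : ℕ) = (2 * n - k - 1) / 2) :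
    (mat z y).1.1 a b = y (.inr k) := by
  obtain rfl : a = (posW₀ (.inr (.inr k))).1.1 := Fin.ext ha
  obtain rfl : b = (posW₀ (.inr (.inr k))).1.2 := Fin.ext hb
  exact mat_posW₀ z y (.inr (.inr k))

lemma exists_mat_eq (B : W₀ n R) : ∃ z y, B = mat z y := by
  refine ⟨fun k => B.1.1 (posW₀ (.inl k)).1.1 (posW₀ (.inl k)).1.2,
    fun t => B.1.1 (posW₀ (.inr t)).1.1 (posW₀ (.inr t)).1.2, ?_⟩
  have key : ∀ (i j : Fin n) (h1 : i ≤ j) (h2 : n ≤ (i + 1 : ℕ) + (j + 1)) (t),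
      posW₀ t = ⟨(i, j), h1, h2⟩ → B.1.1 i j =
        (mat (fun k => B.1.1 (posW₀ (.inl k)).1.1 (posW₀ (.inl k)).1.2)
          (fun t => B.1.1 (posW₀ (.inr t)).1.1 (posW₀ (.inr t)).1.2)).1.1 i j := by
    intro i j h1 h2 t ht
    have h3 := mat_posW₀ (fun k => B.1.1 (posW₀ (.inl k)).1.1 (posW₀ (.inl k)).1.2)
        (fun t => B.1.1 (posW₀ (.inr t)).1.1 (posW₀ (.inr t)).1.2) t
    rw [ht] at h3
    rw [h3]
    rcases t with k | t <;> simp [ht]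
  have key2 : ∀ i j : Fin n, i ≤ j → B.1.1 i j =
      (mat (fun k => B.1.1 (posW₀ (.inl k)).1.1 (posW₀ (.inl k)).1.2)
        (fun t => B.1.1 (posW₀ (.inr t)).1.1 (posW₀ (.inr t)).1.2)).1.1 i j := by
    intro i j h1
    by_cases h2 : n ≤ (i + 1 : ℕ) + (j + 1)
    · obtain ⟨t, ht⟩ := posW₀_bijective.2 ⟨(i, j), h1, h2⟩
      exact key i j h1 h2 t ht
    · rw [B.2 i j (by omega), (mat _ _).2 i j (by omega)]
  refine Subtype.ext (Subtype.ext (Matrix.ext fun i j => ?_))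
  rcases le_total i j with h | h
  · exact key2 i j h
  · rw [mat_symm, ← key2 j i h]
    exact (B.1.2.apply i j).symm

/-- The element of `W₀` with entries `1` on the line `i + j = n` and the entries `y` on the lines
`i + j > n`. -/
noncomputable def slice (y : NIndex n ⊕ Fin n → R) : W₀ n R := mat 1 y

/-- `B` lies in `W₀`, and its entries on the line `i + j = n` are ones. -/
def IsSlice (B : W n R) : Prop :=
  ∀ i j : Fin n, (i : ℕ) + j + 2 ≤ n → B.1 i j = if (i : ℕ) + j + 2 = n then 1 else 0

lemma isSlice_slice (y : NIndex n ⊕ Fin n → R) : IsSlice (slice y).1 := by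
  have key : ∀ i j : Fin n, i ≤ j → (i : ℕ) + j + 2 ≤ n →
      (slice y).1.1 i j = if (i : ℕ) + j + 2 = n then 1 else 0 := by
    intro i j hij h
    rw [Fin.le_def] at hij
    split_ifs with h1
    · exact mat_apply_inl 1 y ⟨i, by omega⟩ rfl (by simp only; omega)
    · exact (slice y).2 i j (by omega)
  intro i j h
  rcases le_total i j with hij | hij
  · exact key i j hij h
  · have := key j i hij (by omega)
    rw [add_comm (i : ℕ) j, ← this]
    exact mat_symm _ _ _ _

lemma IsSlice.eq_slice {B : W n R} (hB : IsSlice B) : ∃ y, B = (slice y).1 := by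
  obtain ⟨z, y, hzy⟩ := exists_mat_eq (⟨B, fun i j hij => by
    rw [hB i j (by omega), if_neg (by omega)]⟩ : W₀ n R)
  have hz : z = 1 := by
    ext k
    have h1 := mat_apply_inl z y k (a := ⟨k, by omega⟩) (b := ⟨n - 2 - k, by omega⟩) rfl rfl
    rw [← hzy, hB _ _ (by simp only; omega), if_pos (by simp only; omega)] at h1
    exact h1.symm
  rw [hz] at hzy
  exact ⟨y, congrArg Subtype.val hzy⟩

/-- The matrix `𝒜 B`, self-adjoint with respect to `𝒜`. -/
def adj (B : W n R) : Matrix (Fin n) (Fin n) R := antiDiag n R * B.1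

lemma adj_apply (B : W n R) (i j : Fin n) : adj B i j = B.1 i.rev j := antiDiag_mul_apply _ _ _

lemma IsSlice.isHess {B : W n R} (hB : IsSlice B) : IsHess (adj B) := by
  intro i j hij
  have h := hB i.rev j (by rw [Fin.val_rev]; omega)
  rw [adj_apply, h, Fin.val_rev]
  congr 1
  rw [eq_iff_iff]
  omega

/-- The Cayley-Hamilton theorem for `-𝒜B`, whose characteristic polynomial is `inv B`, applied to
the first basis vector. -/
lemma krylov_adj_card [Nontrivial R] (B : W n R) :
    krylov (adj B) n = -∑ k : Fin n, ((-1) ^ (n + k : ℕ) * (inv B).coeff k) • krylov (adj B) k := by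
  have h1 := Matrix.aeval_self_charpoly (-(adj B))
  have h2 : (-(adj B)).charpoly = inv B := (inv_eq_charpoly B).symm
  rw [h2, (inv_monic B).as_sum, inv_natDegree] at h1
  simp only [map_add, map_pow, aeval_X, map_sum, map_mul, aeval_C] at h1
  rw [Finset.sum_range] at h1
  have hneg : ∀ k : ℕ, (-(adj B)) ^ k = ((-1 : R) ^ k) • (adj B) ^ k := fun k => by
    rw [← _root_.smul_pow, neg_one_smul]
  have h3 : (adj B) ^ n =
      -∑ k : Fin n, ((-1) ^ (n + k : ℕ) * (inv B).coeff k) • (adj B) ^ (k : ℕ) := by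
    rw [eq_neg_iff_add_eq_zero]
    -- Multiply by `(-1)ⁿ` to make the leading coefficient of the relation for `𝒜B` equal to one.
    have h4 := congrArg (fun M => ((-1 : R) ^ n) • M) h1
    simp only [smul_zero, smul_add, Finset.smul_sum] at h4
    rw [← h4]
    congr 1
    · rw [hneg, smul_smul, ← mul_pow]
      simp
    · refine Finset.sum_congr rfl fun k _ => ?_
      rw [hneg, ← Algebra.smul_def, smul_smul, smul_smul, pow_add]
      congr 1
      ring
  rw [krylov_eq_pow, h3, Matrix.neg_mulVec, Matrix.sum_mulVec]
  congr 1
  refine Finset.sum_congr rfl fun k _ => ?_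
  rw [Matrix.smul_mulVec, ← krylov_eq_pow]

lemma krylov_adj_card_apply [Nontrivial R] (B : W n R) (i : Fin n) :
    krylov (adj B) n i =
      -∑ k : Fin n, ((-1) ^ (n + k : ℕ) * (inv B).coeff k) * krylov (adj B) k i := by
  have h := congrFun (krylov_adj_card B) i
  rw [h]
  simp [Finset.sum_apply]

/-- The coefficient of `x ^ k` in `inv B` is determined by the entries of `𝒜B` of level at
most `n - k`. The relation `krylov_adj_card`, read off in the `k`-th entry, expresses it by the
higher coefficients, since the vectors `Tˡe₁` with `l < k` vanish there. -/
lemma coeff_inv_congr [Nontrivial R] {B B' : W n R} (hB : IsSlice B) (hB' : IsSlice B') {h : ℕ}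
    (hBB : ∀ i j : Fin n, (j + 1 : ℕ) < i + h → adj B i j = adj B' i j) (k : Fin n)
    (hk : n < k + h) : (inv B).coeff k = (inv B').coeff k := by
  obtain ⟨m, hm⟩ : ∃ m, n - (k : ℕ) = m := ⟨_, rfl⟩
  induction m using Nat.strong_induction_on generalizing k with
  | _ m ih =>
    have h1 := (krylov_sub hB.isHess hB'.isHess hBB n).1 k hk
    rw [krylov_adj_card_apply, krylov_adj_card_apply, neg_inj, ← sub_eq_zero,
      ← Finset.sum_sub_distrib, Finset.sum_eq_single k] at h1
    · rw [krylov_self hB.isHess, krylov_self hB'.isHess] at h1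
      have h2 : ((-1 : R) ^ (n + k : ℕ)) * (-1) ^ (n + k : ℕ) = 1 := by
        rw [← mul_pow]; simp
      linear_combination (-1 : R) ^ (n + k : ℕ) * h1 +
        ((inv B').coeff k - (inv B).coeff k) * h2
    · intro l _ hl
      rcases lt_or_gt_of_ne (fun h => hl (Fin.ext h)) with h2 | h2
      · rw [krylov_of_lt hB.isHess h2, krylov_of_lt hB'.isHess h2]; ring
      · rw [ih (n - l) (by omega) l (by omega) rfl,
          (krylov_sub hB.isHess hB'.isHess hBB l).1 k (by omega), sub_self]
    · simp

/-- The coefficient of `x ^ k` in `inv B` depends additively on the entries of `𝒜B` of top level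
`n - k`: up to sign, it changes by the sum of their changes. -/
lemma coeff_inv_sub [Nontrivial R] {B B' : W n R} (hB : IsSlice B) (hB' : IsSlice B') {h : ℕ}
    (hBB : ∀ i j : Fin n, (j + 1 : ℕ) < i + h → adj B i j = adj B' i j) (k : Fin n)
    (hk : n = k + h) : -(-1) ^ (n + k : ℕ) * ((inv B).coeff k - (inv B').coeff k) =
      ∑ i' : Fin n, ∑ j : Fin n,
        if i' ≤ k ∧ (j + 1 : ℕ) = i' + h then adj B i' j - adj B' i' j else 0 := by
  rw [← (krylov_sub hB.isHess hB'.isHess hBB n).2 k hk, krylov_adj_card_apply,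
    krylov_adj_card_apply, neg_sub_neg, ← Finset.sum_sub_distrib, Finset.sum_eq_single k]
  · rw [krylov_self hB.isHess, krylov_self hB'.isHess]
    ring
  · intro l _ hl
    rcases lt_or_gt_of_ne (fun h => hl (Fin.ext h)) with h2 | h2
    · rw [krylov_of_lt hB.isHess h2, krylov_of_lt hB'.isHess h2]; ring
    · rw [coeff_inv_congr hB hB' hBB l (by omega),
        (krylov_sub hB.isHess hB'.isHess hBB l).1 k (by omega), sub_self]
  · simp

end Coordinates


/-! ### The triangular change of coordinates on the slice -/

section Theta

variable {n : ℕ} {K : Type*} [Field K]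

/-- The level `i + j - n` of the position of a coordinate on the slice. -/
def level : NIndex n ⊕ Fin n → ℕ
  | .inl x => x.1.1 - x.1.2
  | .inr k => n - k

/-- The place of a coordinate among the ones of the same level. -/
def place : NIndex n ⊕ Fin n → ℕ
  | .inl x => x.1.2
  | .inr _ => n

lemma place_le (t : NIndex n ⊕ Fin n) : place t ≤ n := by
  rcases t with x | k
  · exact x.1.2.2.le
  · exact le_rfl

/-- The lexicographic order on pairs of level and place. -/
def sliceRank (t : NIndex n ⊕ Fin n) : ℕ := level t * (n + 1) + place t

lemma sliceRank_lt {t : NIndex n ⊕ Fin n} {h c : ℕ} (ht : level t < h) :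
    sliceRank t < h * (n + 1) + c := by
  have h1 := place_le t
  have h2 : (level t + 1) * (n + 1) ≤ h * (n + 1) := Nat.mul_le_mul_right _ ht
  rw [add_mul, one_mul] at h2
  unfold sliceRank
  omega

/-- Every entry of an element of the slice on a line `i + j > n` is one of the coordinates. A
coordinate at distance at least two from the diagonal has the place of its row or column. -/
lemma slice_entry (a b : Fin n) (hab : n < (a : ℕ) + b + 2) :
    ∃ t : NIndex n ⊕ Fin n, (∀ y : NIndex n ⊕ Fin n → K, (slice y).1.1 a b = y t) ∧
      level t = (a : ℕ) + b + 2 - n ∧ ((b : ℕ) + 2 ≤ a → place t = n - 1 - a) ∧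
      ((a : ℕ) + 2 ≤ b → place t = n - 1 - b) := by
  have key : ∀ a b : Fin n, n < (a : ℕ) + b + 2 → a ≤ b → ∃ t : NIndex n ⊕ Fin n,
      (∀ y : NIndex n ⊕ Fin n → K, (slice y).1.1 a b = y t) ∧
      level t = (a : ℕ) + b + 2 - n ∧ ((b : ℕ) + 2 ≤ a → place t = n - 1 - a) ∧
      ((a : ℕ) + 2 ≤ b → place t = n - 1 - b) := by
    intro a b hab hle
    rw [Fin.le_def] at hle
    by_cases h : (a : ℕ) + 2 ≤ b
    · refine ⟨.inl ⟨(⟨a + 1, by omega⟩, ⟨n - 1 - b, by omega⟩), ?_, ?_⟩, fun y => ?_, ?_, ?_, ?_⟩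
      · rw [Fin.lt_def]; simp only; omega
      · simp only; omega
      · exact mat_apply_inr_inl _ _ _ (by simp) (by simp only; omega)
      · simp only [level]; omega
      · omega
      · simp [place]
    · refine ⟨.inr ⟨2 * n - a - b - 2, by omega⟩, fun y => ?_, ?_, ?_, ?_⟩
      · exact mat_apply_inr_inr _ _ _ (by simp only; omega) (by simp only; omega)
      · simp only [level]; omega
      · omega
      · omega
  rcases le_total a b with h | h
  · exact key a b hab h
  · obtain ⟨t, h1, h2, h3, h4⟩ := key b a (by omega) h
    refine ⟨t, fun y => ?_, by omega, h4, h3⟩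
    rw [← h1 y]
    exact mat_symm _ _ _ _

lemma adj_slice_congr {y y' : NIndex n ⊕ Fin n → K} {h : ℕ}
    (hy : ∀ t, level t < h → y t = y' t) (i j : Fin n) (hij : (j + 1 : ℕ) < i + h) :
    adj (slice y).1 i j = adj (slice y').1 i j := by
  rw [adj_apply, adj_apply]
  by_cases h1 : (i.rev : ℕ) + j + 2 ≤ n
  · rw [isSlice_slice y _ _ h1, isSlice_slice y' _ _ h1]
  · have h2 := Fin.val_rev i
    obtain ⟨t, ht, hl, -⟩ := slice_entry (K := K) i.rev j (by omega)
    rw [ht, ht, hy t (by omega)]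

/-- The coordinates of `B` in the slice which carry the information on its `N`-orbit and its
position in that orbit: entries of `(𝒜 B)ᵏ e₁`, and the coefficients of the invariant
polynomial. -/
noncomputable def theta (y : NIndex n ⊕ Fin n → K) : NIndex n ⊕ Fin n → K :=
  Sum.elim (fun x => krylov (adj (slice y).1) x.1.1 x.1.2) fun k => (inv (slice y).1).coeff k

/-- The diagonal entries of the derivative of `theta`. -/
def thetaCoeff (K : Type*) [Field K] : NIndex n ⊕ Fin n → K :=
  Sum.elim (fun _ => 1) fun k => -(-1) ^ (n + k : ℕ) * if Even (k : ℕ) then 1 else 2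

/-- `theta` is triangular. In the entry `(Tᵏe₁)_i`, the rows before the `i`-th contribute
coordinates of the same level and of smaller place, and the row `i` contributes one coordinate, with
factor `1`. In the coefficient of `x ^ k`, all entries of level `n - k` occur, and those which are
coordinates of largest place lie on the diagonal, or in two symmetric positions next to it: hence
the factor `1` for even `k` and `2` for odd `k`. -/
lemma theta_triangular : IsTriangular sliceRank (thetaCoeff (n := n) K) theta := by
  rintro (x | k) y y' hyy
  · have hx := x.2
    rw [Fin.lt_def] at hx
    have hlev : ∀ t, level t < (x.1.1 : ℕ) - x.1.2 → y t = y' t :=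
      fun t ht => hyy t (sliceRank_lt ht)
    simp only [theta, thetaCoeff, Sum.elim_inl, one_mul]
    rw [(krylov_sub (isSlice_slice y).isHess (isSlice_slice y').isHess
      (adj_slice_congr hlev) x.1.1).2 x.1.2 (by omega)]
    rw [Finset.sum_eq_single x.1.2]
    · rw [Finset.sum_eq_single (⟨x.1.1 - 1, by omega⟩ : Fin n)]
      · rw [if_pos ⟨le_rfl, by simp only; omega⟩, adj_apply, adj_apply]
        have h1 : ∀ y : NIndex n ⊕ Fin n → K,
            (slice y).1.1 x.1.2.rev ⟨x.1.1 - 1, by omega⟩ = y (.inl x) := by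
          intro y
          refine (mat_symm _ _ _ _).trans (mat_apply_inr_inl _ _ _ rfl ?_)
          rw [Fin.val_rev]; omega
        rw [h1, h1]
      · intro j _ hj
        rw [if_neg]
        rintro ⟨-, h1⟩
        exact hj (Fin.ext (by simp only; omega))
      · simp
    · intro i' _ hi'
      refine Finset.sum_eq_zero fun j _ => ?_
      split_ifs with h1
      · obtain ⟨h1, h2⟩ := h1
        rw [Fin.le_def] at h1
        have h3 : (i' : ℕ) ≠ x.1.2 := fun h => hi' (Fin.ext h)
        have h4 := Fin.val_rev i'
        obtain ⟨t, ht, hl, hp, -⟩ := slice_entry (K := K) i'.rev j (by omega)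
        rw [adj_apply, adj_apply, ht, ht, hyy t, sub_self]
        have h5 := hp (by omega)
        have h6 : level t = (x.1.1 : ℕ) - x.1.2 := by omega
        change level t * (n + 1) + place t < (x.1.1 - x.1.2 : ℕ) * (n + 1) + x.1.2
        rw [h6, h5]
        omega
      · rfl
    · simp
  · have hlev : ∀ t, level t < n - (k : ℕ) → y t = y' t :=
      fun t ht => hyy t (sliceRank_lt ht)
    have h0 := coeff_inv_sub (isSlice_slice y) (isSlice_slice y') (adj_slice_congr hlev) k
      (by omega)
    have h1 : ((-1 : K) ^ (n + k : ℕ)) * (-1) ^ (n + k : ℕ) = 1 := by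
      rw [← mul_pow]; simp
    simp only [theta, thetaCoeff, Sum.elim_inr]
    -- only the one or two entries next to the diagonal contribute
    have h2 : ∀ i' j : Fin n, (if i' ≤ k ∧ (j + 1 : ℕ) = i' + (n - k) then
        adj (slice y).1 i' j - adj (slice y').1 i' j else 0) =
        (if i' = (⟨k / 2, by omega⟩ : Fin n) then
          if j = (⟨k / 2 + n - k - 1, by omega⟩ : Fin n) then y (.inr k) - y' (.inr k) else 0
          else 0) +
        (if i' = (⟨(k + 1) / 2, by omega⟩ : Fin n) then
          if j = (⟨(k + 1) / 2 + n - k - 1, by omega⟩ : Fin n) then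
            (if Even (k : ℕ) then 0 else y (.inr k) - y' (.inr k)) else 0
          else 0) := by
      intro i' j
      have h4 := Fin.val_rev i'
      have hent : (i' : ℕ) = k / 2 ∨ (i' : ℕ) = (k + 1) / 2 → (j + 1 : ℕ) = i' + (n - k) →
          ∀ y : NIndex n ⊕ Fin n → K, adj (slice y).1 i' j = y (.inr k) := by
        intro h5 h6 y
        rw [adj_apply]
        rcases h5 with h5 | h5
        · refine (mat_symm _ _ _ _).trans (mat_apply_inr_inr _ _ _ ?_ ?_) <;> omega
        · refine mat_apply_inr_inr _ _ _ ?_ ?_ <;> omega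
      simp only [Fin.ext_iff, Fin.le_def]
      by_cases h5 : (i' : ℕ) = k / 2
      · rw [if_pos h5]
        by_cases h6 : (j + 1 : ℕ) = i' + (n - k)
        · rw [if_pos ⟨by omega, h6⟩, if_pos (c := (j : ℕ) = _) (by omega), hent (Or.inl h5) h6,
            hent (Or.inl h5) h6]
          by_cases h7 : Even (k : ℕ)
          · simp [h7]
          · rw [if_neg, add_zero]
            rw [Nat.not_even_iff] at h7
            omega
        · rw [if_neg (fun h => h6 h.2), if_neg (c := (j : ℕ) = k / 2 + n - k - 1) (by omega),
            zero_add]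
          split_ifs
          all_goals first | rfl | omega
      · rw [if_neg h5, zero_add]
        by_cases h6 : (i' : ℕ) = (k + 1) / 2
        · have h7 : ¬ Even (k : ℕ) := by rw [Nat.not_even_iff]; omega
          rw [if_pos h6]
          by_cases h8 : (j + 1 : ℕ) = i' + (n - k)
          · rw [if_pos ⟨by omega, h8⟩, if_pos (by omega), if_neg h7, hent (Or.inr h6) h8,
              hent (Or.inr h6) h8]
          · rw [if_neg (by omega), if_neg (by omega)]
        · rw [if_neg h6]
          split_ifs with h7
          · obtain ⟨h7, h8⟩ := h7
            obtain ⟨t, ht, hl, hp, hp'⟩ := slice_entry (K := K) i'.rev j (by omega)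
            rw [adj_apply, adj_apply, ht, ht, hyy t, sub_self]
            have h9 : level t = n - k := by omega
            have h10 : place t < n := by
              rcases lt_or_ge (i' : ℕ) (k / 2) with h | h
              · rw [hp (by omega)]; omega
              · rw [hp' (by omega)]; omega
            change level t * (n + 1) + place t < (n - k) * (n + 1) + n
            rw [h9]
            omega
          · rfl
    have h3 : ∑ i' : Fin n, ∑ j : Fin n, (if i' ≤ k ∧ (j + 1 : ℕ) = i' + (n - k) then
        adj (slice y).1 i' j - adj (slice y').1 i' j else 0) =
        (if Even (k : ℕ) then 1 else 2) * (y (.inr k) - y' (.inr k)) := by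
      simp only [h2, Finset.sum_add_distrib]
      have h4 : ∀ (a b : Fin n) (z : K),
          ∑ i' : Fin n, ∑ j : Fin n, (if i' = a then if j = b then z else 0 else 0) = z := by
        intro a b z
        rw [Finset.sum_eq_single a]
        · simp
        · intro i' _ hi'
          simp [hi']
        · simp
      rw [h4, h4]
      split_ifs <;> ring
    rw [h3] at h0
    linear_combination (-(-1 : K) ^ (n + k : ℕ)) * h0 +
      (-(inv (slice y).1).coeff k + (inv (slice y').1).coeff k) * h1

lemma thetaCoeff_ne_zero [CharZero K] (t : NIndex n ⊕ Fin n) : thetaCoeff K t ≠ 0 := by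
  rcases t with x | k
  · simp [thetaCoeff]
  · simp only [thetaCoeff, Sum.elim_inr]
    split_ifs <;> simp

lemma theta_bijective [CharZero K] : Function.Bijective (theta (n := n) (K := K)) :=
  theta_triangular.bijective thetaCoeff_ne_zero

end Theta


/-! ### The action of the unipotent group on the slice -/

section NGroup

variable {n : ℕ} {R : Type*} [CommRing R]

lemma N_mul_antiDiag (u : N n R) : u.1 * (antiDiag n R * u.1ᵀ * antiDiag n R) = 1 := by
  refine mul_eq_one_comm.mp ?_
  have h := congrArg (antiDiag n R * ·) u.2.1
  simp only [antiDiag_mul_self] at h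
  simpa only [Matrix.mul_assoc] using h

lemma N_conj_antiDiag (u : N n R) : u.1 * antiDiag n R * u.1ᵀ = antiDiag n R := by
  have h := congrArg (· * antiDiag n R) (N_mul_antiDiag u)
  simpa only [one_mul, Matrix.mul_assoc, antiDiag_mul_self, mul_one] using h

/-- `N(R)` is a group, with inverse `u ↦ 𝒜 uᵀ 𝒜`. -/
instance instGroupN : Group (N n R) where
  mul u v := ⟨u.1 * v.1, by
    refine ⟨?_, fun i => ?_, fun i j hij => ?_⟩
    · calc (u.1 * v.1)ᵀ * antiDiag n R * (u.1 * v.1)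
          = v.1ᵀ * (u.1ᵀ * antiDiag n R * u.1) * v.1 := by
            simp only [Matrix.transpose_mul, Matrix.mul_assoc]
        _ = antiDiag n R := by rw [u.2.1, v.2.1]
    · rw [Matrix.mul_apply, Finset.sum_eq_single i, u.2.2.1, v.2.2.1, one_mul]
      · intro k _ hk
        rcases lt_or_gt_of_ne hk with h | h
        · rw [v.2.2.2 _ _ h, mul_zero]
        · rw [u.2.2.2 _ _ h, zero_mul]
      · simp
    · rw [Matrix.mul_apply]
      refine Finset.sum_eq_zero fun k _ => ?_
      rcases lt_or_ge i k with h | h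
      · rw [u.2.2.2 _ _ h, zero_mul]
      · rw [v.2.2.2 _ _ (h.trans_lt hij), mul_zero]⟩
  one := ⟨1, by simp, fun i => by simp, fun i j hij => by simp [hij.ne]⟩
  inv u := ⟨antiDiag n R * u.1ᵀ * antiDiag n R, by
    refine ⟨?_, fun i => ?_, fun i j hij => ?_⟩
    · simp only [Matrix.transpose_mul, Matrix.transpose_transpose, antiDiag_transpose]
      calc antiDiag n R * (u.1 * antiDiag n R) * antiDiag n R *
            (antiDiag n R * u.1ᵀ * antiDiag n R)
          = antiDiag n R * (u.1 * antiDiag n R * (antiDiag n R * antiDiag n R) * u.1ᵀ) *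
            antiDiag n R := by simp only [Matrix.mul_assoc]
        _ = antiDiag n R := by
            rw [antiDiag_mul_self, mul_one, N_conj_antiDiag, antiDiag_mul_self, one_mul]
    · rw [mul_antiDiag_apply, antiDiag_mul_apply, Matrix.transpose_apply, u.2.2.1]
    · rw [mul_antiDiag_apply, antiDiag_mul_apply, Matrix.transpose_apply]
      exact u.2.2.2 _ _ (Fin.rev_lt_rev.mpr hij)⟩
  mul_assoc u v w := Subtype.ext (Matrix.mul_assoc _ _ _)
  one_mul u := Subtype.ext (one_mul _)
  mul_one u := Subtype.ext (mul_one _)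
  inv_mul_cancel u := Subtype.ext (mul_eq_one_comm.mp (N_mul_antiDiag u))

lemma coe_mul_N (u v : N n R) : (u * v : N n R).1 = u.1 * v.1 := rfl

lemma coe_one_N : (1 : N n R).1 = 1 := rfl

lemma coe_inv_N (u : N n R) : (u⁻¹ : N n R).1 = antiDiag n R * u.1ᵀ * antiDiag n R := rfl

lemma coe_inv_N_apply (u : N n R) (i j : Fin n) : (u⁻¹ : N n R).1 i j = u.1 j.rev i.rev := by
  rw [coe_inv_N, mul_antiDiag_apply, antiDiag_mul_apply, Matrix.transpose_apply]

lemma unip_smul (u : N n R) (B : W n R) : (unip u • B).1 = u.1 * B.1 * u.1ᵀ := by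
  rw [coe_smul_similitudes]
  change (((1 : Rˣ)⁻¹ : Rˣ) : R) • (u.1 * B.1 * u.1ᵀ) = _
  rw [inv_one, Units.val_one, one_smul]

lemma adj_unip_smul (u : N n R) (B : W n R) :
    adj (unip u • B) = (antiDiag n R * u.1 * antiDiag n R) * adj B * u.1ᵀ := by
  simp only [adj, unip_smul]
  simp only [Matrix.mul_assoc, ← Matrix.mul_assoc (antiDiag n R) (antiDiag n R),
    antiDiag_mul_self, one_mul]

lemma transpose_mul_antiDiag_N (u : N n R) :
    u.1ᵀ * (antiDiag n R * u.1 * antiDiag n R) = 1 := by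
  rw [← Matrix.mul_assoc, ← Matrix.mul_assoc, u.2.1, antiDiag_mul_self]

/-- The vectors `Tᵏe₁` are equivariant, because `e₁` is fixed by the upper-triangular
unipotent matrix `𝒜u𝒜`. -/
lemma krylov_unip_smul (u : N n R) (B : W n R) (k : ℕ) :
    krylov (adj (unip u • B)) k = (antiDiag n R * u.1 * antiDiag n R) *ᵥ krylov (adj B) k := by
  induction k with
  | zero =>
    ext i
    simp only [krylov, Matrix.mulVec, dotProduct, mul_ite, mul_one, mul_zero, mul_antiDiag_apply,
      antiDiag_mul_apply]
    have hn : 0 < n := by have := i.2; omega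
    rw [Finset.sum_eq_single (⟨0, hn⟩ : Fin n)]
    · rw [if_pos rfl]
      by_cases h : (i : ℕ) = 0
      · obtain rfl : i = ⟨0, hn⟩ := Fin.ext h
        rw [if_pos rfl, u.2.2.1]
      · rw [if_neg h, u.2.2.2]
        rw [Fin.rev_lt_rev, Fin.lt_def]
        simp only
        omega
    · intro j _ hj
      rw [if_neg (fun h => hj (Fin.ext h))]
    · simp
  | succ k ih =>
    rw [krylov_succ, ih, krylov_succ, adj_unip_smul, Matrix.mulVec_mulVec, Matrix.mulVec_mulVec,
      Matrix.mul_assoc _ u.1ᵀ, transpose_mul_antiDiag_N, mul_one]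

lemma IsSlice.unip_smul {B : W n R} (hB : IsSlice B) (u : N n R) : IsSlice (unip u • B) := by
  intro i j hij
  rw [ReducibleOrbits.unip_smul, Matrix.mul_apply, ← hB i j hij, Finset.sum_eq_single j]
  · rw [Matrix.transpose_apply, u.2.2.1, mul_one, Matrix.mul_apply, Finset.sum_eq_single i]
    · rw [u.2.2.1, one_mul]
    · intro k _ hk
      rcases lt_or_gt_of_ne hk with h | h
      · rw [Fin.lt_def] at h
        rw [hB _ _ (by omega), if_neg (by omega), mul_zero]
      · rw [u.2.2.2 _ _ h, zero_mul]
    · simp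
  · intro l _ hl
    rcases lt_or_gt_of_ne hl with h | h
    · rw [Fin.lt_def] at h
      rw [Matrix.mul_apply, Finset.sum_eq_zero, zero_mul]
      intro k _
      rcases le_or_gt k i with h1 | h1
      · rw [Fin.le_def] at h1
        rw [hB _ _ (by omega), if_neg (by omega), mul_zero]
      · rw [u.2.2.2 _ _ h1, zero_mul]
    · rw [Matrix.transpose_apply, u.2.2.2 _ _ h, mul_zero]
  · simp

/-- The matrix with columns `Tᵏ e₁`, where `T = 𝒜 B`. -/
def krylovMatrix (B : W n R) : Matrix (Fin n) (Fin n) R :=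
  Matrix.of fun i k => krylov (adj B) k i

lemma krylovMatrix_blockTriangular {B : W n R} (hB : IsSlice B) :
    (krylovMatrix B).BlockTriangular id := fun _ _ hij => krylov_of_lt hB.isHess hij

lemma krylovMatrix_det {B : W n R} (hB : IsSlice B) : (krylovMatrix B).det = 1 := by
  rw [Matrix.det_of_isUpperTriangular (krylovMatrix_blockTriangular hB)]
  exact Finset.prod_eq_one fun i _ => krylov_self hB.isHess i

lemma krylovMatrix_unip_smul (u : N n R) (B : W n R) : krylovMatrix (unip u • B) =
    (antiDiag n R * u.1 * antiDiag n R) * krylovMatrix B := by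
  ext i k
  simp only [krylovMatrix, Matrix.of_apply, krylov_unip_smul]
  rfl

/-- `N` acts freely on the slice. -/
lemma unip_smul_injective {B : W n R} (hB : IsSlice B) :
    Function.Injective fun u : N n R => unip u • B := by
  intro u v huv
  have h1 := congrArg krylovMatrix huv
  simp only [krylovMatrix_unip_smul] at h1
  have h2 := congrArg (· * (krylovMatrix B)⁻¹) h1
  have h3 : IsUnit (krylovMatrix B).det := by rw [krylovMatrix_det hB]; exact isUnit_one
  simp only [Matrix.mul_assoc, Matrix.mul_nonsing_inv _ h3, mul_one] at h2
  refine Subtype.ext (Matrix.ext fun i j => ?_)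
  have h4 := congrFun (congrFun h2 i.rev) j.rev
  simpa only [mul_one, antiDiag_mul_apply, mul_antiDiag_apply, Fin.rev_rev] using h4

/-- The Gram matrix of the vectors `Tᵏ e₁` is a Hankel matrix, since `T` is self-adjoint. -/
lemma krylov_gram (B : W n R) (k l : ℕ) :
    krylov (adj B) k ⬝ᵥ (antiDiag n R *ᵥ krylov (adj B) l) =
      krylov (adj B) 0 ⬝ᵥ (antiDiag n R *ᵥ krylov (adj B) (k + l)) := by
  induction k generalizing l with
  | zero => rw [zero_add]
  | succ k ih =>
    rw [show k + 1 + l = k + (l + 1) by ring, ← ih (l + 1), krylov_succ, krylov_succ _ l,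
      Matrix.mulVec_mulVec, ← Matrix.vecMul_transpose, ← Matrix.dotProduct_mulVec,
      Matrix.mulVec_mulVec]
    congr 2
    have h1 : B.1ᵀ = B.1 := B.2
    simp only [adj, Matrix.transpose_mul, antiDiag_transpose, h1, ← Matrix.mul_assoc,
      antiDiag_mul_self, one_mul]
    rw [Matrix.mul_assoc, antiDiag_mul_self, mul_one]

/-- The Gram matrix is determined by the invariant polynomial: the number `⟨e₁, 𝒜Tᵏe₁⟩` is the last
entry of `Tᵏe₁`, so it is known for `k < n`, and the Cayley-Hamilton relation gives a recursion. -/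
lemma krylov_gram_congr [Nontrivial R] {B B' : W n R} (hB : IsSlice B) (hB' : IsSlice B')
    (h : inv B = inv B') (k : ℕ) :
    krylov (adj B) 0 ⬝ᵥ (antiDiag n R *ᵥ krylov (adj B) k) =
      krylov (adj B') 0 ⬝ᵥ (antiDiag n R *ᵥ krylov (adj B') k) := by
  induction k using Nat.strong_induction_on with
  | _ k ih =>
    rcases lt_or_ge k n with hk | hk
    · have h0 : krylov (adj B) 0 = krylov (adj B') 0 := rfl
      rw [h0]
      simp only [dotProduct]
      refine Finset.sum_congr rfl fun i _ => ?_
      by_cases hi : (i : ℕ) = 0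
      · congr 1
        have h1 : ∀ v : Fin n → R, (antiDiag n R *ᵥ v) i = v i.rev := by
          intro v
          simp [Matrix.mulVec, dotProduct, antiDiag]
        rw [h1, h1, krylov_triangular hB.isHess _ _ (by rw [Fin.val_rev]; omega),
          krylov_triangular hB'.isHess _ _ (by rw [Fin.val_rev]; omega)]
      · simp [krylov, hi]
    · obtain ⟨l, rfl⟩ := Nat.exists_eq_add_of_le hk
      have h1 : ∀ B : W n R, krylov (adj B) 0 ⬝ᵥ (antiDiag n R *ᵥ krylov (adj B) (n + l)) =
          -∑ i : Fin n, ((-1) ^ (n + i : ℕ) * (inv B).coeff i) *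
            (krylov (adj B) 0 ⬝ᵥ (antiDiag n R *ᵥ krylov (adj B) (i + l))) := by
        intro B
        rw [← krylov_gram, krylov_adj_card, neg_dotProduct, sum_dotProduct]
        congr 1
        refine Finset.sum_congr rfl fun i _ => ?_
        rw [smul_dotProduct, krylov_gram, smul_eq_mul]
      rw [h1 B, h1 B', h]
      congr 1
      refine Finset.sum_congr rfl fun i _ => ?_
      rw [ih (i + l) (by omega)]

/-- Two elements of the slice with the same invariant polynomial are conjugate under `N`: the
matrix which carries the vectors `Tᵏ e₁` of the one to those of the other preserves `𝒜`, because
the Gram matrices agree. -/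
theorem exists_unip_smul_eq [Nontrivial R] {B B' : W n R} (hB : IsSlice B) (hB' : IsSlice B')
    (h : inv B = inv B') : ∃ u : N n R, unip u • B = B' := by
  have hd : IsUnit (krylovMatrix B).det := by rw [krylovMatrix_det hB]; exact isUnit_one
  have hC1 := Matrix.mul_nonsing_inv _ hd
  have hC2 := Matrix.nonsing_inv_mul _ hd
  set C := krylovMatrix B with hC
  set C' := krylovMatrix B' with hC'
  set w := C' * C⁻¹ with hw
  have hwC : w * C = C' := by rw [hw, Matrix.mul_assoc, hC2, mul_one]
  have hgram : C'ᵀ * antiDiag n R * C' = Cᵀ * antiDiag n R * C := by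
    have h1 : ∀ B : W n R, ∀ k l : Fin n,
        ((krylovMatrix B)ᵀ * antiDiag n R * krylovMatrix B) k l =
        krylov (adj B) k ⬝ᵥ (antiDiag n R *ᵥ krylov (adj B) l) := by
      intro B k l
      rw [Matrix.mul_assoc]
      rfl
    ext k l
    rw [h1, h1, krylov_gram, krylov_gram B, krylov_gram_congr hB hB' h]
  -- `w` is an upper-triangular unipotent isometry of `𝒜`.
  have hwA : wᵀ * antiDiag n R * w = antiDiag n R := by
    have h1 : (C⁻¹)ᵀ * Cᵀ = 1 := by rw [← Matrix.transpose_mul, hC1, Matrix.transpose_one]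
    calc wᵀ * antiDiag n R * w = (C⁻¹)ᵀ * (C'ᵀ * antiDiag n R * C') * C⁻¹ := by
          rw [hw, Matrix.transpose_mul]
          simp only [Matrix.mul_assoc]
      _ = ((C⁻¹)ᵀ * Cᵀ) * antiDiag n R * (C * C⁻¹) := by
          rw [hgram]
          simp only [Matrix.mul_assoc]
      _ = antiDiag n R := by rw [h1, hC1, one_mul, mul_one]
  have : Invertible C := Matrix.invertibleOfIsUnitDet C hd
  have hCi : (C⁻¹).BlockTriangular id :=
    Matrix.blockTriangular_inv_of_blockTriangular (krylovMatrix_blockTriangular hB)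
  have hwt : w.BlockTriangular id := (krylovMatrix_blockTriangular hB').mul hCi
  have hwd : ∀ i, w i i = 1 := by
    intro i
    have h1 := congrFun (congrFun hwC i) i
    rw [Matrix.mul_apply, Finset.sum_eq_single i] at h1
    · have h2 : C i i = 1 := krylov_self hB.isHess i
      have h3 : C' i i = 1 := krylov_self hB'.isHess i
      rwa [h2, h3, mul_one] at h1
    · intro k _ hk
      rcases lt_or_gt_of_ne hk with h2 | h2
      · rw [hwt h2, zero_mul]
      · have h3 : C k i = 0 := krylovMatrix_blockTriangular hB h2
        rw [h3, mul_zero]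
    · simp
  -- Reflecting `w` in the centre gives a lower-triangular matrix.
  let u : N n R := ⟨antiDiag n R * w * antiDiag n R, by
    refine ⟨?_, fun i => ?_, fun i j hij => ?_⟩
    · simp only [Matrix.transpose_mul, antiDiag_transpose]
      calc antiDiag n R * (wᵀ * antiDiag n R) * antiDiag n R * (antiDiag n R * w * antiDiag n R)
          = antiDiag n R * (wᵀ * antiDiag n R * (antiDiag n R * antiDiag n R) * w) *
            antiDiag n R := by simp only [Matrix.mul_assoc]
        _ = antiDiag n R := by
          rw [antiDiag_mul_self, mul_one, hwA, antiDiag_mul_self, one_mul]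
    · rw [mul_antiDiag_apply, antiDiag_mul_apply, hwd]
    · rw [mul_antiDiag_apply, antiDiag_mul_apply]
      exact hwt (Fin.rev_lt_rev.mpr hij)⟩
  refine ⟨u, ?_⟩
  -- For `k = n` the vectors are given by the Cayley-Hamilton relation, which is the same for both.
  have hk : ∀ k : ℕ, k ≤ n → w *ᵥ krylov (adj B) k = krylov (adj B') k := by
    have h1 : ∀ k : Fin n, w *ᵥ krylov (adj B) k = krylov (adj B') k := by
      intro k
      ext i
      exact congrFun (congrFun hwC i) k
    intro k hk
    rcases hk.lt_or_eq with hk | rfl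
    · exact h1 ⟨k, hk⟩
    · rw [krylov_adj_card, krylov_adj_card, Matrix.mulVec_neg, Matrix.mulVec_sum, ← h]
      congr 1
      refine Finset.sum_congr rfl fun i _ => ?_
      rw [Matrix.mulVec_smul, h1]
  -- `w` intertwines `T` and `T'`, since it does so on the basis of the vectors `Tᵏe₁`.
  have hconj : adj B' * w = w * adj B := by
    have h1 : (adj B' * w) * C = (w * adj B) * C := by
      ext i k
      have h2 : (adj B' *ᵥ (w *ᵥ krylov (adj B) k)) i = (w *ᵥ (adj B *ᵥ krylov (adj B) k)) i := by
        rw [hk k k.2.le, ← krylov_succ, ← krylov_succ, hk _ k.2]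
      rw [Matrix.mul_assoc w, Matrix.mul_assoc (adj B'), hwC]
      rw [hk k k.2.le] at h2
      exact h2
    have h2 := congrArg (· * C⁻¹) h1
    simpa only [Matrix.mul_assoc, hC1, mul_one] using h2
  have hwu : w * u.1ᵀ = 1 := by
    refine mul_eq_one_comm.mp ?_
    simp only [u, Matrix.transpose_mul, antiDiag_transpose]
    calc antiDiag n R * (wᵀ * antiDiag n R) * w = antiDiag n R * (wᵀ * antiDiag n R * w) := by
          simp only [Matrix.mul_assoc]
      _ = 1 := by rw [hwA, antiDiag_mul_self]
  refine Subtype.ext ?_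
  rw [unip_smul]
  calc u.1 * B.1 * u.1ᵀ = antiDiag n R * (w * adj B) * u.1ᵀ := by
        simp only [u, adj, Matrix.mul_assoc]
    _ = (antiDiag n R * antiDiag n R) * B'.1 * (w * u.1ᵀ) := by
        rw [← hconj]
        simp only [adj, Matrix.mul_assoc]
    _ = B'.1 := by rw [antiDiag_mul_self, hwu, one_mul, mul_one]

end NGroup

/-! ### The free coordinates determine an element of the unipotent group -/

section Heights

variable {n : ℕ} {R : Type*} [CommRing R]

/-- If the entries of height `i - j < h` of two elements of `N` agree, then their differences in
height `h` are antisymmetric about the antidiagonal. -/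
lemma N_sub_add_sub_rev {u u' : N n R} {h : ℕ} (h0 : 0 < h)
    (hu : ∀ i j : Fin n, (i : ℕ) < j + h → u.1 i j = u'.1 i j) (i j : Fin n)
    (hij : (i : ℕ) = j + h) :
    (u.1 i j - u'.1 i j) + (u.1 j.rev i.rev - u'.1 j.rev i.rev) = 0 := by
  -- Compare the entries of `uᵀ𝒜u = 𝒜 = u'ᵀ𝒜u'` at `(n+1-i, j)`: all products in the sum have equal
  -- factors, except for the two in which one factor is a diagonal entry.
  have hgram : ∀ u : N n R, ∑ k : Fin n, u.1 k i.rev * u.1 k.rev j = antiDiag n R i.rev j := by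
    intro u
    conv_rhs => rw [← u.2.1]
    rw [Matrix.mul_assoc, Matrix.mul_apply]
    simp only [Matrix.transpose_apply, antiDiag_mul_apply]
  have hi := Fin.val_rev i
  have hj := Fin.val_rev j
  have h1 : ∀ k : Fin n, u.1 k i.rev * u.1 k.rev j - u'.1 k i.rev * u'.1 k.rev j =
      (if k = i.rev then u.1 i j - u'.1 i j else 0) +
      (if k = j.rev then u.1 j.rev i.rev - u'.1 j.rev i.rev else 0) := by
    intro k
    have hk := Fin.val_rev k
    by_cases h2 : k = i.rev
    · subst h2
      have h3 : i.rev ≠ j.rev := fun h => by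
        rw [Fin.rev_inj] at h
        subst h
        omega
      rw [if_pos rfl, if_neg h3, u.2.2.1, u'.2.2.1, Fin.rev_rev]
      ring
    · rw [if_neg h2, zero_add]
      by_cases h3 : k = j.rev
      · subst h3
        rw [if_pos rfl, Fin.rev_rev, u.2.2.1, u'.2.2.1]
        ring
      · rw [if_neg h3]
        rcases lt_or_gt_of_ne h2 with h4 | h4
        · rw [u.2.2.2 _ _ h4, u'.2.2.2 _ _ h4]
          ring
        · rw [Fin.lt_def] at h4
          have h5 : (k : ℕ) ≠ j.rev := fun h => h3 (Fin.ext h)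
          rcases lt_or_ge k.rev j with h6 | h6
          · rw [u.2.2.2 _ _ h6, u'.2.2.2 _ _ h6]
            ring
          · rw [Fin.le_def] at h6
            rw [hu _ _ (by omega), hu _ _ (by omega), sub_self]
  have h2 := Finset.sum_congr rfl fun k (_ : k ∈ Finset.univ) => h1 k
  rw [Finset.sum_sub_distrib, hgram, hgram, sub_self, Finset.sum_add_distrib] at h2
  simpa using h2.symm

/-- The entries of small height of an element of `N` are determined by its free coordinates of
small height. By `N_sub_add_sub_rev` the entries beyond the anti-diagonal are minus those at the
reflected positions, up to entries of smaller height, and the ones on it are determined because `2`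
is not a zero divisor. -/
lemma N_entry_congr [IsDomain R] [NeZero (2 : R)] {u u' : N n R} {h : ℕ}
    (hu : ∀ x : NIndex n, (x.1.1 : ℕ) - x.1.2 < h → NCoord u x = NCoord u' x) (i j : Fin n)
    (hij : (i : ℕ) < j + h) : u.1 i j = u'.1 i j := by
  induction h generalizing i j with
  | zero => rw [u.2.2.2 _ _ (by simpa using hij), u'.2.2.2 _ _ (by simpa using hij)]
  | succ h ih =>
    have ih' := ih fun x hx => hu x (by omega)
    by_cases h1 : (i : ℕ) < j + h
    · exact ih' i j h1
    rcases Nat.eq_zero_or_pos h with rfl | h0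
    · obtain rfl : i = j := Fin.ext (by omega)
      rw [u.2.2.1, u'.2.2.1]
    have hfree : ∀ i j : Fin n, (i : ℕ) = j + h → (i + 1 : ℕ) + (j + 1) ≤ n →
        u.1 i j = u'.1 i j := by
      intro i j hij h2
      exact hu ⟨(i, j), by rw [Fin.lt_def]; simp only; omega, h2⟩ (by simp only; omega)
    by_cases h2 : (i + 1 : ℕ) + (j + 1) ≤ n
    · exact hfree i j (by omega) h2
    have h3 := N_sub_add_sub_rev h0 ih' i j (by omega)
    have hi := Fin.val_rev i
    have hj := Fin.val_rev j
    by_cases h4 : (i : ℕ) + j + 1 = n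
    · have h5 : j.rev = i := Fin.ext (by omega)
      have h6 : i.rev = j := Fin.ext (by omega)
      rw [h5, h6, ← two_mul, mul_eq_zero] at h3
      exact sub_eq_zero.mp (h3.resolve_left (NeZero.ne _))
    · rw [hfree j.rev i.rev (by omega) (by omega), sub_self, add_zero] at h3
      exact sub_eq_zero.mp h3

lemma NCoord_injective [IsDomain R] [NeZero (2 : R)] :
    Function.Injective (NCoord : N n R → NIndex n → R) := by
  intro u u' huu
  refine Subtype.ext (Matrix.ext fun i j => N_entry_congr (h := n) (fun x _ => congrFun huu x) i j
    (by omega))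

end Heights


/-! ### Continuity and measurability of the coordinates -/

section Continuity

lemma continuous_mat_apply {Y R : Type*} [TopologicalSpace Y] [CommRing R] [TopologicalSpace R]
    {n : ℕ} {z : Y → Fin (n / 2) → R} {w : Y → NIndex n ⊕ Fin n → R}
    (hz : Continuous z) (hw : Continuous w) (i j : Fin n) :
    Continuous fun y => (mat (z y) (w y)).1.1 i j := by
  simp only [mat, W₀ofCoord, Matrix.of_apply]
  split_ifs with h
  · rcases idxW₀.symm _ with t | t
    · exact (continuous_apply t).comp hz
    · exact (continuous_apply t).comp hw
  · exact continuous_const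

variable {Y R : Type*} [TopologicalSpace Y] [CommRing R] [TopologicalSpace R] [IsTopologicalRing R]

lemma continuous_coeff_mul {f g : Y → R[X]} (hf : ∀ k, Continuous fun y => (f y).coeff k)
    (hg : ∀ k, Continuous fun y => (g y).coeff k) (k : ℕ) :
    Continuous fun y => (f y * g y).coeff k := by
  simp only [coeff_mul]
  exact continuous_finsetSum _ fun i _ => (hf _).mul (hg _)

lemma continuous_coeff_prod {ι : Type*} (s : Finset ι) {f : ι → Y → R[X]}
    (hf : ∀ i k, Continuous fun y => (f i y).coeff k) (k : ℕ) :
    Continuous fun y => (∏ i ∈ s, f i y).coeff k := by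
  classical
  induction s using Finset.induction_on generalizing k with
  | empty => simp only [Finset.prod_empty]; exact continuous_const
  | insert i s hi ih =>
    simp only [Finset.prod_insert hi]
    exact continuous_coeff_mul (hf i) ih k

lemma continuous_coeff_det {n : ℕ} {M : Y → Matrix (Fin n) (Fin n) R[X]}
    (hM : ∀ i j k, Continuous fun y => (M y i j).coeff k) (k : ℕ) :
    Continuous fun y => (M y).det.coeff k := by
  simp only [Matrix.det_apply, finsetSum_coeff, Units.smul_def, zsmul_eq_mul, coeff_intCast_mul]
  exact continuous_finsetSum _ fun σ _ =>
    continuous_const.mul (continuous_coeff_prod _ (fun i k => hM _ _ k) k)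

lemma continuous_coeff_inv {n : ℕ} {B : Y → W n R} (hB : ∀ i j, Continuous fun y => (B y).1 i j)
    (k : ℕ) : Continuous fun y => (inv (B y)).coeff k := by
  unfold inv
  refine continuous_coeff_mul (fun k => continuous_const) (fun k => ?_) k
  refine continuous_coeff_det (fun i j k => ?_) k
  simp only [Matrix.add_apply, Matrix.smul_apply, Matrix.map_apply, coeff_add, coeff_C]
  refine continuous_const.add ?_
  split_ifs
  · exact hB i j
  · exact continuous_const

lemma continuous_krylov {n : ℕ} {B : Y → W n R} (hB : ∀ i j, Continuous fun y => (B y).1 i j)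
    (k : ℕ) (i : Fin n) : Continuous fun y => krylov (adj (B y)) k i := by
  induction k generalizing i with
  | zero => exact continuous_const
  | succ k ih =>
    simp only [krylov_succ, Matrix.mulVec, dotProduct, adj_apply]
    exact continuous_finsetSum _ fun j _ => (hB _ _).mul (ih j)

lemma continuous_theta {n : ℕ} {K : Type*} [Field K] [TopologicalSpace K] [IsTopologicalRing K] :
    Continuous (theta : (NIndex n ⊕ Fin n → K) → _) := by
  have h : ∀ i j, Continuous fun y : NIndex n ⊕ Fin n → K => (slice y).1.1 i j :=
    continuous_mat_apply continuous_const continuous_id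
  refine continuous_pi fun t => ?_
  rcases t with x | k
  · exact continuous_krylov h _ _
  · exact continuous_coeff_inv h _

end Continuity

section StandardBorel

variable {n : ℕ} {R : Type*} [MeasurableSpace R]

lemma measurable_matrix_iff {Y : Type*} [MeasurableSpace Y] {f : Y → Matrix (Fin n) (Fin n) R} :
    Measurable f ↔ ∀ i j, Measurable fun y => f y i j := by
  constructor
  · intro h i j
    exact (measurable_pi_apply j).comp ((measurable_pi_apply i).comp h)
  · intro h
    exact measurable_pi_lambda _ fun i => measurable_pi_lambda _ fun j => h i j

lemma measurable_entry (i j : Fin n) :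
    Measurable fun M : Matrix (Fin n) (Fin n) R => M i j :=
  measurable_matrix_iff.mp measurable_id i j

lemma measurable_W_iff {Y : Type*} [MeasurableSpace Y] {f : Y → W n R} :
    Measurable f ↔ ∀ i j, Measurable fun y => (f y).1 i j :=
  ⟨fun h => measurable_matrix_iff.mp (measurable_subtype_coe.comp h),
    fun h => (measurable_matrix_iff.mpr h).subtype_mk⟩

variable [CommRing R]

lemma measurable_N_iff {Y : Type*} [MeasurableSpace Y] {f : Y → N n R} :
    Measurable f ↔ ∀ i j, Measurable fun y => (f y).1 i j :=
  ⟨fun h => measurable_matrix_iff.mp (measurable_subtype_coe.comp h),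
    fun h => (measurable_matrix_iff.mpr h).subtype_mk⟩

lemma measurable_NCoord : Measurable (NCoord : N n R → NIndex n → R) :=
  measurable_pi_lambda _ fun x => measurable_N_iff.mp measurable_id x.1.1 x.1.2

instance instStandardBorelMatrix [StandardBorelSpace R] :
    StandardBorelSpace (Matrix (Fin n) (Fin n) R) :=
  inferInstanceAs (StandardBorelSpace (Fin n → Fin n → R))

variable [StandardBorelSpace R] [MeasurableAdd₂ R] [MeasurableMul₂ R]

lemma measurableSet_N : MeasurableSet {u : Matrix (Fin n) (Fin n) R |
    uᵀ * antiDiag n R * u = antiDiag n R ∧ (∀ i, u i i = 1) ∧ ∀ i j, i < j → u i j = 0} := by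
  have h1 : ∀ (i j : Fin n) (r : R), MeasurableSet {u : Matrix (Fin n) (Fin n) R | u i j = r} :=
    fun i j r => measurable_entry i j (measurableSet_singleton r)
  refine MeasurableSet.inter ?_ (MeasurableSet.inter ?_ ?_)
  · refine measurableSet_eq_fun ?_ measurable_const
    rw [measurable_matrix_iff]
    intro i j
    simp only [Matrix.mul_apply, Matrix.transpose_apply]
    exact Finset.measurable_sum _ fun k _ => (Finset.measurable_sum _ fun l _ =>
      (measurable_entry _ _).mul measurable_const).mul (measurable_entry _ _)
  · change MeasurableSet {u : Matrix (Fin n) (Fin n) R | ∀ i, u i i = 1}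
    simp only [Set.ofPred_forall]
    exact MeasurableSet.iInter fun i => h1 i i 1
  · change MeasurableSet {u : Matrix (Fin n) (Fin n) R | ∀ i j, i < j → u i j = 0}
    simp only [Set.ofPred_forall]
    exact MeasurableSet.iInter fun i => MeasurableSet.iInter fun j =>
      MeasurableSet.iInter fun _ => h1 i j 0

instance instStandardBorelN : StandardBorelSpace (N n R) := measurableSet_N.standardBorel

instance instStandardBorelW : StandardBorelSpace (W n R) := by
  refine MeasurableSet.standardBorel (s := {B : Matrix (Fin n) (Fin n) R | B.IsSymm}) ?_
  refine measurableSet_eq_fun ?_ measurable_id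
  rw [measurable_matrix_iff]
  exact fun i j => measurable_entry j i

instance instStandardBorelW₀ : StandardBorelSpace (W₀ n R) := by
  refine MeasurableSet.standardBorel
    (s := {B : W n R | ∀ i j : Fin n, (i + 1 : ℕ) + (j + 1) < n → B.1 i j = 0}) ?_
  simp only [Set.ofPred_forall]
  exact MeasurableSet.iInter fun i => MeasurableSet.iInter fun j => MeasurableSet.iInter fun _ =>
    measurable_W_iff.mp measurable_id i j (measurableSet_singleton 0)

lemma measurableEmbedding_NCoord [IsDomain R] [NeZero (2 : R)] :
    MeasurableEmbedding (NCoord : N n R → NIndex n → R) :=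
  measurable_NCoord.measurableEmbedding NCoord_injective

end StandardBorel

/-! ### The unipotent group as an affine space -/

section NCoordEquiv

variable {n : ℕ} {K : Type*} [Field K]

/-- If all coordinates vanish, then `T` is the nilpotent shift of the basis. -/
lemma krylov_slice_zero (k : Fin n) (i : Fin n) :
    krylov (adj (slice (0 : NIndex n ⊕ Fin n → K)).1) k i = if (k : ℕ) = i then 1 else 0 := by
  have hent : ∀ i j : Fin n, adj (slice (0 : NIndex n ⊕ Fin n → K)).1 i j =
      if (j + 1 : ℕ) = i then 1 else 0 := by
    intro i j
    rw [adj_apply]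
    have hi := Fin.val_rev i
    by_cases h : (i.rev : ℕ) + j + 2 ≤ n
    · rw [isSlice_slice _ _ _ h]
      congr 1
      rw [eq_iff_iff]
      omega
    · obtain ⟨t, ht, -⟩ := slice_entry (K := K) i.rev j (by omega)
      rw [ht, if_neg (by omega)]
      rfl
  obtain ⟨k, hk⟩ := k
  simp only
  induction k generalizing i with
  | zero => simp [krylov, eq_comm]
  | succ k ih =>
    rw [krylov_succ, Matrix.mulVec, dotProduct]
    rw [Finset.sum_eq_single (⟨k, by omega⟩ : Fin n)]
    · rw [hent, ih _ (by omega), if_pos rfl, mul_one]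
    · intro j _ hj
      rw [ih _ (by omega), if_neg (fun h => hj (Fin.ext h.symm)), mul_zero]
    · simp

variable [CharZero K]

/-- Surjectivity comes from that of `theta`: the `N`-orbit of the nilpotent element of the slice
consists of all elements of the slice with the same invariant polynomial. -/
lemma NCoord_bijective : Function.Bijective (NCoord : N n K → NIndex n → K) := by
  refine ⟨NCoord_injective, fun v => ?_⟩
  obtain ⟨y, hy⟩ := theta_bijective (n := n) (K := K) |>.2
    (Sum.elim v fun k => (inv (slice (0 : NIndex n ⊕ Fin n → K)).1).coeff k)
  have hinv : inv (slice (0 : NIndex n ⊕ Fin n → K)).1 = inv (slice y).1 := by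
    rw [inv_eq_monicPoly, inv_eq_monicPoly (slice y).1]
    congr 1
    ext k
    exact (congrFun hy (.inr k)).symm
  obtain ⟨u, hu⟩ := exists_unip_smul_eq (isSlice_slice 0) (isSlice_slice y) hinv
  refine ⟨u⁻¹, ?_⟩
  ext x
  have h1 := congrFun hy (.inl x)
  simp only [theta, Sum.elim_inl, ← hu, krylov_unip_smul] at h1
  rw [← h1, NCoord, coe_inv_N_apply, Matrix.mulVec, dotProduct, Finset.sum_eq_single x.1.1]
  · rw [krylov_slice_zero, if_pos rfl, mul_one, mul_antiDiag_apply, antiDiag_mul_apply]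
  · intro j _ hj
    rw [krylov_slice_zero, if_neg (fun h => hj (Fin.ext h.symm)), mul_zero]
  · simp

variable [MeasurableSpace K] [StandardBorelSpace K] [MeasurableAdd₂ K] [MeasurableMul₂ K]

/-- Over a field of characteristic zero, `N` is an affine space. -/
noncomputable def NEquiv : N n K ≃ᵐ (NIndex n → K) where
  toEquiv := Equiv.ofBijective NCoord NCoord_bijective
  measurable_toFun := measurable_NCoord
  measurable_invFun := by
    intro s hs
    rw [← Equiv.image_eq_preimage_symm]
    exact measurableEmbedding_NCoord.measurableSet_image' hs

lemma NEquiv_apply (u : N n K) : NEquiv u = NCoord u := rfl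

lemma NCoord_NEquiv_symm (v : NIndex n → K) : NCoord (NEquiv.symm v) = v :=
  NEquiv.apply_symm_apply v

/-- The bijection `theta` as a measurable equivalence. -/
noncomputable def thetaEquiv [TopologicalSpace K] [IsTopologicalRing K] [BorelSpace K]
    [SecondCountableTopology K] : (NIndex n ⊕ Fin n → K) ≃ᵐ (NIndex n ⊕ Fin n → K) where
  toEquiv := Equiv.ofBijective theta theta_bijective
  measurable_toFun := continuous_theta.measurable
  measurable_invFun := by
    intro s hs
    rw [← Equiv.image_eq_preimage_symm]
    exact (continuous_theta.measurable.measurableEmbedding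
      theta_bijective.1).measurableSet_image' hs

end NCoordEquiv

/-! ### The Jacobian of a triangular map -/

section PiMeasure

lemma pi_smul_measure {ι X : Type*} [Fintype ι] [MeasurableSpace X] (μ : Measure X)
    [SigmaFinite μ] (c : ι → ℝ≥0∞) (hc : ∀ i, c i ≠ ∞) :
    (Measure.pi fun i => c i • μ) = (∏ i, c i) • Measure.pi fun _ : ι => μ := by
  have : ∀ i, SigmaFinite (c i • μ) := fun i => by
    lift c i to ℝ≥0 using hc i with d
    exact inferInstanceAs (SigmaFinite (d • μ))
  refine Measure.pi_eq fun s _ => ?_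
  rw [Measure.smul_apply, Measure.pi_pi, smul_eq_mul, ← Finset.prod_mul_distrib]
  rfl

variable {ι K : Type*} [Fintype ι] [NontriviallyNormedField K] [MeasurableSpace K] [BorelSpace K]
  {μ : Measure K} [SigmaFinite μ] [μ.IsAddLeftInvariant]

/-- The Jacobian of a triangular map. The hypothesis `hμ` says that `‖·‖` is the normalized absolute
value, by which multiplication scales Haar measure. -/
lemma IsTriangular.map_pi {r : ι → ℕ} {c : ι → K} {F : (ι → K) → ι → K}
    (h : IsTriangular r c F) (hc : ∀ i, c i ≠ 0) (hF : Measurable F)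
    (hμ : ∀ c : K, c ≠ 0 → μ.map (c * ·) = ENNReal.ofReal ‖c‖⁻¹ • μ) :
    (Measure.pi fun _ => μ).map F = (∏ i, ENNReal.ofReal ‖c i‖⁻¹) • Measure.pi fun _ => μ := by
  classical
  rw [← pi_smul_measure μ _ (fun i => ENNReal.ofReal_ne_top)]
  have : ∀ i, SigmaFinite (ENNReal.ofReal ‖c i‖⁻¹ • μ) := fun i =>
    inferInstanceAs (SigmaFinite (Real.toNNReal ‖c i‖⁻¹ • μ))
  refine (measurePreserving_pi_of_triangular r F hF (fun i x y hxy hi => ?_) (fun _ => μ)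
    (fun i => ENNReal.ofReal ‖c i‖⁻¹ • μ) fun i x => ?_).map_eq
  · rw [← sub_eq_zero, h i x y hxy, hi, sub_self, mul_zero]
  · have h1 : (fun t => F (Function.update x i t) i) =
        (fun t => (F (Function.update x i 0) i) + t) ∘ (c i * ·) := by
      ext t
      have h2 := h i (Function.update x i t) (Function.update x i 0) (fun j hj => by
        rw [Function.update_of_ne (by rintro rfl; exact hj.ne rfl),
          Function.update_of_ne (by rintro rfl; exact hj.ne rfl)])
      simp only [Function.update_self, sub_zero] at h2
      simp only [Function.comp_apply, ← h2]
      ring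
    rw [h1, ← Measure.map_map (measurable_const_add _) (measurable_const_mul _), hμ _ (hc i),
      Measure.map_smul, map_add_left_eq_self]

end PiMeasure


/-! ### Integration over the slice -/

section SliceFormula

variable {n : ℕ} {K : Type*} [NontriviallyNormedField K] [CharZero K] [MeasurableSpace K]
  [BorelSpace K] [ProperSpace K]

/-- A representative in the slice of the `N`-orbit with invariant polynomial `monicPoly a`. -/
noncomputable def sec (a : Fin n → K) : W₀ n K := slice (thetaEquiv.symm (Sum.elim 0 a))

lemma isSlice_sec (a : Fin n → K) : IsSlice (sec a).1 := isSlice_slice _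

lemma theta_thetaEquiv_symm (w : NIndex n ⊕ Fin n → K) : theta (thetaEquiv.symm w) = w :=
  thetaEquiv.apply_symm_apply w

lemma thetaEquiv_symm_theta (y : NIndex n ⊕ Fin n → K) : thetaEquiv.symm (theta y) = y :=
  thetaEquiv.symm_apply_apply y

lemma inv_sec (a : Fin n → K) : inv (sec a).1 = monicPoly a := by
  rw [inv_eq_monicPoly_iff]
  ext k
  exact congrFun (theta_thetaEquiv_symm (Sum.elim 0 a)) (.inr k)

lemma measurable_unip_smul {Y : Type*} [MeasurableSpace Y] {u : Y → N n K} {B : Y → W n K}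
    (hu : Measurable u) (hB : Measurable B) : Measurable fun y => unip (u y) • B y := by
  rw [measurable_N_iff] at hu
  rw [measurable_W_iff] at hB ⊢
  intro i j
  simp only [unip_smul, Matrix.mul_apply, Matrix.transpose_apply]
  exact Finset.measurable_sum _ fun k _ =>
    (Finset.measurable_sum _ fun l _ => (hu _ _).mul (hB _ _)).mul (hu _ _)

lemma measurable_slice : Measurable fun y : NIndex n ⊕ Fin n → K => (slice y).1 :=
  measurable_W_iff.mpr fun i j =>
    (continuous_mat_apply continuous_const continuous_id i j).measurable

lemma measurable_sec : Measurable fun a : Fin n → K => (sec a).1 := by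
  refine measurable_slice.comp (thetaEquiv.symm.measurable.comp ?_)
  refine measurable_pi_lambda _ fun t => ?_
  rcases t with x | k
  · exact measurable_const
  · exact measurable_pi_apply k

variable (μ : Measure K) [μ.IsAddHaarMeasure]

/-- The measure `∏ du_ij` on `N(K)`. -/
noncomputable def duFree (n : ℕ) : Measure (N n K) :=
  (Measure.pi fun _ : NIndex n => μ).comap NCoord

lemma measurePreserving_NCoord : MeasurePreserving NCoord (duFree μ n) (Measure.pi fun _ => μ) := by
  refine ⟨measurable_NCoord, ?_⟩
  rw [duFree, measurableEmbedding_NCoord.map_comap, NCoord_bijective.2.range_eq,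
    Measure.restrict_univ]

lemma duFree_eq_map : duFree μ n = (Measure.pi fun _ => μ).map NEquiv.symm := by
  rw [← (measurePreserving_NCoord μ).map_eq, Measure.map_map NEquiv.symm.measurable
    measurable_NCoord]
  have : (NEquiv.symm : (NIndex n → K) → N n K) ∘ NCoord = id :=
    funext fun u => NEquiv.symm_apply_apply u
  rw [this, Measure.map_id]

instance : SigmaFinite (duFree μ n) := by
  rw [duFree_eq_map]
  exact NEquiv.symm.sigmaFinite_map

/-- A map on `N` which is triangular with respect to the height `i - j`, with diagonal entries `c`
of norm one, preserves `∏ du_ij`. -/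
lemma measurePreserving_of_height {G : N n K → NIndex n → K} (hG : Measurable G) {c : K}
    (hc : ‖c‖ = 1) (h : ∀ (u u' : N n K) (x : NIndex n),
      (∀ i j : Fin n, (i : ℕ) < j + ((x.1.1 : ℕ) - x.1.2) → u.1 i j = u'.1 i j) →
      G u x - G u' x = c * (NCoord u x - NCoord u' x))
    (hμ : ∀ c : K, c ≠ 0 → μ.map (c * ·) = ENNReal.ofReal ‖c‖⁻¹ • μ) :
    MeasurePreserving G (duFree μ n) (Measure.pi fun _ => μ) := by
  refine ⟨hG, ?_⟩
  have hc0 : c ≠ 0 := by rw [← norm_ne_zero_iff, hc]; exact one_ne_zero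
  have hT : IsTriangular (fun x : NIndex n => (x.1.1 : ℕ) - x.1.2) (fun _ => c)
      (fun v => G (NEquiv.symm v)) := by
    intro x v v' hv
    rw [h (NEquiv.symm v) (NEquiv.symm v') x ?_, NCoord_NEquiv_symm, NCoord_NEquiv_symm]
    intro i j hij
    refine N_entry_congr (fun x' hx' => ?_) i j hij
    rw [NCoord_NEquiv_symm, NCoord_NEquiv_symm]
    exact hv x' hx'
  have h1 := hT.map_pi (μ := μ) (fun _ => hc0) (hG.comp NEquiv.symm.measurable) hμ
  rw [duFree_eq_map, Measure.map_map hG NEquiv.symm.measurable]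
  refine h1.trans ?_
  simp [hc]

/-- Right translations preserve `∏ du_ij`. -/
lemma measurePreserving_mul_right_N (v : N n K)
    (hμ : ∀ c : K, c ≠ 0 → μ.map (c * ·) = ENNReal.ofReal ‖c‖⁻¹ • μ) :
    MeasurePreserving (fun u : N n K => u * v) (duFree μ n) (duFree μ n) := by
  have hm : Measurable fun u : N n K => u * v := by
    rw [measurable_N_iff]
    intro i j
    simp only [coe_mul_N, Matrix.mul_apply]
    exact Finset.measurable_sum _ fun k _ =>
      (measurable_N_iff.mp measurable_id i k).mul measurable_const
  have h1 : MeasurePreserving (fun u => NCoord (u * v)) (duFree μ n)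
      (Measure.pi fun _ => μ) := by
    refine measurePreserving_of_height μ (measurable_NCoord.comp hm) norm_one
      (fun u u' x hu => ?_) hμ
    simp only [NCoord, coe_mul_N, Matrix.mul_apply, one_mul]
    have hx := Fin.lt_def.mp x.2.1
    rw [← Finset.sum_sub_distrib, Finset.sum_eq_single x.1.2]
    · rw [v.2.2.1]; ring
    · intro k _ hk
      rcases lt_or_gt_of_ne hk with h | h
      · rw [v.2.2.2 _ _ h]; ring
      · rw [Fin.lt_def] at h
        rw [hu _ _ (by omega), sub_self]
    · simp
  refine ⟨hm, ?_⟩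
  have h2 := congrArg (Measure.map NEquiv.symm) h1.map_eq
  rw [Measure.map_map NEquiv.symm.measurable h1.measurable, ← duFree_eq_map] at h2
  rw [← h2]
  congr 1
  exact funext fun u => (NEquiv.symm_apply_apply (u * v)).symm

/-- In the orbit of `sec a` the free coordinates of `theta` have the same measure as those on
`N`. -/
lemma measurePreserving_krylov_orbit (a : Fin n → K)
    (hμ : ∀ c : K, c ≠ 0 → μ.map (c * ·) = ENNReal.ofReal ‖c‖⁻¹ • μ) :
    MeasurePreserving (fun (u : N n K) (x : NIndex n) =>
      krylov (adj (unip u • (sec a).1)) x.1.1 x.1.2) (duFree μ n) (Measure.pi fun _ => μ) := by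
  have hform : ∀ (u : N n K) (k i : Fin n), krylov (adj (unip u • (sec a).1)) k i =
      ∑ l : Fin n, u.1 i.rev l.rev * krylov (adj (sec a).1) k l := by
    intro u k i
    rw [krylov_unip_smul]
    simp only [Matrix.mulVec, dotProduct, mul_antiDiag_apply, antiDiag_mul_apply]
  -- The leading term is the entry of `u` at the position reflected in the anti-diagonal, which by
  -- `N_sub_add_sub_rev` is minus the free coordinate, up to entries of smaller height.
  refine measurePreserving_of_height μ (c := -1) ?_ (by simp) (fun u u' x hu => ?_) hμ
  · refine measurable_pi_lambda _ fun x => ?_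
    simp only [hform]
    exact Finset.measurable_sum _ fun l _ =>
      (measurable_N_iff.mp measurable_id _ _).mul measurable_const
  · have hx := Fin.lt_def.mp x.2.1
    have h1 := N_sub_add_sub_rev (by omega) hu x.1.1 x.1.2 (by omega)
    have hH := (isSlice_sec a).isHess
    rw [hform, hform, ← Finset.sum_sub_distrib, Finset.sum_eq_single x.1.1]
    · rw [krylov_self hH]
      simp only [NCoord]
      linear_combination h1
    · intro l _ hl
      rcases lt_or_gt_of_ne hl with h | h
      · rw [Fin.lt_def] at h
        have h2 := Fin.val_rev l
        have h3 := Fin.val_rev x.1.2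
        rw [hu _ _ (by omega), sub_self]
      · rw [krylov_of_lt hH h]; ring
    · simp

/-- The Jacobian of `theta`. -/
lemma prod_thetaCoeff : ∏ t : NIndex n ⊕ Fin n, ENNReal.ofReal ‖thetaCoeff K t‖⁻¹ =
    ENNReal.ofReal (‖(2 : K)‖⁻¹ ^ (n / 2)) := by
  rw [Fintype.prod_sum_type]
  simp only [thetaCoeff, Sum.elim_inl, Sum.elim_inr, norm_one, inv_one, ENNReal.ofReal_one,
    Finset.prod_const_one, one_mul, norm_mul, norm_neg, norm_pow, one_pow]
  rw [← ENNReal.ofReal_prod_of_nonneg (fun _ _ => by positivity)]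
  congr 1
  rw [Fin.prod_univ_eq_prod_range (fun k => ‖(if Even k then (1 : K) else 2)‖⁻¹)]
  induction n with
  | zero => simp
  | succ n ih =>
    rw [Finset.prod_range_succ, ih]
    rcases Nat.even_or_odd n with h | h
    · rw [if_pos h, norm_one, inv_one, mul_one]
      congr 1
      rw [Nat.even_iff] at h
      omega
    · rw [if_neg (Nat.not_even_iff_odd.mpr h), ← pow_succ]
      congr 1
      rw [Nat.odd_iff] at h
      omega

/-- The slice is fibred over the space of polynomials by the orbits of `N`. -/
theorem lintegral_slice (hμ : ∀ c : K, c ≠ 0 → μ.map (c * ·) = ENNReal.ofReal ‖c‖⁻¹ • μ)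
    {G : W n K → ℝ≥0∞} (hG : Measurable G) :
    ∫⁻ y, G (slice y).1 ∂(Measure.pi fun _ => μ) = ENNReal.ofReal (‖(2 : K)‖⁻¹ ^ (n / 2)) *
      ∫⁻ a : Fin n → K, ∫⁻ u, G (unip u • (sec a).1) ∂(duFree μ n) ∂(Measure.pi fun _ => μ) := by
  have h1 := (theta_triangular (n := n) (K := K)).map_pi (μ := μ) thetaCoeff_ne_zero
    continuous_theta.measurable hμ
  rw [prod_thetaCoeff] at h1
  have hm : Measurable fun w : NIndex n ⊕ Fin n → K => G (slice (thetaEquiv.symm w)).1 :=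
    hG.comp (measurable_slice.comp thetaEquiv.symm.measurable)
  have h2 : ∫⁻ y, G (slice y).1 ∂(Measure.pi fun _ => μ) =
      ENNReal.ofReal (‖(2 : K)‖⁻¹ ^ (n / 2)) *
        ∫⁻ w, G (slice (thetaEquiv.symm w)).1 ∂(Measure.pi fun _ => μ) := by
    rw [← smul_eq_mul, ← lintegral_smul_measure, ← h1,
      lintegral_map hm continuous_theta.measurable]
    simp only [thetaEquiv_symm_theta]
  rw [h2]
  congr 1
  -- Split the coordinates of `theta` into those along an orbit and the coefficients of `inv`.
  have h3 := (measurePreserving_sumPiEquivProdPi_symm (X := fun _ : NIndex n ⊕ Fin n => K)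
    (fun _ => μ))
  rw [← h3.lintegral_comp hm]
  refine (lintegral_prod_symm' _ (hm.comp h3.measurable)).trans ?_
  refine lintegral_congr fun a => ?_
  have h4 := measurePreserving_krylov_orbit μ a hμ
  refine (h4.lintegral_comp
    (hm.comp (h3.measurable.comp (measurable_id.prodMk measurable_const)))).symm.trans ?_
  refine lintegral_congr fun u => ?_
  obtain ⟨y, hy⟩ := ((isSlice_sec a).unip_smul u).eq_slice
  have h5 : (MeasurableEquiv.sumPiEquivProdPi fun _ : NIndex n ⊕ Fin n => K).symm
      ((fun x : NIndex n => krylov (adj (unip u • (sec a).1)) x.1.1 x.1.2), a) = theta y := by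
    ext t
    rcases t with x | k
    · rw [hy]
      rfl
    · simp only [theta, Sum.elim_inr, ← hy, inv_smul, inv_sec, monicPoly_coeff]
      rfl
  change G (slice (thetaEquiv.symm ((MeasurableEquiv.sumPiEquivProdPi
    fun _ : NIndex n ⊕ Fin n => K).symm
      ((fun x : NIndex n => krylov (adj (unip u • (sec a).1)) x.1.1 x.1.2), a)))).1 = _
  rw [h5, thetaEquiv_symm_theta, ← hy]

end SliceFormula


/-! ### The action of the torus on `W₀` -/

section Torus

/-- Summation by parts, written multiplicatively: it turns products over the coordinates `s_k` of
the torus, which are ratios of successive diagonal entries, into products over the diagonal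
entries. -/
lemma prod_div_zpow {G : Type*} [CommGroup G] (t : ℕ → G) (e : ℕ → ℤ) (he : e 0 = 0) (M : ℕ) :
    ∏ k ∈ Finset.range M, (t (k + 1) / t k) ^ e (k + 1) =
      t M ^ e M * ∏ k ∈ Finset.range M, t k ^ (e k - e (k + 1)) := by
  induction M with
  | zero => simp [he]
  | succ M ih =>
    rw [Finset.prod_range_succ, Finset.prod_range_succ, ih, div_zpow, zpow_sub]
    simp only [div_eq_mul_inv]
    have h : t M ^ e M * (t M ^ e M)⁻¹ = 1 := mul_inv_cancel _
    rw [mul_comm (t M ^ e M), mul_assoc, mul_comm (t M ^ e M)]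
    rw [mul_comm (t M ^ e M) (t M ^ e (M + 1))⁻¹]
    simp only [mul_assoc, mul_comm, mul_left_comm]

variable {n : ℕ} {R : Type*} [CommRing R]

lemma torus_smul_apply (s : Fin (n / 2) → Rˣ) (B : W n R) (i j : Fin n) :
    (torus s • B).1 i j =
      (((torusMult s)⁻¹ * torusEntry s i * torusEntry s j : Rˣ) : R) * B.1 i j := by
  rw [coe_smul_similitudes]
  simp only [torus, torusGL, Matrix.smul_apply, Matrix.diagonal_transpose, Matrix.mul_diagonal,
    Matrix.diagonal_mul, smul_eq_mul, Units.val_mul]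
  ring

lemma sc_mul (s s' : Fin (n / 2) → Rˣ) (k : ℕ) : sc (s * s') k = sc s k * sc s' k := by
  unfold sc
  split_ifs <;> simp

lemma torusMult_mul (s s' : Fin (n / 2) → Rˣ) :
    torusMult (s * s') = torusMult s * torusMult s' := by
  unfold torusMult
  split_ifs
  · simp
  · simp only [sc_mul]
    exact mul_mul_mul_comm _ _ _ _

lemma torusHalf_mul (s s' : Fin (n / 2) → Rˣ) (i : ℕ) :
    torusHalf (s * s') i = torusHalf s i * torusHalf s' i := by
  unfold torusHalf
  split_ifs <;> simp [sc_mul, Finset.prod_mul_distrib, mul_comm]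

lemma torusEntry_mul (s s' : Fin (n / 2) → Rˣ) (i : Fin n) :
    torusEntry (s * s') i = torusEntry s i * torusEntry s' i := by
  unfold torusEntry
  split_ifs
  · exact torusHalf_mul _ _ _
  · rw [torusHalf_mul, torusMult_mul, mul_inv, mul_mul_mul_comm]

/-- The entries `t_{i+1}` of the torus element, indexed by natural numbers. -/
def tN (s : Fin (n / 2) → Rˣ) (i : ℕ) : Rˣ := if h : i < n then torusEntry s ⟨i, h⟩ else 1

lemma tN_val (s : Fin (n / 2) → Rˣ) (i : Fin n) : tN s i = torusEntry s i := by simp [tN]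

lemma tN_mul_tN (s : Fin (n / 2) → Rˣ) {i j : ℕ} (h : i + j + 1 = n) :
    tN s i * tN s j = torusMult s := by
  rw [tN, tN, dif_pos (by omega), dif_pos (by omega), ← torusEntry_mul_rev s ⟨i, by omega⟩]
  congr 2
  exact Fin.ext (by rw [Fin.val_rev]; simp only; omega)

lemma tN_of_odd (hn : Odd n) (s : Fin (n / 2) → Rˣ) {i : ℕ} (hi : i ≤ n / 2) :
    tN s i = ∏ k ∈ Finset.Icc (i + 1) (n / 2), (sc s k)⁻¹ := by
  have := Nat.odd_iff.mp hn
  rw [tN, dif_pos (by omega), torusEntry, if_pos (by simp only; omega), torusHalf, if_pos hn]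

lemma tN_of_even (hn : ¬ Odd n) (s : Fin (n / 2) → Rˣ) {i : ℕ} (hi : i + 1 < n / 2) :
    tN s i = ∏ k ∈ Finset.Icc (i + 1) ((n - 4) / 2), (sc s k)⁻¹ := by
  rw [tN, dif_pos (by omega), torusEntry, if_pos (by simp only; omega), torusHalf, if_neg hn,
    if_pos (by simp only; omega)]

lemma tN_of_even_half (hn : ¬ Odd n) (s : Fin (n / 2) → Rˣ) {i : ℕ} (hi : i + 1 = n / 2) :
    tN s i = sc s (n / 2 - 1) := by
  rw [tN, dif_pos (by omega), torusEntry, if_pos (by simp only; omega), torusHalf, if_neg hn,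
    if_neg (by simp only; omega)]

lemma tN_odd_half (hn : Odd n) (s : Fin (n / 2) → Rˣ) : tN s (n / 2) = 1 := by
  rw [tN_of_odd hn s le_rfl, Finset.Icc_eq_empty (by omega), Finset.prod_empty]

/-- The coordinates of the torus are ratios of successive diagonal entries, apart from the last one
for even `n`. -/
lemma tN_div_tN (s : Fin (n / 2) → Rˣ) {k : ℕ} (hk : k + 1 ≤ n / 2)
    (h : Odd n ∨ k + 1 < n / 2) : tN s (k + 1) / tN s k = sc s (k + 1) := by
  rw [div_eq_iff_eq_mul]
  by_cases hn : Odd n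
  · rw [tN_of_odd hn s hk, tN_of_odd hn s (by omega), ← Finset.insert_Icc_succ_left_eq_Icc hk,
      Finset.prod_insert (by simp)]
    simp
  · have h1 : k + 1 < n / 2 := h.resolve_left hn
    by_cases h2 : k + 2 < n / 2
    · rw [tN_of_even hn s h1, tN_of_even hn s h2,
        ← Finset.insert_Icc_succ_left_eq_Icc (a := k + 1) (by omega),
        Finset.prod_insert (by simp)]
      simp
    · rw [tN_of_even hn s h1, tN_of_even_half hn s (by omega), Finset.Icc_eq_empty (by omega),
        Finset.prod_empty, mul_one]
      congr 1
      omega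

/-- The factor by which the torus element `s` scales the entry `b_{k+1, n-k-1}`. -/
def chi (s : Fin (n / 2) → Rˣ) (k : Fin (n / 2)) : Rˣ := tN s k / tN s (k + 1)

lemma chi_of_lt (s : Fin (n / 2) → Rˣ) (k : Fin (n / 2)) (h : Odd n ∨ (k : ℕ) + 1 < n / 2) :
    chi s k = (s k)⁻¹ := by
  rw [chi, ← inv_div, tN_div_tN s (by omega) h]
  congr 1
  simp [sc, show (k : ℕ) + 1 ≤ n / 2 by omega]

lemma chi_of_even (hn3 : 3 ≤ n) (hn : ¬ Odd n) (s : Fin (n / 2) → Rˣ) (k : Fin (n / 2))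
    (hk : (k : ℕ) + 1 = n / 2) : chi s k = s ⟨k - 1, by omega⟩ * (s k)⁻¹ := by
  have hne := Nat.not_odd_iff.mp hn
  have h1 := tN_mul_tN s (i := k) (j := k + 1) (by omega)
  have h2 : torusMult s = sc s (n / 2 - 1) * sc s (n / 2) := by simp [torusMult, hn]
  rw [chi, div_eq_iff_eq_mul, ← mul_right_inj (tN s k)]
  have h3 : tN s k = s ⟨k - 1, by omega⟩ := by
    rw [tN_of_even_half hn s hk, sc, dif_pos (by omega)]
    congr 1
    exact Fin.ext (by simp only; omega)
  have h4 : sc s (n / 2) = s k := by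
    rw [sc, dif_pos (by omega)]
    congr 1
    exact Fin.ext (by simp only; omega)
  have h5 : sc s (n / 2 - 1) = tN s k := by
    rw [tN_of_even_half hn s hk]
  rw [mul_left_comm, h1, h2, h4, h5, h3, mul_left_comm, mul_assoc, inv_mul_cancel, mul_one]

lemma wt_eq_div (s : Fin (n / 2) → Rˣ) (i j : Fin n) :
    (torusMult s)⁻¹ * torusEntry s i * torusEntry s j = torusEntry s i / torusEntry s j.rev := by
  rw [← torusEntry_mul_rev s j, mul_inv, div_eq_mul_inv]
  rw [mul_comm (torusEntry s j)⁻¹, mul_assoc, mul_assoc, mul_comm, mul_assoc, mul_assoc,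
    mul_left_comm, inv_mul_cancel_left]

lemma torus_smul_mat (s : Fin (n / 2) → Rˣ) (z : Fin (n / 2) → R) (y : NIndex n ⊕ Fin n → R) :
    torus s • (mat z y).1 = (mat (fun k => (chi s k : R) * z k) fun t =>
      (((torusMult s)⁻¹ * torusEntry s (posW₀ (.inr t)).1.1 * torusEntry s (posW₀ (.inr t)).1.2 :
        Rˣ) : R) * y t).1 := by
  have key : ∀ i j : Fin n, i ≤ j → (torus s • (mat z y).1).1 i j =
      (mat (fun k => (chi s k : R) * z k) fun t => (((torusMult s)⁻¹ *
        torusEntry s (posW₀ (.inr t)).1.1 * torusEntry s (posW₀ (.inr t)).1.2 : Rˣ) : R) *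
          y t).1.1 i j := by
    intro i j hij
    rw [torus_smul_apply]
    by_cases h : n ≤ (i + 1 : ℕ) + (j + 1)
    · obtain ⟨t, ht⟩ := posW₀_bijective.2 ⟨(i, j), hij, h⟩
      have h1 : i = (posW₀ t).1.1 := by rw [ht]
      have h2 : j = (posW₀ t).1.2 := by rw [ht]
      rw [h1, h2, mat_posW₀, mat_posW₀]
      rcases t with k | t
      · simp only [Sum.elim_inl]
        congr 2
        rw [wt_eq_div, chi, ← tN_val, ← tN_val]
        congr 2
        rw [Fin.val_rev]
        simp only [posW₀]
        omega
      · rfl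
    · rw [(mat z y).2 i j (by omega), (mat _ _).2 i j (by omega), mul_zero]
  refine Subtype.ext (Matrix.ext fun i j => ?_)
  rcases le_total i j with h | h
  · exact key i j h
  · rw [mat_symm, ← key j i h]
    exact ((torus s • (mat z y).1).2.apply i j).symm

/-- In the product of the diagonal entries strictly between the positions `j` and `n - 1 - j`, the
entries at reflected positions pair off to `torusMult s`; the middle one, for odd `n`, is `1`. -/
lemma prod_Icc_tN (s : Fin (n / 2) → Rˣ) (d : ℕ) : ∀ j, 2 * j + 2 + d = n →
    ∏ i ∈ Finset.Icc (j + 1) (n - 2 - j), tN s i = torusMult s ^ (d / 2) := by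
  induction d using Nat.strong_induction_on with
  | _ d ih =>
    intro j hj
    rcases Nat.lt_or_ge d 2 with hd | hd
    · interval_cases d
      · rw [Finset.Icc_eq_empty (by omega)]
        simp
      · have hn : Odd n := ⟨j + 1, by omega⟩
        rw [show n - 2 - j = j + 1 by omega, Finset.Icc_self, Finset.prod_singleton,
          show j + 1 = n / 2 by omega, tN_odd_half hn]
        simp
    · rw [← Finset.insert_Icc_succ_left_eq_Icc (by omega), Finset.prod_insert (by simp),
        Order.succ_eq_add_one, show n - 2 - j = (n - 2 - (j + 1)) + 1 by omega,
        ← Finset.insert_Icc_right_eq_Icc_add_one (by omega), Finset.prod_insert (by simp),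
        ← mul_assoc, tN_mul_tN s (by omega)]
      have := ih (d - 2) (by omega) (j + 1) (by omega)
      rw [this, ← pow_succ']
      congr 1
      omega

end Torus


/-! ### The Jacobian identity for the torus -/

section Jacobian

variable {n : ℕ} {R : Type*} [CommRing R]

lemma prod_Icc_one {G : Type*} [CommMonoid G] (f : ℕ → G) (M : ℕ) :
    ∏ k ∈ Finset.Icc 1 M, f k = ∏ k ∈ Finset.range M, f (k + 1) := by
  induction M with
  | zero => simp
  | succ M ih => rw [Finset.prod_Icc_succ_top (by omega), ih, Finset.prod_range_succ]

lemma prod_pairs {G : Type*} [CommMonoid G] (p : Fin n × Fin n → Prop) [DecidablePred p]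
    (f : Fin n → Fin n → G) :
    ∏ x : {x : Fin n × Fin n // p x}, f x.1.1 x.1.2 =
      ∏ i : Fin n, ∏ j : Fin n, if p (i, j) then f i j else 1 := by
  rw [← Fintype.prod_prod_type', ← Finset.prod_filter (fun x : Fin n × Fin n => p x)
    (fun x => f x.1 x.2)]
  exact (Finset.prod_subtype _ (fun x => by simp) (fun x : Fin n × Fin n => f x.1 x.2)).symm

/-- The product of the roots of `N`, sorted by columns. -/
lemma prod_NIndex_div (s : Fin (n / 2) → Rˣ) :
    ∏ x : NIndex n, torusEntry s x.1.2 / torusEntry s x.1.1 =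
      ∏ j ∈ Finset.range (n / 2),
        tN s j ^ (n - 2 - 2 * j) / torusMult s ^ ((n - 2 - 2 * j) / 2) := by
  have h1 : ∀ j : ℕ, (∏ i : Fin n, if j < (i : ℕ) ∧ (i + 1 : ℕ) + (j + 1) ≤ n then
      tN s j / tN s i else 1) =
      if j < n / 2 then tN s j ^ (n - 2 - 2 * j) / torusMult s ^ ((n - 2 - 2 * j) / 2) else 1 := by
    intro j
    rw [Fin.prod_univ_eq_prod_range (fun i : ℕ => if j < i ∧ (i + 1 : ℕ) + (j + 1) ≤ n then
      tN s j / tN s i else 1), ← Finset.prod_filter]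
    split_ifs with h
    · rw [show (Finset.range n).filter (fun i => j < i ∧ (i + 1 : ℕ) + (j + 1) ≤ n) =
        Finset.Icc (j + 1) (n - 2 - j) by ext i; simp; omega, Finset.prod_div_distrib,
        prod_Icc_tN s (n - 2 - 2 * j) j (by omega), Finset.prod_const, Nat.card_Icc]
      congr 2
      omega
    · rw [show (Finset.range n).filter (fun i => j < i ∧ (i + 1 : ℕ) + (j + 1) ≤ n) = ∅ by
        ext i; simp; omega, Finset.prod_empty]
  rw [prod_pairs _ (fun i j => torusEntry s j / torusEntry s i), Finset.prod_comm]
  simp only [← tN_val, Fin.lt_def]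
  simp only [h1]
  rw [Fin.prod_univ_eq_prod_range (fun j : ℕ => if j < n / 2 then
    tN s j ^ (n - 2 - 2 * j) / torusMult s ^ ((n - 2 - 2 * j) / 2) else 1), ← Finset.prod_filter]
  congr 1
  ext j
  simp
  omega

/-- `δ(s)` is the determinant of the conjugation by `s⁻¹` on the coordinates of `N`. -/
lemma delta_eq (hn3 : 3 ≤ n) (s : Fin (n / 2) → Rˣ) :
    delta s = ∏ x : NIndex n, torusEntry s x.1.2 / torusEntry s x.1.1 := by
  rw [prod_NIndex_div]
  by_cases hn : Odd n
  · have h1 : torusMult s = 1 := by simp [torusMult, hn]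
    have hn' := Nat.odd_iff.mp hn
    rw [delta, if_pos hn, prod_Icc_one]
    have h2 := prod_div_zpow (fun k => tN s k) (fun k => (k : ℤ) ^ 2 - 2 * k * (n / 2 : ℕ))
      (by simp) (n / 2)
    simp only [tN_odd_half hn, one_zpow, one_mul] at h2
    refine Eq.trans (Finset.prod_congr rfl fun k hk => ?_) (h2.trans
      (Finset.prod_congr rfl fun k hk => ?_))
    · rw [tN_div_tN s (by have := Finset.mem_range.mp hk; omega) (Or.inl hn)]
    · have := Finset.mem_range.mp hk
      rw [h1, one_pow, div_one, ← zpow_natCast]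
      congr 1
      push_cast [Nat.cast_sub (show 2 * k ≤ n - 2 by omega), Nat.cast_sub (show 2 ≤ n by omega)]
      have : (n : ℤ) = 2 * (n / 2 : ℕ) + 1 := by omega
      push_cast at this
      linear_combination (-1 : ℤ) * this
  · obtain ⟨m, rfl⟩ : ∃ m, n = 2 * m + 4 := by
      have := Nat.not_odd_iff.mp hn
      exact ⟨n / 2 - 2, by omega⟩
    have hm : (2 * m + 4) / 2 = m + 2 := by omega
    have h1 : torusMult s = sc s ((2 * m + 4) / 2 - 1) * sc s ((2 * m + 4) / 2) := by
      simp [torusMult, hn]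
    rw [delta, if_neg hn, prod_Icc_one, ← h1, show (2 * m + 4 - 4) / 2 = m by omega, hm]
    -- The coordinates `s_1, …, s_{m-2}` are ratios of diagonal entries, and the multiplier
    -- `s_{m-1} s_m` occurs with the exponent `-∑ ⌊(n - 2 - 2j) / 2⌋ = -(n² - 2n) / 8`.
    have h2 := prod_div_zpow (fun k => tN s k)
      (fun k => (k : ℤ) ^ 2 - k * (((2 * m + 4 : ℕ) : ℤ) - 1)) (by simp) m
    have h3 : tN s m = 1 := by
      rw [tN_of_even hn s (by omega), Finset.Icc_eq_empty (by omega), Finset.prod_empty]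
    simp only [h3, one_zpow, one_mul] at h2
    rw [Finset.prod_div_distrib, mul_comm, zpow_neg, div_eq_mul_inv]
    congr 1
    · rw [Finset.prod_range_succ, Finset.prod_range_succ, h3, one_pow, mul_one,
        show 2 * m + 4 - 2 - 2 * (m + 1) = 0 by omega, pow_zero, mul_one]
      refine Eq.trans (Finset.prod_congr rfl fun k hk => ?_) (h2.trans
        (Finset.prod_congr rfl fun k hk => ?_))
      · have := Finset.mem_range.mp hk
        rw [tN_div_tN s (by omega) (Or.inr (by omega))]
      · have := Finset.mem_range.mp hk
        rw [← zpow_natCast]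
        congr 1
        rw [Nat.cast_sub (by omega), Nat.cast_sub (by omega)]
        push_cast
        ring
    · congr 1
      rw [Finset.prod_pow_eq_pow_sum, ← zpow_natCast]
      congr 1
      have h4 : ∀ m : ℕ, ((∑ i ∈ Finset.range (m + 2), (2 * m + 4 - 2 - 2 * i) / 2 : ℕ) : ℤ) * 8 =
          ((2 * m + 4 : ℕ) : ℤ) ^ 2 - 2 * ((2 * m + 4 : ℕ) : ℤ) := by
        intro m
        induction m with
        | zero => simp [Finset.sum_range_succ]
        | succ m ih =>
          rw [Finset.sum_range_succ']
          have : ∀ i, (2 * (m + 1) + 4 - 2 - 2 * (i + 1)) / 2 = (2 * m + 4 - 2 - 2 * i) / 2 :=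
            fun i => by omega
          simp only [this]
          rw [Nat.cast_add, add_mul, ih, show (2 * (m + 1) + 4 - 2 - 2 * 0) / 2 = m + 2 by omega]
          push_cast
          ring
      rw [← h4 m]
      omega

lemma delta_mul (hn3 : 3 ≤ n) (s s' : Fin (n / 2) → Rˣ) : delta (s * s') = delta s * delta s' := by
  simp only [delta_eq hn3, torusEntry_mul, mul_div_mul_comm, Finset.prod_mul_distrib]

/-- The factor by which the torus scales the coordinates of `W₀` off the entries `b_{k, n-k}`. -/
def wt (s : Fin (n / 2) → Rˣ) (t : NIndex n ⊕ Fin n) : Rˣ :=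
  (torusMult s)⁻¹ * torusEntry s (posW₀ (.inr t)).1.1 * torusEntry s (posW₀ (.inr t)).1.2

/-- The weights of the torus on the lines `i + j > n` are `t_i / t_{n+1-j}`. The entries off the
diagonal contribute the inverses of the roots in `δ`, and the diagonal entries contribute
`torusMult s / t_j ^ 2`. -/
lemma prod_wt (s : Fin (n / 2) → Rˣ) :
    ∏ t, wt s t = (∏ x : NIndex n, torusEntry s x.1.1 / torusEntry s x.1.2) *
      ∏ j ∈ Finset.range (n / 2), torusMult s / tN s j ^ 2 := by
  have h1 : ∏ t, wt s t = ∏ x : W₀Index n, if n ≤ (x.1.1 + x.1.2 + 1 : ℕ) then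
      torusEntry s x.1.1 / torusEntry s x.1.2.rev else 1 := by
    rw [← posW₀_bijective.prod_comp, Fintype.prod_sum_type (α₁ := Fin (n / 2)),
      Finset.prod_eq_one (s := Finset.univ (α := Fin (n / 2))), one_mul]
    · refine Finset.prod_congr rfl fun t _ => ?_
      rw [if_pos, wt, wt_eq_div]
      rcases t with t | k
      · have := t.2
        simp only [posW₀]
        omega
      · simp only [posW₀]
        omega
    · intro k _
      rw [if_neg]
      simp only [posW₀]
      omega
  have h2 := prod_pairs (fun x : Fin n × Fin n => x.1 ≤ x.2 ∧ n ≤ (x.1 + 1 : ℕ) + (x.2 + 1))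
    (fun i j => if n ≤ (i + j + 1 : ℕ) then torusEntry s i / torusEntry s j.rev else 1)
  rw [h1, h2, prod_pairs _ (fun i j => torusEntry s i / torusEntry s j)]
  -- Reflect `j`: the case `i = j.rev` below is that of a diagonal entry of `B`.
  have h3 : ∀ i j : Fin n, (if i ≤ j.rev ∧ n ≤ (i + 1 : ℕ) + (j.rev + 1) then
      if n ≤ (i + j.rev + 1 : ℕ) then torusEntry s i / torusEntry s j.rev.rev else 1 else 1) =
      (if j < i ∧ (i + 1 : ℕ) + (j + 1) ≤ n then torusEntry s i / torusEntry s j else 1) *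
      (if i = j.rev then if 2 * (j + 1 : ℕ) ≤ n then torusEntry s i / torusEntry s j else 1
        else 1) := by
    intro i j
    have hj := Fin.val_rev j
    simp only [Fin.rev_rev, Fin.le_def, Fin.lt_def, Fin.ext_iff, hj]
    have := j.2
    split_ifs <;> first
      | omega
      | (simp; done)
      | (rw [show i = j from Fin.ext (by omega)]; simp)
  have h4 : ∀ i : Fin n, (∏ j : Fin n, if i ≤ j ∧ n ≤ (i + 1 : ℕ) + (j + 1) then
      if n ≤ (i + j + 1 : ℕ) then torusEntry s i / torusEntry s j.rev else 1 else 1) =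
      ∏ j : Fin n, (if j < i ∧ (i + 1 : ℕ) + (j + 1) ≤ n then torusEntry s i / torusEntry s j
        else 1) * (if i = j.rev then if 2 * (j + 1 : ℕ) ≤ n then torusEntry s i / torusEntry s j
          else 1 else 1) := by
    intro i
    rw [← Equiv.prod_comp Fin.revPerm]
    exact Finset.prod_congr rfl fun j _ => h3 i j
  simp only [h4, Finset.prod_mul_distrib]
  congr 1
  rw [Finset.prod_comm]
  simp only [Finset.prod_ite_eq', Finset.mem_univ, if_true]
  have h5 : ∀ j : Fin n, torusEntry s j.rev / torusEntry s j = torusMult s / tN s j ^ 2 := by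
    intro j
    rw [← torusEntry_mul_rev s j, tN_val, pow_two, mul_div_mul_left_eq_div]
  simp only [h5]
  rw [Fin.prod_univ_eq_prod_range (fun j : ℕ => if 2 * (j + 1) ≤ n then
    torusMult s / tN s j ^ 2 else 1), ← Finset.prod_filter]
  congr 1
  ext j
  simp
  omega

/-- The exponent of `b_{k+1, n-k-1}` in `λ`. -/
def lamExp (n k : ℕ) : ℕ := if Odd n ∨ k + 1 < n / 2 then 2 * k + 1 else k

lemma lam_mat (hn3 : 3 ≤ n) (z : Fin (n / 2) → R) (y : NIndex n ⊕ Fin n → R) :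
    lam (mat z y) = ∏ k : Fin (n / 2), z k ^ lamExp n k := by
  have hb : ∀ k (hk : k < n / 2), b (mat z y).1 (k + 1) (n - (k + 1)) = z ⟨k, hk⟩ := by
    intro k hk
    rw [b, dif_pos (by omega)]
    have h := mat_posW₀ z y (.inl ⟨k, hk⟩)
    simp only [Sum.elim_inl] at h
    rw [← h]
    exact congrArg ((mat z y).1.1 ⟨k, by omega⟩)
      (Fin.ext (show n - (k + 1) - 1 = n - 2 - k by omega))
  have h1 : ∏ k : Fin (n / 2), z k ^ lamExp n k =
      ∏ k ∈ Finset.range (n / 2), b (mat z y).1 (k + 1) (n - (k + 1)) ^ lamExp n k := by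
    rw [← Fin.prod_univ_eq_prod_range
      (fun k => b (mat z y).1 (k + 1) (n - (k + 1)) ^ lamExp n k)]
    exact Finset.prod_congr rfl fun k _ => by rw [hb k k.2]
  rw [h1, lam]
  split_ifs with hn
  · rw [prod_Icc_one]
    refine Finset.prod_congr rfl fun k _ => ?_
    rw [lamExp, if_pos (Or.inl hn)]
    congr 1
  · have := Nat.not_odd_iff.mp hn
    rw [prod_Icc_one, show n / 2 = (n - 2) / 2 + 1 by omega, Finset.prod_range_succ, mul_comm]
    congr 1
    · refine Finset.prod_congr rfl fun k hk => ?_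
      have := Finset.mem_range.mp hk
      rw [lamExp, if_pos (Or.inr (by omega))]
      rfl
    · rw [lamExp, if_neg (by rintro (h | h); exacts [hn h, by omega])]
      congr 2
      omega

/-- The weights on the line `i + j = n`, with the exponents from `λ` increased by one for the
measure, cancel the contribution of the diagonal entries in `prod_wt`. -/
lemma prod_chi_pow (hn3 : 3 ≤ n) (s : Fin (n / 2) → Rˣ) :
    ∏ k : Fin (n / 2), chi s k ^ (lamExp n k + 1) =
      ∏ j ∈ Finset.range (n / 2), tN s j ^ 2 / torusMult s := by
  have h0 : ∏ k : Fin (n / 2), chi s k ^ (lamExp n k + 1) =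
      ∏ k ∈ Finset.range (n / 2), (tN s k / tN s (k + 1)) ^ (lamExp n k + 1) :=
    Fin.prod_univ_eq_prod_range (fun k => (tN s k / tN s (k + 1)) ^ (lamExp n k + 1)) _
  have h2 := fun M => prod_div_zpow (fun k => tN s k) (fun k => -2 * (k : ℤ)) (by simp) M
  have h3 : ∀ k : ℕ, (tN s k / tN s (k + 1)) ^ (2 * k + 1 + 1) =
      (tN s (k + 1) / tN s k) ^ (-2 * ((k + 1 : ℕ) : ℤ)) := by
    intro k
    rw [← zpow_natCast, ← inv_div, inv_zpow, ← zpow_neg]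
    rfl
  have h4 : ∀ k : ℕ, tN s k ^ (-2 * (k : ℤ) - -2 * ((k + 1 : ℕ) : ℤ)) = tN s k ^ 2 := by
    intro k
    rw [← zpow_natCast]
    congr 1
    push_cast
    ring
  rw [h0]
  by_cases hn : Odd n
  · have h1 : torusMult s = 1 := by simp [torusMult, hn]
    simp only [lamExp, hn, true_or, if_true, h3, h2, h4, tN_odd_half hn, one_zpow, one_mul, h1,
      div_one]
  · obtain ⟨m, rfl⟩ : ∃ m, n = 2 * m + 4 := by
      have := Nat.not_odd_iff.mp hn
      exact ⟨n / 2 - 2, by omega⟩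
    have hm : (2 * m + 4) / 2 = (m + 1) + 1 := by omega
    have h5 : tN s (m + 1) * tN s (m + 1 + 1) = torusMult s := tN_mul_tN s (by omega)
    have h6 : tN s (m + 1) / tN s (m + 1 + 1) = tN s (m + 1) ^ 2 / torusMult s := by
      rw [← h5, pow_two, mul_div_mul_left_eq_div]
    rw [hm, Finset.prod_div_distrib, Finset.prod_range_succ, Finset.prod_range_succ _ (m + 1)]
    have h7 : ∏ x ∈ Finset.range (m + 1),
        (tN s x / tN s (x + 1)) ^ (lamExp (2 * m + 4) x + 1) =
        ∏ x ∈ Finset.range (m + 1), (tN s (x + 1) / tN s x) ^ (-2 * ((x + 1 : ℕ) : ℤ)) := by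
      refine Finset.prod_congr rfl fun k hk => ?_
      have := Finset.mem_range.mp hk
      rw [lamExp, if_pos (Or.inr (by omega)), h3]
    rw [h7, h2]
    simp only [h4]
    rw [lamExp, if_neg (by rintro (h | h); exacts [hn h, by omega]), h6, Finset.prod_const,
      Finset.card_range, div_pow, ← pow_mul, mul_comm (_ ^ (-2 * ((m + 1 : ℕ) : ℤ))), mul_assoc,
      mul_div_assoc]
    congr 1
    rw [← mul_div_assoc]
    congr 1
    rw [← zpow_natCast, ← zpow_natCast, ← zpow_add]
    congr 1
    push_cast
    ring

/-- The Jacobian identity behind the change of variables: scaling by the torus multiplies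
`|λ| dB` by `|δ|⁻¹`. -/
lemma prod_chi_mul_prod_wt (hn3 : 3 ≤ n) (s : Fin (n / 2) → Rˣ) :
    (∏ k : Fin (n / 2), chi s k ^ (lamExp n k + 1)) * ∏ t, wt s t = (delta s)⁻¹ := by
  rw [prod_chi_pow hn3, prod_wt, delta_eq hn3, ← Finset.prod_inv_distrib, mul_left_comm,
    ← Finset.prod_mul_distrib]
  rw [Finset.prod_eq_one (s := Finset.range (n / 2)) (fun j _ => by simp), mul_one]
  exact Finset.prod_congr rfl fun x _ => (inv_div _ _).symm

end Jacobian


/-! ### Densities on product spaces -/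

section PiIntegral

lemma lintegral_pi_prod {X : Type*} [MeasurableSpace X] (ν : Measure X) [SigmaFinite ν] {m : ℕ}
    (h : Fin m → X → ℝ≥0∞) (hh : ∀ i, Measurable (h i)) :
    ∫⁻ x, ∏ i, h i (x i) ∂(Measure.pi fun _ => ν) = ∏ i, ∫⁻ x, h i x ∂ν := by
  induction m with
  | zero => simp
  | succ m ih =>
    have h1 := (measurePreserving_piFinSuccAbove (fun _ : Fin (m + 1) => ν) 0).symm
    have hm : Measurable fun x : Fin (m + 1) → X => ∏ i, h i (x i) :=
      Finset.measurable_prod _ fun i _ => (hh i).comp (measurable_pi_apply i)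
    rw [← h1.lintegral_comp hm, Fin.prod_univ_succ, ← ih (fun i => h i.succ) fun i => hh _]
    refine Eq.trans ?_ (lintegral_prod_mul (hh 0).aemeasurable
      (Finset.measurable_prod _ fun i _ => (hh i.succ).comp (measurable_pi_apply i)).aemeasurable)
    refine lintegral_congr fun x => ?_
    rw [Fin.prod_univ_succ]
    rfl

lemma pi_withDensity {X : Type*} [MeasurableSpace X] (ν : Measure X) [SigmaFinite ν] {m : ℕ}
    (h : X → ℝ≥0∞) (hh : Measurable h) [SigmaFinite (ν.withDensity h)] :
    (Measure.pi fun _ : Fin m => ν.withDensity h) =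
      (Measure.pi fun _ : Fin m => ν).withDensity fun x => ∏ i, h (x i) := by
  refine Measure.pi_eq fun s hs => ?_
  rw [withDensity_apply _ (MeasurableSet.univ_pi hs),
    ← lintegral_indicator (MeasurableSet.univ_pi hs)]
  simp only [withDensity_apply _ (hs _), ← lintegral_indicator (hs _)]
  rw [← lintegral_pi_prod ν (fun i => (s i).indicator h) fun i => hh.indicator (hs i)]
  refine lintegral_congr fun x => ?_
  classical
  simp only [Set.indicator_apply, Set.mem_univ_pi]
  split_ifs with h1
  · exact Finset.prod_congr rfl fun i _ => by rw [if_pos (h1 i)]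
  · push Not at h1
    obtain ⟨i, hi⟩ := h1
    exact (Finset.prod_eq_zero (Finset.mem_univ i) (if_neg hi)).symm

end PiIntegral

/-! ### The multiplicative measure on the units -/

section UnitsMeasure

variable {R : Type*} [NormedCommRing R] [CompleteSpace R] [MeasurableSpace R] [BorelSpace R]

lemma measurableEmbedding_units_val : MeasurableEmbedding (Units.val : Rˣ → R) where
  injective := fun _ _ => Units.ext
  measurable := comap_measurable _
  measurableSet_image' := by
    rintro _ ⟨t, ht, rfl⟩
    rw [Set.image_preimage_eq_inter_range]
    exact ht.inter Units.isOpenEmbedding_val.isOpen_range.measurableSet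

lemma measurable_units_iff {Y : Type*} [MeasurableSpace Y] {f : Y → Rˣ} :
    Measurable f ↔ Measurable fun y => (f y : R) :=
  measurableEmbedding_units_val.measurable_comp_iff.symm

instance instBorelSpaceUnits : BorelSpace Rˣ := ⟨by
  rw [Units.isOpenEmbedding_val.isInducing.eq_induced, borel_comap,
    ← BorelSpace.measurable_eq (α := R)]
  rfl⟩

instance instMeasurableMulUnits [SecondCountableTopology R] : MeasurableMul₂ Rˣ where
  measurable_mul := by
    rw [measurable_units_iff]
    exact (measurableEmbedding_units_val.measurable.comp measurable_fst).mul
      (measurableEmbedding_units_val.measurable.comp measurable_snd)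

instance instMeasurableInvUnits : MeasurableInv Rˣ where
  measurable_inv := continuous_inv.measurable

variable (μ : Measure R)

instance instSigmaFiniteDUnits [SigmaFinite μ] : SigmaFinite (dUnits μ) := by
  have h : SigmaFinite ((μ.comap Units.val).map Units.val) := by
    rw [measurableEmbedding_units_val.map_comap]
    infer_instance
  have h2 : SigmaFinite (μ.comap (Units.val : Rˣ → R)) :=
    SigmaFinite.of_map _ measurableEmbedding_units_val.measurable.aemeasurable h
  exact SigmaFinite.withDensity fun s : Rˣ => Real.toNNReal ‖(s : R)‖⁻¹

instance instSigmaFiniteDs {n : ℕ} [SigmaFinite μ] : SigmaFinite (ds n μ) :=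
  inferInstanceAs (SigmaFinite (Measure.pi _))

lemma measurable_ofReal_norm : Measurable fun s : Rˣ => ENNReal.ofReal ‖(s : R)‖ :=
  (measurable_norm.comp measurableEmbedding_units_val.measurable).ennreal_ofReal

end UnitsMeasure

section FieldUnits

variable {K : Type*} [NontriviallyNormedField K] [MeasurableSpace K]
  [BorelSpace K] [ProperSpace K]

variable (μ : Measure K) [μ.IsAddHaarMeasure]

lemma lintegral_dUnits {g : K → ℝ≥0∞} (hg : Measurable g) :
    ∫⁻ s, g s ∂(dUnits μ) = ∫⁻ x, ENNReal.ofReal ‖x‖⁻¹ * g x ∂μ := by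
  have hn : Measurable fun x : K => ENNReal.ofReal ‖x‖⁻¹ := measurable_norm.inv.ennreal_ofReal
  have hv := measurableEmbedding_units_val (R := K)
  have hn' : Measurable fun s : Kˣ => ENNReal.ofReal ‖(s : K)‖⁻¹ := hn.comp hv.measurable
  have hg' : Measurable fun s : Kˣ => g s := hg.comp hv.measurable
  rw [dUnits, lintegral_withDensity_eq_lintegral_mul _ hn' hg']
  refine (hv.lintegral_map (μ := μ.comap Units.val)
    (fun x => ENNReal.ofReal ‖x‖⁻¹ * g x)).symm.trans ?_
  rw [hv.map_comap, ← lintegral_indicator hv.measurableSet_range]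
  refine lintegral_congr fun x => ?_
  by_cases hx : x = 0
  · subst hx
    simp
  · rw [Set.indicator_of_mem]
    exact ⟨Units.mk0 x hx, rfl⟩

/-- Multiplying `ds / |s|` by `|s|` gives back the additive measure, as `0` is a null set. -/
lemma map_val_withDensity_dUnits :
    ((dUnits μ).withDensity fun s => ENNReal.ofReal ‖(s : K)‖).map Units.val = μ := by
  have hv := measurableEmbedding_units_val (R := K)
  refine Measure.ext_of_lintegral _ fun g hg => ?_
  have hg' : Measurable fun s : Kˣ => g s := hg.comp hv.measurable
  rw [lintegral_map hg hv.measurable, lintegral_withDensity_eq_lintegral_mul _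
    measurable_ofReal_norm hg']
  refine (lintegral_dUnits μ (g := fun x => ENNReal.ofReal ‖x‖ * g x)
    (measurable_norm.ennreal_ofReal.mul hg)).trans (lintegral_congr_ae ?_)
  have h0 : ∀ᵐ x ∂μ, x ≠ 0 := by
    rw [ae_iff]
    simp
  filter_upwards [h0] with x hx
  rw [← mul_assoc, ← ENNReal.ofReal_mul (by positivity), inv_mul_cancel₀ (norm_ne_zero_iff.mpr hx),
    ENNReal.ofReal_one, one_mul]

lemma map_mul_left_dUnits (hμ : ∀ c : K, c ≠ 0 → μ.map (c * ·) = ENNReal.ofReal ‖c‖⁻¹ • μ)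
    (c : Kˣ) : (dUnits μ).map (c * ·) = dUnits μ := by
  have hv := measurableEmbedding_units_val (R := K)
  refine Measure.ext_of_lintegral _ fun g hg => ?_
  -- every measurable function on the units extends to the field
  obtain ⟨g, hg', rfl⟩ : ∃ g' : K → ℝ≥0∞, Measurable g' ∧ g = fun s : Kˣ => g' s :=
    ⟨_, hv.measurable_extend hg measurable_const (g' := fun _ => 0),
      funext fun s => (hv.injective.extend_apply _ _ s).symm⟩
  rw [lintegral_map hg (measurable_const_mul c)]
  simp only [Units.val_mul]
  rw [lintegral_dUnits μ (g := fun x => g (c * x)) (hg'.comp (measurable_const_mul (c : K))),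
    lintegral_dUnits μ hg']
  have hc := c.ne_zero
  have h1 : ∫⁻ x, ENNReal.ofReal ‖x‖⁻¹ * g x ∂μ = ENNReal.ofReal ‖(c : K)‖ *
      ∫⁻ x, ENNReal.ofReal ‖x‖⁻¹ * g x ∂(μ.map ((c : K) * ·)) := by
    rw [hμ c hc, lintegral_smul_measure, smul_eq_mul, ← mul_assoc,
      ← ENNReal.ofReal_mul (by positivity), mul_inv_cancel₀ (norm_ne_zero_iff.mpr hc),
      ENNReal.ofReal_one, one_mul]
  have hm : Measurable fun x : K => ENNReal.ofReal ‖x‖⁻¹ * g x :=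
    measurable_norm.inv.ennreal_ofReal.mul hg'
  rw [h1, lintegral_map hm (measurable_const_mul _), ← lintegral_const_mul _
    (f := fun x => ENNReal.ofReal ‖(c : K) * x‖⁻¹ * g (c * x))
    (hm.comp (measurable_const_mul (c : K)))]
  refine lintegral_congr fun x => ?_
  rw [← mul_assoc, ← ENNReal.ofReal_mul (by positivity), norm_mul, mul_inv, ← mul_assoc,
    mul_inv_cancel₀ (norm_ne_zero_iff.mpr hc), one_mul]

/-- Inversion preserves `ds / |s|`: both measures are invariant, and they agree on an annulus which
is stable under inversion. -/
lemma map_inv_dUnits (hμ : ∀ c : K, c ≠ 0 → μ.map (c * ·) = ENNReal.ofReal ‖c‖⁻¹ • μ) :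
    (dUnits μ).map (·⁻¹) = dUnits μ := by
  obtain ⟨c, hc⟩ := NormedField.exists_one_lt_norm K
  have hc0 : c ≠ 0 := norm_pos_iff.mp (one_pos.trans hc)
  set r := ‖c‖ with hr
  have hr0 : 0 < r := one_pos.trans hc
  have hi1 : (dUnits μ).IsMulLeftInvariant := ⟨map_mul_left_dUnits μ hμ⟩
  have hi2 : ((dUnits μ).map (·⁻¹)).IsMulLeftInvariant := ⟨fun g => by
    rw [Measure.map_map (measurable_const_mul g) measurable_inv]
    conv_rhs => rw [← map_mul_left_dUnits μ hμ g⁻¹,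
      Measure.map_map measurable_inv (measurable_const_mul _)]
    congr 1
    ext s
    simp [mul_comm]⟩
  have hsf : SigmaFinite ((dUnits μ).map (·⁻¹)) :=
    (MeasurableEquiv.inv Kˣ).sigmaFinite_map
  -- Two invariant measures that agree on a set of finite positive measure are equal.
  let A : Set K := {x | r⁻¹ ≤ ‖x‖ ∧ ‖x‖ ≤ r}
  have hA : MeasurableSet A := (measurableSet_le measurable_const measurable_norm).inter
    (measurableSet_le measurable_norm measurable_const)
  let S : Set Kˣ := Units.val ⁻¹' A
  have hS : MeasurableSet S := measurableEmbedding_units_val.measurable hA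
  have hSinv : (·⁻¹) ⁻¹' S = S := by
    ext s
    have hs : 0 < ‖(s : K)‖ := norm_pos_iff.mpr s.ne_zero
    simp only [S, A, Set.mem_preimage, Set.mem_ofPred_eq, Units.val_inv_eq_inv_val, norm_inv]
    rw [inv_le_inv₀ hr0 hs, inv_le_comm₀ hs hr0]
    exact and_comm
  have hval : dUnits μ S = ∫⁻ x in A, ENNReal.ofReal ‖x‖⁻¹ ∂μ := by
    rw [← lintegral_indicator_one hS]
    refine (lintegral_dUnits μ (g := A.indicator 1) (measurable_one.indicator hA)).trans ?_
    rw [← lintegral_indicator hA]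
    refine lintegral_congr fun x => ?_
    simp only [Set.indicator_apply]
    split_ifs <;> simp
  have hfin : dUnits μ S ≠ ∞ := by
    rw [hval]
    refine (lt_of_le_of_lt (setLIntegral_mono (measurable_const (a := ENNReal.ofReal r))
      fun x hx => ENNReal.ofReal_le_ofReal ?_) ?_).ne
    · have := hx.1
      exact inv_le_of_inv_le₀ hr0 hx.1
    · rw [setLIntegral_const]
      refine ENNReal.mul_lt_top ENNReal.ofReal_lt_top (lt_of_le_of_lt (measure_mono ?_)
        (isCompact_closedBall (0 : K) r).measure_lt_top)
      intro x hx
      rw [mem_closedBall_zero_iff]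
      exact hx.2
  have hpos : dUnits μ S ≠ 0 := by
    rw [hval]
    intro h
    rw [setLIntegral_eq_zero_iff hA (f := fun x : K => ENNReal.ofReal ‖x‖⁻¹)
      measurable_norm.inv.ennreal_ofReal] at h
    let U : Set K := {x | r⁻¹ < ‖x‖ ∧ ‖x‖ < r}
    have hU : IsOpen U := (isOpen_lt continuous_const continuous_norm).inter
      (isOpen_lt continuous_norm continuous_const)
    have h1U : (1 : K) ∈ U := by
      simp only [U, Set.mem_ofPred_eq, norm_one]
      exact ⟨inv_lt_one_of_one_lt₀ hc, hc⟩
    have := (hU.measure_pos μ ⟨1, h1U⟩).ne'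
    apply this
    refine measure_mono_null ?_ (measure_eq_zero_iff_ae_notMem.mpr (h.mono fun x hx => ?_) :
      μ U = 0)
    · exact subset_rfl
    · intro hxU
      have h2 := hx ⟨hxU.1.le, hxU.2.le⟩
      have h3 : 0 < ‖x‖ := (inv_pos.mpr hr0).trans hxU.1
      rw [ENNReal.ofReal_eq_zero] at h2
      exact absurd h2 (not_le.mpr (inv_pos.mpr h3))
  have h := measure_eq_div_smul ((dUnits μ).map (·⁻¹)) (dUnits μ) hpos hfin
  rw [Measure.map_apply measurable_inv hS, hSinv, ENNReal.div_self hpos hfin, one_smul] at h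
  exact h

lemma map_ds_val {n : ℕ} :
    ((ds n μ).withDensity fun s => ∏ i, ENNReal.ofReal ‖(s i : K)‖).map (fun s i => (s i : K)) =
      Measure.pi fun _ => μ := by
  have : SigmaFinite ((dUnits μ).withDensity fun s => ENNReal.ofReal ‖(s : K)‖) :=
    SigmaFinite.withDensity fun s : Kˣ => Real.toNNReal ‖(s : K)‖
  rw [ds, ← pi_withDensity _ _ measurable_ofReal_norm]
  have h := map_val_withDensity_dUnits μ
  have : SigmaFinite
      (((dUnits μ).withDensity fun s => ENNReal.ofReal ‖(s : K)‖).map Units.val) := by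
    rw [h]
    infer_instance
  have h' := Measure.pi_map_pi (ι := Fin (n / 2))
    (μ := fun _ => (dUnits μ).withDensity fun s => ENNReal.ofReal ‖(s : K)‖)
    (f := fun _ => Units.val) (hμ := fun _ => this)
    fun _ => measurableEmbedding_units_val.measurable.aemeasurable
  rw [h', h]

variable {n : ℕ}

lemma measurePreserving_mul_left_ds
    (hμ : ∀ c : K, c ≠ 0 → μ.map (c * ·) = ENNReal.ofReal ‖c‖⁻¹ • μ) (s₀ : Fin (n / 2) → Kˣ) :
    MeasurePreserving (s₀ * ·) (ds n μ) (ds n μ) :=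
  measurePreserving_pi _ _ fun i => ⟨measurable_const_mul _, map_mul_left_dUnits μ hμ (s₀ i)⟩

lemma measurable_chi (hn3 : 3 ≤ n) : Measurable (chi : (Fin (n / 2) → Kˣ) → Fin (n / 2) → Kˣ) := by
  refine measurable_pi_lambda _ fun k => ?_
  by_cases hk : Odd n ∨ (k : ℕ) + 1 < n / 2
  · simp only [chi_of_lt _ k hk]
    exact (measurable_pi_apply k).inv
  · push Not at hk
    simp only [chi_of_even hn3 hk.1 _ k (by omega)]
    exact (measurable_pi_apply _).mul (measurable_pi_apply k).inv

/-- `chi` is inversion in each coordinate, followed, in the last coordinate for even `n`, by a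
translation which depends on another coordinate. -/
lemma measurePreserving_chi (hn3 : 3 ≤ n)
    (hμ : ∀ c : K, c ≠ 0 → μ.map (c * ·) = ENNReal.ofReal ‖c‖⁻¹ • μ) :
    MeasurePreserving chi (ds n μ) (ds n μ) := by
  refine measurePreserving_pi_of_triangular (fun k : Fin (n / 2) => (k : ℕ)) chi
    (measurable_chi hn3) ?_ _ _ ?_
  · intro k s s' h1 h2
    by_cases hk : Odd n ∨ (k : ℕ) + 1 < n / 2
    · rw [chi_of_lt s k hk, chi_of_lt s' k hk, h2]
    · push Not at hk
      have hne := hk.1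
      rw [chi_of_even hn3 hne s k (by omega), chi_of_even hn3 hne s' k (by omega), h2, h1]
      have := Nat.not_odd_iff.mp hne
      simp only
      omega
  · intro k s
    by_cases hk : Odd n ∨ (k : ℕ) + 1 < n / 2
    · simp only [chi_of_lt _ k hk, Function.update_self]
      exact map_inv_dUnits μ hμ
    · push Not at hk
      have hne := hk.1
      have := Nat.not_odd_iff.mp hne
      have hk1 : (⟨k - 1, by omega⟩ : Fin (n / 2)) ≠ k := by
        intro h
        have := congrArg Fin.val h
        simp only at this
        omega
      simp only [chi_of_even hn3 hne _ k (by omega), Function.update_self,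
        Function.update_of_ne hk1]
      have h1 := Measure.map_map (μ := dUnits μ) (measurable_const_mul (s ⟨k - 1, by omega⟩))
        measurable_inv
      rw [map_inv_dUnits μ hμ, map_mul_left_dUnits μ hμ] at h1
      exact h1.symm

/-- The torus acts simply transitively on the invertible values of the entries on the line
`i + j = n`. -/
lemma chi_bijective {R : Type*} [CommRing R] (hn3 : 3 ≤ n) :
    Function.Bijective (chi : (Fin (n / 2) → Rˣ) → Fin (n / 2) → Rˣ) := by
  constructor
  · intro s s' h
    have h1 : ∀ k : Fin (n / 2), Odd n ∨ (k : ℕ) + 1 < n / 2 → s k = s' k := fun k hk => by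
      have := congrFun h k
      rwa [chi_of_lt s k hk, chi_of_lt s' k hk, inv_inj] at this
    ext1 k
    by_cases hk : Odd n ∨ (k : ℕ) + 1 < n / 2
    · exact h1 k hk
    · push Not at hk
      have hne := hk.1
      have := Nat.not_odd_iff.mp hne
      have h2 := congrFun h k
      rwa [chi_of_even hn3 hne s k (by omega), chi_of_even hn3 hne s' k (by omega),
        h1 ⟨k - 1, by omega⟩ (Or.inr (by simp only; omega)), mul_right_inj, inv_inj] at h2
  · intro z
    refine ⟨fun k => if Odd n ∨ (k : ℕ) + 1 < n / 2 then (z k)⁻¹ else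
      (z ⟨k - 1, by omega⟩)⁻¹ * (z k)⁻¹, ?_⟩
    ext1 k
    by_cases hk : Odd n ∨ (k : ℕ) + 1 < n / 2
    · rw [chi_of_lt _ k hk, if_pos hk, inv_inv]
    · have hk' := hk
      push Not at hk'
      have hne := hk'.1
      have := Nat.not_odd_iff.mp hne
      rw [chi_of_even hn3 hne _ k (by omega), if_neg hk, if_pos (Or.inr (by simp only; omega)),
        mul_inv, inv_inv, inv_inv, inv_mul_cancel_left]

end FieldUnits


/-! ### Measurability of the torus action -/

section TorusMeasurable

variable {n : ℕ} {R : Type*} [NormedCommRing R] [CompleteSpace R] [SecondCountableTopology R]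
  [MeasurableSpace R] [BorelSpace R]

lemma measurable_sc (k : ℕ) : Measurable fun s : Fin (n / 2) → Rˣ => sc s k := by
  unfold sc
  split_ifs
  · exact measurable_pi_apply _
  · exact measurable_const

lemma measurable_torusMult : Measurable (torusMult : (Fin (n / 2) → Rˣ) → Rˣ) := by
  unfold torusMult
  split_ifs
  · exact measurable_const
  · exact (measurable_sc _).mul (measurable_sc _)

lemma measurable_torusHalf (i : ℕ) : Measurable fun s : Fin (n / 2) → Rˣ => torusHalf s i := by
  unfold torusHalf
  split_ifs
  · exact Finset.measurable_prod _ fun k _ => (measurable_sc k).inv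
  · exact Finset.measurable_prod _ fun k _ => (measurable_sc k).inv
  · exact measurable_sc _

lemma measurable_torusEntry (i : Fin n) :
    Measurable fun s : Fin (n / 2) → Rˣ => torusEntry s i := by
  unfold torusEntry
  split_ifs
  · exact measurable_torusHalf _
  · exact measurable_torusMult.mul (measurable_torusHalf _).inv

lemma measurable_delta (hn3 : 3 ≤ n) : Measurable (delta : (Fin (n / 2) → Rˣ) → Rˣ) := by
  have : (delta : (Fin (n / 2) → Rˣ) → Rˣ) = fun s =>
      ∏ x : NIndex n, torusEntry s x.1.2 / torusEntry s x.1.1 := funext fun s => delta_eq hn3 s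
  rw [this]
  simp only [div_eq_mul_inv]
  exact Finset.measurable_prod _ fun x _ =>
    (measurable_torusEntry _).mul (measurable_torusEntry _).inv

lemma measurable_ofReal_norm_delta (hn3 : 3 ≤ n) : Measurable fun s : Fin (n / 2) → Rˣ =>
    ENNReal.ofReal ‖(((delta s)⁻¹ : Rˣ) : R)‖ :=
  measurable_ofReal_norm.comp (measurable_delta hn3).inv

lemma measurable_torus_smul {Y : Type*} [MeasurableSpace Y] {s : Y → Fin (n / 2) → Rˣ}
    {B : Y → W n R} (hs : Measurable s) (hB : Measurable B) :
    Measurable fun y => torus (s y) • B y := by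
  rw [measurable_W_iff] at hB ⊢
  intro i j
  simp only [torus_smul_apply]
  refine (measurableEmbedding_units_val.measurable.comp ?_).mul (hB i j)
  exact ((measurable_torusMult.comp hs).inv.mul ((measurable_torusEntry i).comp hs)).mul
    ((measurable_torusEntry j).comp hs)

lemma measurable_W₀ofCoord : Measurable (W₀ofCoord : (W₀Index n → R) → W₀ n R) := by
  refine Measurable.subtype_mk (measurable_W_iff.mpr fun i j => ?_)
  simp only [Matrix.of_apply]
  split_ifs
  · exact measurable_pi_apply _
  · exact measurable_const

lemma measurable_lam : Measurable (lam : W₀ n R → R) := by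
  have hb : ∀ i j, Measurable fun B : W₀ n R => b B.1 i j := by
    intro i j
    unfold b
    split_ifs
    · exact measurable_W_iff.mp measurable_subtype_coe _ _
    · exact measurable_const
  unfold lam
  split_ifs
  · exact Finset.measurable_prod _ fun i _ => (hb _ _).pow_const _
  · exact ((hb _ _).pow_const _).mul (Finset.measurable_prod _ fun i _ => (hb _ _).pow_const _)

end TorusMeasurable

/-! ### The change of variables over a field -/

section FieldFormula

variable {n : ℕ} {K : Type*} [NontriviallyNormedField K] [CharZero K] [MeasurableSpace K]
  [BorelSpace K] [ProperSpace K]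

lemma measurable_torus_unip_smul {Y : Type*} [MeasurableSpace Y]
    {x : Y → (Fin (n / 2) → Kˣ) × N n K} {B : Y → W n K} (hx : Measurable x) (hB : Measurable B) :
    Measurable fun y => (torus (x y).1 * unip (x y).2) • B y := by
  simp only [mul_smul]
  exact measurable_torus_smul hx.fst (measurable_unip_smul hx.snd hB)

variable (μ : Measure K) [μ.IsAddHaarMeasure]

/-- The measure `|δ(s)|⁻¹ ∏ du_ij d^×s` on pairs `(s, u)`. -/
noncomputable def dhFree (n : ℕ) : Measure ((Fin (n / 2) → Kˣ) × N n K) :=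
  ((ds n μ).prod (duFree μ n)).withDensity fun x => ENNReal.ofReal ‖(((delta x.1)⁻¹ : Kˣ) : K)‖

instance : SigmaFinite (dhFree μ n) :=
  SigmaFinite.withDensity fun x : (Fin (n / 2) → Kˣ) × N n K =>
    Real.toNNReal ‖(((delta x.1)⁻¹ : Kˣ) : K)‖

lemma lintegral_dhFree (hn3 : 3 ≤ n) {f : (Fin (n / 2) → Kˣ) × N n K → ℝ≥0∞} (hf : Measurable f) :
    ∫⁻ x, f x ∂(dhFree μ n) = ∫⁻ s, ENNReal.ofReal ‖(((delta s)⁻¹ : Kˣ) : K)‖ *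
      ∫⁻ u, f (s, u) ∂(duFree μ n) ∂(ds n μ) := by
  have hd := measurable_ofReal_norm_delta (R := K) hn3
  have hd' : Measurable fun x : (Fin (n / 2) → Kˣ) × N n K =>
      ENNReal.ofReal ‖(((delta x.1)⁻¹ : Kˣ) : K)‖ := hd.comp measurable_fst
  rw [dhFree, lintegral_withDensity_eq_lintegral_mul _ hd' hf,
    lintegral_prod _ (hd'.mul hf).aemeasurable]
  refine lintegral_congr fun s => ?_
  simp only [Pi.mul_apply]
  exact lintegral_const_mul _ (hf.comp measurable_prodMk_left)

lemma measurable_mat : Measurable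
    fun x : (Fin (n / 2) → K) × (NIndex n ⊕ Fin n → K) => mat x.1 x.2 :=
  Measurable.subtype_mk (h := fun x => (mat x.1 x.2).2) (measurable_W_iff.mpr fun i j =>
    (continuous_mat_apply continuous_fst continuous_snd i j).measurable)

lemma lintegral_W₀ofCoord {F : W₀ n K → ℝ≥0∞} (hF : Measurable F) :
    ∫⁻ x, F (W₀ofCoord x) ∂(Measure.pi fun _ => μ) =
      ∫⁻ z : Fin (n / 2) → K, ∫⁻ y : NIndex n ⊕ Fin n → K, F (mat z y)
        ∂(Measure.pi fun _ => μ) ∂(Measure.pi fun _ => μ) := by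
  have h1 := measurePreserving_piCongrLeft (fun _ : W₀Index n => μ) (idxW₀ (n := n))
  have h2 := (measurePreserving_sumPiEquivProdPi_symm
    (X := fun _ : Fin (n / 2) ⊕ (NIndex n ⊕ Fin n) => K) (fun _ => μ))
  have h3 := h1.comp h2
  have hm : Measurable fun x : W₀Index n → K => F (W₀ofCoord x) := hF.comp measurable_W₀ofCoord
  rw [← h3.lintegral_comp hm]
  have h4 : ∀ x : (Fin (n / 2) → K) × (NIndex n ⊕ Fin n → K), F (W₀ofCoord
      (((MeasurableEquiv.piCongrLeft (fun _ : W₀Index n => K) idxW₀) ∘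
        (MeasurableEquiv.sumPiEquivProdPi fun _ => K).symm) x)) = F (mat x.1 x.2) := by
    intro x
    rw [mat]
    congr 2
    ext t
    obtain ⟨t, rfl⟩ := idxW₀.surjective t
    rw [Equiv.symm_apply_apply, Function.comp_apply, MeasurableEquiv.coe_piCongrLeft]
    refine (Equiv.piCongrLeft_apply_apply (fun _ : W₀Index n => K) idxW₀ _ t).trans ?_
    rcases t with t | t <;> rfl
  refine (lintegral_congr h4).trans ?_
  exact lintegral_prod _ (hF.comp measurable_mat).aemeasurable

/-- Scaling by the torus carries the slice of matrices with `b_{k, n-k} = 1` to any other one. -/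
lemma lintegral_mat_chi (s : Fin (n / 2) → Kˣ)
    (hμ : ∀ c : K, c ≠ 0 → μ.map (c * ·) = ENNReal.ofReal ‖c‖⁻¹ • μ)
    {F : W n K → ℝ≥0∞} (hF : Measurable F) :
    ∫⁻ y, F (mat (fun k => (chi s k : K)) y).1 ∂(Measure.pi fun _ => μ) =
      (∏ t, ENNReal.ofReal ‖(wt s t : K)‖) *
        ∫⁻ y, F (torus s • (slice y).1) ∂(Measure.pi fun _ => μ) := by
  have hT : IsTriangular (fun _ : NIndex n ⊕ Fin n => 0) (fun t => (wt s t : K))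
      (fun y t => (wt s t : K) * y t) := fun t y y' _ => (mul_sub _ _ _).symm
  have hm : Measurable fun (y : NIndex n ⊕ Fin n → K) t => (wt s t : K) * y t :=
    measurable_pi_lambda _ fun t => (measurable_pi_apply t).const_mul _
  have h1 := hT.map_pi (μ := μ) (fun t => (wt s t).ne_zero) hm hμ
  have h2 : Measurable fun y : NIndex n ⊕ Fin n → K => F (mat (fun k => (chi s k : K)) y).1 :=
    hF.comp (measurable_subtype_coe.comp (measurable_mat.comp measurable_prodMk_left))
  have h3 : ∫⁻ y, F (torus s • (slice y).1) ∂(Measure.pi fun _ => μ) =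
      ∫⁻ y, F (mat (fun k => (chi s k : K)) y).1
        ∂((Measure.pi fun _ => μ).map fun (y : NIndex n ⊕ Fin n → K) t => (wt s t : K) * y t) := by
    rw [lintegral_map h2 hm]
    refine lintegral_congr fun y => ?_
    rw [slice, torus_smul_mat]
    simp only [Pi.one_apply, mul_one]
    rfl
  rw [h3, h1, lintegral_smul_measure, smul_eq_mul, ← mul_assoc, ← Finset.prod_mul_distrib,
    Finset.prod_eq_one, one_mul]
  intro t _
  rw [← ENNReal.ofReal_mul (norm_nonneg _), mul_inv_cancel₀ (norm_ne_zero_iff.mpr (wt s t).ne_zero),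
    ENNReal.ofReal_one]

/-- The entries on the line `i + j = n` as functions of the torus element. -/
lemma lintegral_pi_eq_lintegral_ds (hn3 : 3 ≤ n)
    (hμ : ∀ c : K, c ≠ 0 → μ.map (c * ·) = ENNReal.ofReal ‖c‖⁻¹ • μ)
    {g : (Fin (n / 2) → K) → ℝ≥0∞} (hg : Measurable g) :
    ∫⁻ z, g z ∂(Measure.pi fun _ => μ) = ∫⁻ s, (∏ i, ENNReal.ofReal ‖(chi s i : K)‖) *
      g (fun i => (chi s i : K)) ∂(ds n μ) := by
  have hval : Measurable fun (s : Fin (n / 2) → Kˣ) i => (s i : K) :=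
    measurable_pi_lambda _ fun i =>
      measurableEmbedding_units_val.measurable.comp (measurable_pi_apply i)
  have hn : Measurable fun s : Fin (n / 2) → Kˣ => ∏ i, ENNReal.ofReal ‖(s i : K)‖ :=
    Finset.measurable_prod _ fun i _ => measurable_ofReal_norm.comp (measurable_pi_apply i)
  have hgv : Measurable fun s : Fin (n / 2) → Kˣ => g (fun i => (s i : K)) := hg.comp hval
  have h1 := lintegral_map (μ := (ds n μ).withDensity fun s => ∏ i, ENNReal.ofReal ‖(s i : K)‖)
    hg hval
  rw [map_ds_val μ] at h1
  rw [h1, lintegral_withDensity_eq_lintegral_mul _ hn hgv,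
    ← (measurePreserving_chi μ hn3 hμ).lintegral_comp (hn.mul hgv)]
  rfl

/-- The Jacobian identity `prod_chi_mul_prod_wt` for absolute values: the factors come from the
measure on the line `i + j = n`, the measure on the other lines, and `λ`. -/
lemma ofReal_norm_delta_inv (hn3 : 3 ≤ n) (s : Fin (n / 2) → Kˣ) :
    ENNReal.ofReal ‖(((delta s)⁻¹ : Kˣ) : K)‖ = (∏ i, ENNReal.ofReal ‖(chi s i : K)‖) *
      ((∏ t, ENNReal.ofReal ‖(wt s t : K)‖) * ‖∏ k, (chi s k : K) ^ lamExp n k‖ₑ) := by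
  rw [← prod_chi_mul_prod_wt hn3, ← ofReal_norm,
    ← ENNReal.ofReal_prod_of_nonneg fun _ _ => norm_nonneg _,
    ← ENNReal.ofReal_prod_of_nonneg fun _ _ => norm_nonneg _,
    ← ENNReal.ofReal_mul (by positivity), ← ENNReal.ofReal_mul (by positivity)]
  congr 1
  simp only [Units.val_mul, Units.coe_prod, Units.val_pow_eq_pow_val, norm_mul, norm_prod,
    norm_pow, pow_succ, Finset.prod_mul_distrib]
  ring

/-- The integral over the matrices with given entries on the line `i + j = n`: it is reduced to the
slice by the torus element `s`, and there to the orbits of `N`. -/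
lemma lintegral_mat_chi_mul_lam (hn3 : 3 ≤ n) (s : Fin (n / 2) → Kˣ)
    (hμ : ∀ c : K, c ≠ 0 → μ.map (c * ·) = ENNReal.ofReal ‖c‖⁻¹ • μ)
    {F : W n K → ℝ≥0∞} (hF : Measurable F) :
    (∏ i, ENNReal.ofReal ‖(chi s i : K)‖) *
      ∫⁻ y : NIndex n ⊕ Fin n → K, F (mat (fun i => (chi s i : K)) y).1 *
        ‖lam (mat (fun i => (chi s i : K)) y)‖ₑ ∂(Measure.pi fun _ => μ) =
      ENNReal.ofReal (‖(2 : K)‖⁻¹ ^ (n / 2)) * ∫⁻ a : Fin n → K,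
        ENNReal.ofReal ‖(((delta s)⁻¹ : Kˣ) : K)‖ *
          ∫⁻ u, F ((torus s * unip u) • (sec a).1) ∂(duFree μ n) ∂(Measure.pi fun _ => μ) := by
  have h2 : Measurable fun y : NIndex n ⊕ Fin n → K => F (mat (fun k => (chi s k : K)) y).1 :=
    hF.comp (measurable_subtype_coe.comp (measurable_mat.comp measurable_prodMk_left))
  have h3 : Measurable fun B : W n K => F (torus s • B) :=
    hF.comp (measurable_torus_smul measurable_const measurable_id)
  have h5 : Measurable fun a : Fin n → K =>
      ∫⁻ u, F (torus s • unip u • (sec a).1) ∂(duFree μ n) :=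
    Measurable.lintegral_prod_right' (f := fun x : (Fin n → K) × N n K =>
      F (torus s • unip x.2 • (sec x.1).1)) (h3.comp (measurable_unip_smul measurable_snd
        (measurable_sec.comp measurable_fst)))
  simp only [lam_mat hn3, mul_smul]
  rw [lintegral_mul_const _ h2, lintegral_mat_chi μ s hμ hF, lintegral_slice μ hμ h3,
    ofReal_norm_delta_inv hn3, lintegral_const_mul _ h5]
  ring

/-- The change of variables over the field: almost all of `W₀` is fibred over the space of
polynomials by the free orbits of the elements `sec a`. -/
theorem lintegral_W₀_eq (hn3 : 3 ≤ n)
    (hμ : ∀ c : K, c ≠ 0 → μ.map (c * ·) = ENNReal.ofReal ‖c‖⁻¹ • μ)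
    {F : W n K → ℝ≥0∞} (hF : Measurable F) :
    ∫⁻ x, F (W₀ofCoord x).1 * ‖lam (W₀ofCoord x)‖ₑ ∂(Measure.pi fun _ => μ) =
      ENNReal.ofReal (‖(2 : K)‖⁻¹ ^ (n / 2)) * ∫⁻ a : Fin n → K,
        ∫⁻ x, F ((torus x.1 * unip x.2) • (sec a).1) ∂(dhFree μ n) ∂(Measure.pi fun _ => μ) := by
  have hF' : Measurable fun B : W₀ n K => F B.1 * ‖lam B‖ₑ :=
    (hF.comp measurable_subtype_coe).mul measurable_lam.enorm
  have hg : Measurable fun z : Fin (n / 2) → K => ∫⁻ y : NIndex n ⊕ Fin n → K,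
      F (mat z y).1 * ‖lam (mat z y)‖ₑ ∂(Measure.pi fun _ => μ) :=
    Measurable.lintegral_prod_right' (hF'.comp measurable_mat)
  have hsua : Measurable fun x : ((Fin n → K) × (Fin (n / 2) → Kˣ)) × N n K =>
      F ((torus x.1.2 * unip x.2) • (sec x.1.1).1) := by
    refine hF.comp (measurable_torus_unip_smul
      (x := fun x : ((Fin n → K) × (Fin (n / 2) → Kˣ)) × N n K => (x.1.2, x.2))
      (measurable_fst.snd.prodMk measurable_snd) (measurable_sec.comp measurable_fst.fst))
  rw [lintegral_W₀ofCoord μ hF', lintegral_pi_eq_lintegral_ds μ hn3 hμ hg]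
  refine (lintegral_congr fun s => lintegral_mat_chi_mul_lam μ hn3 s hμ hF).trans ?_
  have hin : Measurable fun x : (Fin n → K) × (Fin (n / 2) → Kˣ) =>
      ENNReal.ofReal ‖(((delta x.2)⁻¹ : Kˣ) : K)‖ *
        ∫⁻ u, F ((torus x.2 * unip u) • (sec x.1).1) ∂(duFree μ n) :=
    ((measurable_ofReal_norm_delta hn3).comp measurable_snd).mul hsua.lintegral_prod_right'
  rw [lintegral_const_mul _ hin.lintegral_prod_left', lintegral_lintegral_swap]
  -- Reassemble the integrals over `s` and `u` to one over the group.
  · congr 1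
    refine lintegral_congr fun a => ?_
    have hm : Measurable fun x : (Fin (n / 2) → Kˣ) × N n K =>
        (torus x.1 * unip x.2) • (sec a).1 :=
      measurable_torus_unip_smul (x := fun x => x) measurable_id measurable_const
    exact (lintegral_dhFree μ hn3 (hF.comp hm)).symm
  · exact (hin.comp measurable_swap).aemeasurable

end FieldFormula


/-! ### The group `𝒫` in the coordinates `s`, `u` -/

section SemidirectProduct

variable {n : ℕ} {R : Type*} [CommRing R]

lemma transpose_mul_antiDiag_mul_apply (A : Matrix (Fin n) (Fin n) R) (i j : Fin n) :
    (Aᵀ * antiDiag n R * A) i j = ∑ k, A k.rev i * A k j := by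
  rw [Matrix.mul_apply]
  simp only [mul_antiDiag_apply, Matrix.transpose_apply]

/-- Conjugation by the inverse of a torus element. -/
def conjN (s : Fin (n / 2) → Rˣ) (u : N n R) : N n R :=
  ⟨Matrix.of fun i j => ((torusEntry s j / torusEntry s i : Rˣ) : R) * u.1 i j, by
    refine ⟨Matrix.ext fun i j => ?_, fun i => ?_, fun i j hij => ?_⟩
    · have h1 := congrFun (congrFun u.2.1 i) j
      rw [transpose_mul_antiDiag_mul_apply] at h1 ⊢
      have h2 : ∀ k : Fin n, torusEntry s i / torusEntry s k.rev * (torusEntry s j /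
          torusEntry s k) = torusEntry s i * torusEntry s j / torusMult s := by
        intro k
        rw [← torusEntry_mul_rev s k, div_mul_div_comm, mul_comm (torusEntry s k)]
      have h3 : ∀ k : Fin n, (torusEntry s i / torusEntry s k.rev : Rˣ) * u.1 k.rev i *
          ((torusEntry s j / torusEntry s k : Rˣ) * u.1 k j) =
          ((torusEntry s i * torusEntry s j / torusMult s : Rˣ) : R) * (u.1 k.rev i * u.1 k j) := by
        intro k
        rw [← h2 k, Units.val_mul]
        ring
      simp only [Matrix.of_apply, h3]
      rw [← Finset.mul_sum, h1]
      simp only [antiDiag, Matrix.of_apply]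
      split_ifs with h
      · rw [h, torusEntry_mul_rev, div_self', Units.val_one, mul_one]
      · rw [mul_zero]
    · rw [Matrix.of_apply, div_self', Units.val_one, one_mul, u.2.2.1]
    · rw [Matrix.of_apply, u.2.2.2 i j hij, mul_zero]⟩

lemma conjN_apply (s : Fin (n / 2) → Rˣ) (u : N n R) (i j : Fin n) :
    (conjN s u).1 i j = ((torusEntry s j / torusEntry s i : Rˣ) : R) * u.1 i j := rfl

/-- The element `s u` of the group of similitudes. -/
def elt (x : (Fin (n / 2) → Rˣ) × N n R) : similitudes n R := torus x.1 * unip x.2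

lemma similitude_ext {x y : similitudes n R} (h : x.1.1.val = y.1.1.val) (h' : x.1.2 = y.1.2) :
    x = y := Subtype.ext (Prod.ext (Units.ext h) h')

lemma torus_mul (s s' : Fin (n / 2) → Rˣ) : torus (s * s') = torus s * torus s' := by
  refine similitude_ext ?_ (torusMult_mul s s')
  simp [torus, torusGL, torusEntry_mul]

lemma unip_mul (u v : N n R) : unip (u * v) = unip u * unip v :=
  similitude_ext rfl (one_mul _).symm

lemma unip_mul_torus (s : Fin (n / 2) → Rˣ) (u : N n R) :
    unip u * torus s = torus s * unip (conjN s u) := by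
  refine similitude_ext (Matrix.ext fun i j => ?_) (mul_comm _ _)
  change (u.1 * Matrix.diagonal fun i => (torusEntry s i : R)) i j =
    ((Matrix.diagonal fun i => (torusEntry s i : R)) * (conjN s u).1) i j
  rw [Matrix.mul_diagonal, Matrix.diagonal_mul, conjN_apply, ← mul_assoc, ← Units.val_mul,
    mul_div_cancel, mul_comm]

/-- The product of the elements `s u` and `s' u'`, in coordinates. -/
def mulTN (x y : (Fin (n / 2) → Rˣ) × N n R) : (Fin (n / 2) → Rˣ) × N n R :=
  (x.1 * y.1, conjN y.1 x.2 * y.2)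

lemma elt_mulTN (x y : (Fin (n / 2) → Rˣ) × N n R) : elt (mulTN x y) = elt x * elt y := by
  simp only [elt, mulTN]
  rw [torus_mul, unip_mul, mul_assoc, ← mul_assoc (torus y.1), ← unip_mul_torus]
  simp only [mul_assoc]

/-- The group `𝒫` acts freely on the slice: the entries on the line `i + j = n` recover `s`. -/
lemma elt_smul_sec_eq (hn3 : 3 ≤ n) {B : W n R} (hB : IsSlice B)
    {x y : (Fin (n / 2) → Rˣ) × N n R} (h : elt x • B = elt y • B) : x = y := by
  have key : ∀ x : (Fin (n / 2) → Rˣ) × N n R, ∃ y', elt x • B =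
      (mat (fun k => (chi x.1 k : R)) y').1 := by
    intro x
    obtain ⟨y, hy⟩ := (hB.unip_smul x.2).eq_slice
    refine ⟨fun t => (wt x.1 t : R) * y t, ?_⟩
    rw [elt, mul_smul, hy, slice, torus_smul_mat]
    simp only [Pi.one_apply, mul_one]
    rfl
  have h1 : chi x.1 = chi y.1 := by
    obtain ⟨p, hp⟩ := key x
    obtain ⟨q, hq⟩ := key y
    ext k
    have hk := mat_posW₀ (fun k => (chi x.1 k : R)) p (.inl k)
    have hk' := mat_posW₀ (fun k => (chi y.1 k : R)) q (.inl k)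
    rw [← hp, h, hq, hk'] at hk
    exact hk.symm
  have h2 : x.1 = y.1 := (chi_bijective hn3).1 h1
  have h3 : x.2 = y.2 := by
    simp only [elt, mul_smul, h2] at h
    exact unip_smul_injective hB (smul_left_cancel _ h)
  exact Prod.ext h2 h3

/-- The coordinates `s`, `u` are unique, since `𝒫` acts freely on the slice. -/
lemma elt_injective (hn3 : 3 ≤ n) :
    Function.Injective (elt : (Fin (n / 2) → Rˣ) × N n R → similitudes n R) := fun x y h =>
  elt_smul_sec_eq hn3 (isSlice_slice 0) (by rw [h])

lemma mulTN_assoc (hn3 : 3 ≤ n) (x y z : (Fin (n / 2) → Rˣ) × N n R) :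
    mulTN (mulTN x y) z = mulTN x (mulTN y z) :=
  elt_injective hn3 (by simp only [elt_mulTN, mul_assoc])

lemma elt_one : elt (1 : (Fin (n / 2) → Rˣ) × N n R) = 1 := by
  have h1 : torus (1 : Fin (n / 2) → Rˣ) = 1 := by
    have := torus_mul (1 : Fin (n / 2) → Rˣ) 1
    rwa [mul_one, left_eq_mul] at this
  have h2 : unip (1 : N n R) = 1 := by
    have := unip_mul (1 : N n R) 1
    rwa [mul_one, left_eq_mul] at this
  rw [elt, Prod.fst_one, Prod.snd_one, h1, h2, mul_one]

lemma mulTN_one (hn3 : 3 ≤ n) (x : (Fin (n / 2) → Rˣ) × N n R) : mulTN x 1 = x :=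
  elt_injective hn3 (by rw [elt_mulTN, elt_one, mul_one])

/-- The inverse of `s u`, in coordinates. -/
def invTN (x : (Fin (n / 2) → Rˣ) × N n R) : (Fin (n / 2) → Rˣ) × N n R :=
  (x.1⁻¹, (conjN x.1⁻¹ x.2)⁻¹)

lemma mulTN_invTN (x : (Fin (n / 2) → Rˣ) × N n R) : mulTN x (invTN x) = 1 :=
  Prod.ext (mul_inv_cancel _) (mul_inv_cancel _)

lemma invTN_mulTN (hn3 : 3 ≤ n) (x : (Fin (n / 2) → Rˣ) × N n R) : mulTN (invTN x) x = 1 := by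
  refine elt_injective hn3 ?_
  have := congrArg elt (mulTN_invTN x)
  rw [elt_mulTN, elt_one] at this ⊢
  exact mul_eq_one_comm.mp this

/-- The elements of `W₀` with invertible entries on the line `i + j = n` and with the same invariant
polynomial as an element `B` of the slice lie in the orbit of `B`: the torus carries them to the
slice, where `N` acts transitively. -/
lemma exists_elt_smul_eq [Nontrivial R] (hn3 : 3 ≤ n) {B : W n R} (hB : IsSlice B)
    (z : Fin (n / 2) → Rˣ) (y : NIndex n ⊕ Fin n → R)
    (h : inv (mat (fun k => (z k : R)) y).1 = inv B) :
    ∃ x : (Fin (n / 2) → Rˣ) × N n R, elt x • B = (mat (fun k => (z k : R)) y).1 := by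
  obtain ⟨s, rfl⟩ := (chi_bijective hn3).2 z
  let y' : NIndex n ⊕ Fin n → R := fun t => (((wt s t)⁻¹ : Rˣ) : R) * y t
  have h1 : torus s • (slice y').1 =
      (mat (fun k => (chi s k : R)) y).1 := by
    rw [slice, torus_smul_mat]
    congr 2
    · ext k
      rw [Pi.one_apply, mul_one]
    · ext t
      exact (wt s t).mul_inv_cancel_left _
  rw [← h1, inv_smul] at h
  obtain ⟨u, hu⟩ := exists_unip_smul_eq hB (isSlice_slice _) h.symm
  exact ⟨(s, u), by rw [elt, mul_smul, hu, h1]⟩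

end SemidirectProduct

/-! ### Lower-triangular similitudes -/

section LowerTriangular

variable {n : ℕ} {R : Type*} [CommRing R]

lemma toP_val (x : (Fin (n / 2) → Rˣ) × N n R) : (toP x).1 = (elt x : G n R) := rfl

lemma toP_mulTN (x y : (Fin (n / 2) → Rˣ) × N n R) : toP (mulTN x y) = toP x * toP y :=
  Subtype.ext (by rw [toP_val, elt_mulTN]; rfl)

lemma toP_smul (x : (Fin (n / 2) → Rˣ) × N n R) (B : W₀ n R) : (toP x • B).1 = elt x • B.1 := rfl

lemma diag_mul_diag_rev (x : similitudes n R) (hx : x ∈ lowerTriangular n R) (i : Fin n) :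
    x.1.1.val i i * x.1.1.val i.rev i.rev = x.1.2 := by
  have h := congrFun (congrFun ((mem_similitudes _ _).mp x.2).1 i) i.rev
  rw [transpose_mul_antiDiag_mul_apply, Finset.sum_eq_single i.rev] at h
  · rw [Fin.rev_rev] at h
    rw [h]
    simp [antiDiag]
  · intro k _ hk
    rcases lt_or_gt_of_ne hk with h' | h'
    · rw [hx _ _ h', mul_zero]
    · rw [hx _ _ (Fin.rev_lt_iff.mp h'), zero_mul]
  · simp

/-- The diagonal entry of a lower-triangular similitude. -/
def diagUnit (x : similitudes n R) (hx : x ∈ lowerTriangular n R) (i : Fin n) : Rˣ :=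
  Units.mkOfMulEqOne (x.1.1.val i i) (x.1.1.val i.rev i.rev * ((x.1.2⁻¹ : Rˣ) : R)) (by
    rw [← mul_assoc, diag_mul_diag_rev x hx, Units.mul_inv])

lemma exists_unip_eq (x : similitudes n R) (hx : x ∈ lowerTriangular n R)
    (h1 : ∀ i, x.1.1.val i i = 1) (h2 : x.1.2 = 1) : ∃ u : N n R, unip u = x := by
  refine ⟨⟨x.1.1.val, ?_, h1, hx⟩, similitude_ext rfl h2.symm⟩
  rw [((mem_similitudes _ _).mp x.2).1, h2, Units.val_one, one_smul]

lemma torus_mem_lowerTriangular (s : Fin (n / 2) → Rˣ) : torus s ∈ lowerTriangular n R :=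
  fun _ _ hij => Matrix.diagonal_apply_ne _ hij.ne

/-- The middle diagonal entry is `1` for odd `n`: in the determinant, which is `1`, the other
diagonal entries cancel in pairs. -/
lemma diag_mid (hn : Odd n) (x : similitudes n R) (hx : x ∈ lowerTriangular n R) (i : Fin n)
    (hi : (i : ℕ) = n / 2) : x.1.1.val i i = 1 := by
  have hn' := Nat.odd_iff.mp hn
  obtain ⟨hc, hdet⟩ := ((mem_similitudes _ _).mp x.2).2 hn
  have h1 : x.1.1.val.det = ∏ i, x.1.1.val i i :=
    Matrix.det_of_isLowerTriangular _ fun i j hij => hx i j hij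
  rw [h1] at hdet
  have hrev : i.rev = i := Fin.ext (by rw [Fin.val_rev]; omega)
  rw [← Finset.mul_prod_erase _ _ (Finset.mem_univ i)] at hdet
  rw [← hdet]
  refine (mul_one _).symm.trans (congrArg _ (Eq.symm ?_))
  refine Finset.prod_involution (fun j _ => j.rev) ?_ ?_ ?_ (fun _ _ => Fin.rev_rev _)
  · intro j _
    rw [diag_mul_diag_rev x hx, hc, Units.val_one]
  · intro j hj _ h
    apply (Finset.mem_erase.mp hj).1
    have h1 := congrArg Fin.val h
    rw [Fin.val_rev] at h1
    exact Fin.ext (by omega)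
  · intro j hj
    refine Finset.mem_erase.mpr ⟨?_, Finset.mem_univ _⟩
    intro h
    exact (Finset.mem_erase.mp hj).1 (by rw [← Fin.rev_rev j, h, hrev])

/-- Up to scalars, every lower-triangular similitude is of the form `s u`. The element `s` is chosen
so that the ratios of successive diagonal entries agree. -/
lemma toP_surjective (hn3 : 3 ≤ n) :
    Function.Surjective (toP : (Fin (n / 2) → Rˣ) × N n R → P n R) := by
  rintro ⟨_, x, hx, rfl⟩
  let d : ℕ → Rˣ := fun i => if h : i < n then diagUnit x hx ⟨i, h⟩ else 1
  have hd : ∀ {i j : ℕ}, i + j + 1 = n → d i * d j = x.1.2 := by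
    intro i j h
    simp only [d, dif_pos (show i < n by omega), dif_pos (show j < n by omega)]
    refine Units.ext ?_
    rw [show (⟨j, by omega⟩ : Fin n) = (⟨i, by omega⟩ : Fin n).rev from
      Fin.ext (by rw [Fin.val_rev]; simp only; omega)]
    exact diag_mul_diag_rev x hx _
  obtain ⟨s, hs⟩ := (chi_bijective hn3).2 fun k : Fin (n / 2) => d k / d (k + 1)
  have hs' : ∀ k, k + 1 ≤ n / 2 → tN s k / tN s (k + 1) = d k / d (k + 1) := fun k hk =>
    congrFun hs ⟨k, hk⟩
  -- the diagonal of `x` is proportional to the diagonal of the torus element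
  set r : Rˣ := tN s 0 / d 0 with hr
  have h1 : ∀ i, i ≤ n / 2 → tN s i = r * d i := by
    intro i
    induction i with
    | zero => intro _; rw [hr, div_mul_cancel]
    | succ i ih =>
      intro hi
      have h2 := hs' i hi
      rw [ih (by omega), div_eq_div_iff_mul_eq_mul] at h2
      have h3 : d i * (r * d (i + 1)) = d i * tN s (i + 1) := by
        rw [← h2, mul_left_comm, mul_assoc]
      exact (mul_left_cancel h3).symm
  have hodd : Odd n → r = 1 := by
    intro hn
    have h2 := h1 (n / 2) le_rfl
    have h3 : d (n / 2) = 1 := by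
      have := diag_mid hn x hx ⟨n / 2, by omega⟩ rfl
      simp only [d, dif_pos (show n / 2 < n by omega)]
      exact Units.ext this
    rw [tN_odd_half hn, h3, mul_one] at h2
    exact h2.symm
  have hmult : torusMult s = r ^ 2 * x.1.2 := by
    by_cases hn : Odd n
    · rw [hodd hn, (((mem_similitudes _ _).mp x.2).2 hn).1]
      simp [torusMult, hn]
    · have := Nat.not_odd_iff.mp hn
      rw [← tN_mul_tN s (i := n / 2 - 1) (j := n / 2) (by omega), h1 _ (by omega), h1 _ le_rfl,
        mul_mul_mul_comm, hd (by omega), pow_two]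
  have h2 : ∀ i : Fin n, torusEntry s i = r * diagUnit x hx i := by
    intro i
    have hdi : diagUnit x hx i = d i := by simp [d]
    rw [← tN_val, hdi]
    rcases Nat.lt_or_ge (n / 2) i with h | h
    · have h3 := tN_mul_tN s (i := i) (j := n - 1 - i) (by omega)
      rw [h1 (n - 1 - i) (by omega), hmult, ← hd (i := i) (j := n - 1 - i) (by omega)] at h3
      refine mul_right_cancel (b := r * d (n - 1 - i)) (h3.trans ?_)
      rw [mul_mul_mul_comm, pow_two]
    · exact h1 i h
  -- the scalar similitude `r`
  let σ : similitudes n R := ⟨(Units.map (Matrix.scalar (Fin n)).toMonoidHom r, r ^ 2), by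
    refine (mem_similitudes _ _).mpr ⟨?_, fun hn => ?_⟩
    · change (Matrix.diagonal fun _ => (r : R))ᵀ * antiDiag n R *
        (Matrix.diagonal fun _ => (r : R)) = _
      ext i j
      rw [Matrix.diagonal_transpose, Matrix.mul_diagonal, Matrix.diagonal_mul, Matrix.smul_apply,
        smul_eq_mul, pow_two, Units.val_mul]
      ring
    · rw [hodd hn]
      simp⟩
  have hσ : σ ∈ scalars n R := ⟨r, by simp [σ, Matrix.scalar, Matrix.smul_one_eq_diagonal], rfl⟩
  have hσt : σ ∈ lowerTriangular n R := by
    intro i j hij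
    simp [σ, hij.ne]
  have hy : (torus s)⁻¹ * (x * σ) ∈ lowerTriangular n R :=
    mul_mem (inv_mem (torus_mem_lowerTriangular s)) (mul_mem hx hσt)
  have hdiag : ∀ i, ((torus s)⁻¹ * (x * σ)).1.1.val i i = 1 := by
    intro i
    change ((Matrix.diagonal fun i => (((torusEntry s i)⁻¹ : Rˣ) : R)) *
      (x.1.1.val * Matrix.diagonal fun _ => (r : R)) : Matrix (Fin n) (Fin n) R) i i = 1
    rw [Matrix.diagonal_mul, Matrix.mul_diagonal, h2 i, mul_comm (x.1.1.val i i)]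
    have : (r : R) * x.1.1.val i i = ((r * diagUnit x hx i : Rˣ) : R) := rfl
    rw [this, Units.inv_mul]
  have hone : ((torus s)⁻¹ * (x * σ)).1.2 = 1 := by
    change (torusMult s)⁻¹ * (x.1.2 * r ^ 2) = 1
    rw [hmult, mul_comm x.1.2, inv_mul_cancel]
  obtain ⟨u, hu⟩ := exists_unip_eq _ hy hdiag hone
  refine ⟨(s, u), Subtype.ext ?_⟩
  rw [toP_val, elt, hu, mul_inv_cancel_left]
  exact QuotientGroup.eq.mpr (by simpa using inv_mem hσ)

end LowerTriangular


/-! ### Right invariance over a field -/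

section RightInvariance

variable {n : ℕ} {R : Type*} [NormedCommRing R] [CompleteSpace R] [SecondCountableTopology R]
  [MeasurableSpace R] [BorelSpace R]

lemma measurable_conjN {Y : Type*} [MeasurableSpace Y] {s : Y → Fin (n / 2) → Rˣ} {u : Y → N n R}
    (hs : Measurable s) (hu : Measurable u) : Measurable fun y => conjN (s y) (u y) := by
  rw [measurable_N_iff] at hu ⊢
  intro i j
  simp only [conjN_apply, div_eq_mul_inv]
  exact (measurableEmbedding_units_val.measurable.comp (((measurable_torusEntry j).comp hs).mul
    ((measurable_torusEntry i).comp hs).inv)).mul (hu i j)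

lemma measurable_mulN {Y : Type*} [MeasurableSpace Y] {u v : Y → N n R}
    (hu : Measurable u) (hv : Measurable v) : Measurable fun y => u y * v y := by
  rw [measurable_N_iff] at hu hv ⊢
  intro i j
  simp only [coe_mul_N, Matrix.mul_apply]
  exact Finset.measurable_sum _ fun k _ => (hu i k).mul (hv k j)

lemma measurable_mulTN {Y : Type*} [MeasurableSpace Y] {x y : Y → (Fin (n / 2) → Rˣ) × N n R}
    (hx : Measurable x) (hy : Measurable y) : Measurable fun t => mulTN (x t) (y t) :=
  (hx.fst.mul hy.fst).prodMk (measurable_mulN (measurable_conjN hy.fst hx.snd) hy.snd)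

/-- Right translation by `y`, as a measurable equivalence. -/
def mulRightTN (hn3 : 3 ≤ n) (y : (Fin (n / 2) → Rˣ) × N n R) :
    ((Fin (n / 2) → Rˣ) × N n R) ≃ᵐ ((Fin (n / 2) → Rˣ) × N n R) where
  toFun x := mulTN x y
  invFun x := mulTN x (invTN y)
  left_inv x := by simp only; rw [mulTN_assoc hn3, mulTN_invTN, mulTN_one hn3]
  right_inv x := by simp only; rw [mulTN_assoc hn3, invTN_mulTN hn3, mulTN_one hn3]
  measurable_toFun := measurable_mulTN measurable_id measurable_const
  measurable_invFun := measurable_mulTN measurable_id measurable_const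

end RightInvariance

section FieldInvariance

variable {n : ℕ} {K : Type*} [NontriviallyNormedField K] [CharZero K] [MeasurableSpace K]
  [BorelSpace K] [ProperSpace K] (μ : Measure K) [μ.IsAddHaarMeasure]

/-- Conjugation by the torus scales `∏ du_ij` by `|δ|⁻¹`. -/
lemma lintegral_conjN (hn3 : 3 ≤ n) (s : Fin (n / 2) → Kˣ)
    (hμ : ∀ c : K, c ≠ 0 → μ.map (c * ·) = ENNReal.ofReal ‖c‖⁻¹ • μ)
    {f : N n K → ℝ≥0∞} (hf : Measurable f) :
    ∫⁻ u, f (conjN s u) ∂(duFree μ n) =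
      ENNReal.ofReal ‖(((delta s)⁻¹ : Kˣ) : K)‖ * ∫⁻ u, f u ∂(duFree μ n) := by
  have hT : IsTriangular (fun _ : NIndex n => 0)
      (fun x => ((torusEntry s x.1.2 / torusEntry s x.1.1 : Kˣ) : K))
      (fun v x => ((torusEntry s x.1.2 / torusEntry s x.1.1 : Kˣ) : K) * v x) :=
    fun t y y' _ => (mul_sub _ _ _).symm
  have hm : Measurable fun (v : NIndex n → K) (x : NIndex n) =>
      ((torusEntry s x.1.2 / torusEntry s x.1.1 : Kˣ) : K) * v x :=
    measurable_pi_lambda _ fun t => (measurable_pi_apply t).const_mul _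
  have h1 := hT.map_pi (μ := μ) (fun t => Units.ne_zero _) hm hμ
  have hm2 : Measurable fun v : NIndex n → K => f (NEquiv.symm v) := hf.comp NEquiv.symm.measurable
  have hc : Measurable fun u : N n K => f (conjN s u) :=
    hf.comp (measurable_conjN measurable_const measurable_id)
  rw [duFree_eq_map, lintegral_map hc NEquiv.symm.measurable,
    lintegral_map hf NEquiv.symm.measurable]
  have h2 : ∀ v : NIndex n → K, conjN s (NEquiv.symm v) = NEquiv.symm fun x =>
      ((torusEntry s x.1.2 / torusEntry s x.1.1 : Kˣ) : K) * v x := by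
    intro v
    rw [MeasurableEquiv.eq_symm_apply, NEquiv_apply]
    ext x
    rw [NCoord, conjN_apply]
    congr 1
    exact congrFun (NCoord_NEquiv_symm v) x
  simp only [h2]
  rw [← lintegral_map hm2 hm, h1, lintegral_smul_measure, smul_eq_mul,
    ← ENNReal.ofReal_prod_of_nonneg fun _ _ => by positivity]
  congr 2
  rw [delta_eq hn3, ← Finset.prod_inv_distrib, Units.coe_prod, norm_prod]
  simp only [Units.val_inv_eq_inv_val, norm_inv]

/-- The measure `|δ(s)|⁻¹ ∏ du_ij d^×s` is right-invariant: `(s u)(s' u') = s s' · (s'⁻¹us')u'`, and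
the factor `|δ(s')|⁻¹` from the conjugation turns `|δ(s)|⁻¹` into `|δ(ss')|⁻¹`. -/
lemma measurePreserving_mulTN (hn3 : 3 ≤ n) (y : (Fin (n / 2) → Kˣ) × N n K)
    (hμ : ∀ c : K, c ≠ 0 → μ.map (c * ·) = ENNReal.ofReal ‖c‖⁻¹ • μ) :
    MeasurePreserving (mulRightTN hn3 y) (dhFree μ n) (dhFree μ n) := by
  refine ⟨(mulRightTN hn3 y).measurable, Measure.ext_of_lintegral _ fun f hf => ?_⟩
  have hm : Measurable fun x => f (mulRightTN hn3 y x) := hf.comp (mulRightTN hn3 y).measurable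
  rw [lintegral_map hf (mulRightTN hn3 y).measurable, lintegral_dhFree μ hn3 hm,
    lintegral_dhFree μ hn3 hf]
  have h1 : ∀ s : Fin (n / 2) → Kˣ, ENNReal.ofReal ‖(((delta s)⁻¹ : Kˣ) : K)‖ *
      ∫⁻ u, f (mulRightTN hn3 y (s, u)) ∂(duFree μ n) =
      ENNReal.ofReal ‖(((delta (y.1 * s))⁻¹ : Kˣ) : K)‖ *
        ∫⁻ u, f (y.1 * s, u) ∂(duFree μ n) := by
    intro s
    have h2 : Measurable fun u : N n K => f (y.1 * s, u) := hf.comp measurable_prodMk_left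
    have h3 : Measurable fun u : N n K => f (y.1 * s, u * y.2) :=
      h2.comp (measurable_mulN measurable_id measurable_const)
    change _ * ∫⁻ u, f (s * y.1, conjN y.1 u * y.2) ∂(duFree μ n) = _
    rw [mul_comm s, lintegral_conjN μ hn3 y.1 hμ h3,
      (measurePreserving_mul_right_N μ y.2 hμ).lintegral_comp h2, ← mul_assoc,
      ← ENNReal.ofReal_mul (norm_nonneg _), ← norm_mul, ← Units.val_mul, delta_mul hn3, mul_inv,
      mul_comm (delta s)⁻¹]
  simp only [h1]
  have h4 : Measurable fun s : Fin (n / 2) → Kˣ => ENNReal.ofReal ‖(((delta s)⁻¹ : Kˣ) : K)‖ *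
      ∫⁻ u, f (s, u) ∂(duFree μ n) :=
    (measurable_ofReal_norm_delta hn3).mul hf.lintegral_prod_right'
  exact (measurePreserving_mul_left_ds μ hμ y.1).lintegral_comp h4

end FieldInvariance

/-! ### Restriction of measures along an embedding -/

section Restriction

variable {X Y Z X' Y' : Type*} [MeasurableSpace X] [MeasurableSpace Y] [MeasurableSpace Z]
  [MeasurableSpace X'] [MeasurableSpace Y']

/-- `e` identifies the measure `μ` with the restriction of `ν` to the range of `e`. -/
structure IsRestriction (e : X → Y) (μ : Measure X) (ν : Measure Y) : Prop where
  emb : MeasurableEmbedding e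
  map_eq : μ.map e = ν.restrict (Set.range e)

lemma IsRestriction.lintegral_eq {e : X → Y} {μ : Measure X} {ν : Measure Y}
    (h : IsRestriction e μ ν) (f : Y → ℝ≥0∞) :
    ∫⁻ x, f (e x) ∂μ = ∫⁻ y in Set.range e, f y ∂ν := by
  rw [← h.map_eq, h.emb.lintegral_map]

lemma _root_.MeasurableEmbedding.isRestriction_comap {e : X → Y} (he : MeasurableEmbedding e)
    (ν : Measure Y) : IsRestriction e (ν.comap e) ν := ⟨he, he.map_comap ν⟩

lemma IsRestriction.comp {e : X → Y} {e' : Y → Z} {μ : Measure X} {ν : Measure Y} {ρ : Measure Z}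
    (h' : IsRestriction e' ν ρ) (h : IsRestriction e μ ν) : IsRestriction (e' ∘ e) μ ρ := by
  refine ⟨h'.emb.comp h.emb, ?_⟩
  rw [← Measure.map_map h'.emb.measurable h.emb.measurable, h.map_eq,
    ← h'.emb.injective.preimage_image (Set.range e),
    ← Measure.restrict_map h'.emb.measurable (h'.emb.measurableSet_image.mpr
      h.emb.measurableSet_range), h'.map_eq,
    Measure.restrict_restrict (h'.emb.measurableSet_image.mpr h.emb.measurableSet_range),
    Set.inter_eq_self_of_subset_left (Set.image_subset_range _ _), Set.range_comp]

/-- If a restriction along `e' ∘ e` factors through a restriction along `e'`, then `e` is a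
restriction as well. -/
lemma IsRestriction.of_comp {e : X → Y} {e' : Y → Z} {μ : Measure X} {ν : Measure Y}
    {ρ : Measure Z} (h' : IsRestriction e' ν ρ) (he : Measurable e)
    (h : IsRestriction (e' ∘ e) μ ρ) : IsRestriction e μ ν := by
  have hemb : MeasurableEmbedding e := by
    refine ⟨Function.Injective.of_comp h.emb.injective, he, fun s hs => ?_⟩
    rw [← h'.emb.measurableSet_image, ← Set.image_comp]
    exact h.emb.measurableSet_image.mpr hs
  refine ⟨hemb, ?_⟩
  refine Measure.ext fun s hs => ?_
  have h1 := congrArg (fun τ : Measure Z => τ (e' '' s)) h.map_eq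
  have hs' := h'.emb.measurableSet_image.mpr hs
  have h2 := congrArg (fun τ : Measure Z => τ (e' '' (s ∩ Set.range e))) h'.map_eq
  rw [Measure.map_apply h.emb.measurable hs', Set.preimage_comp,
    h'.emb.injective.preimage_image, Measure.restrict_apply hs', Set.range_comp,
    ← Set.image_inter h'.emb.injective] at h1
  have hs2 := h'.emb.measurableSet_image.mpr (hs.inter hemb.measurableSet_range)
  rw [Measure.map_apply h'.emb.measurable hs2, h'.emb.injective.preimage_image,
    Measure.restrict_apply hs2, Set.inter_eq_self_of_subset_left (Set.image_subset_range _ _)] at h2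
  rw [Measure.map_apply he hs, h1, Measure.restrict_apply hs, h2]

lemma IsRestriction.withDensity {e : X → Y} {μ : Measure X} {ν : Measure Y}
    (h : IsRestriction e μ ν) (f : Y → ℝ≥0∞) :
    IsRestriction e (μ.withDensity fun x => f (e x)) (ν.withDensity f) := by
  refine ⟨h.emb, Measure.ext fun s hs => ?_⟩
  rw [Measure.map_apply h.emb.measurable hs, withDensity_apply _ (h.emb.measurable hs),
    Measure.restrict_apply hs, withDensity_apply _ (hs.inter h.emb.measurableSet_range),
    ← Measure.restrict_restrict hs, ← h.map_eq, h.emb.restrict_map, h.emb.lintegral_map]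

lemma IsRestriction.smul {e : X → Y} {μ : Measure X} {ν : Measure Y}
    (h : IsRestriction e μ ν) (c : ℝ≥0∞) : IsRestriction e (c • μ) (c • ν) :=
  ⟨h.emb, by rw [Measure.map_smul, h.map_eq, Measure.restrict_smul]⟩

lemma IsRestriction.prod {e : X → Y} {μ : Measure X} {ν : Measure Y} {e' : X' → Y'}
    {μ' : Measure X'} {ν' : Measure Y'} [SFinite μ] [SFinite ν] [SFinite μ'] [SFinite ν']
    (h : IsRestriction e μ ν) (h' : IsRestriction e' μ' ν') :
    IsRestriction (Prod.map e e') (μ.prod μ') (ν.prod ν') :=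
  ⟨h.emb.prodMap h'.emb, by
    rw [← Measure.map_prod_map _ _ h.emb.measurable h'.emb.measurable, h.map_eq, h'.map_eq,
      Measure.prod_restrict, Set.range_prodMap]⟩

lemma IsRestriction.pi {ι : Type*} [Fintype ι] [Nonempty X] {e : X → Y} {μ : Measure X}
    {ν : Measure Y} [SigmaFinite μ] [SigmaFinite ν] (h : IsRestriction e μ ν) :
    IsRestriction (fun (x : ι → X) i => e (x i)) (Measure.pi fun _ => μ)
      (Measure.pi fun _ => ν) := by
  have hm : Measurable fun (x : ι → X) i => e (x i) :=
    measurable_pi_lambda _ fun i => h.emb.measurable.comp (measurable_pi_apply i)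
  have hr : Set.range (fun (x : ι → X) i => e (x i)) = Set.univ.pi fun _ => Set.range e := by
    ext y
    simp only [Set.mem_univ_pi, Set.mem_range]
    constructor
    · rintro ⟨x, rfl⟩ i
      exact ⟨x i, rfl⟩
    · intro hy
      choose x hx using hy
      exact ⟨x, funext hx⟩
  obtain ⟨g, hg, hge⟩ := h.emb.exists_measurable_extend measurable_id fun _ => ‹Nonempty X›
  have hgm : Measurable fun (y : ι → Y) i => g (y i) :=
    measurable_pi_lambda _ fun i => hg.comp (measurable_pi_apply i)
  refine ⟨MeasurableEmbedding.of_measurable_inverse hm ?_ hgm fun x =>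
    funext fun i => congrFun hge (x i), ?_⟩
  · rw [hr]
    exact MeasurableSet.univ_pi fun _ => h.emb.measurableSet_range
  have hsf : SigmaFinite (μ.map e) := by
    rw [h.map_eq]
    infer_instance
  have h1 := Measure.pi_map_pi (ι := ι) (μ := fun _ => μ) (f := fun _ => e) (hμ := fun _ => hsf)
    fun _ => h.emb.measurable.aemeasurable
  rw [h1, h.map_eq, ← Measure.restrict_pi_pi, hr]

end Restriction


/-! ### Base change from the ring to the field -/

section BaseChange

variable {n : ℕ} {R K : Type*} [CommRing R] [CommRing K] (ι : R →+* K)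

/-- Base change for `W`. -/
def mapW (B : W n R) : W n K := ⟨B.1.map ι, B.2.map ι⟩

/-- Base change for `N`. -/
def mapN (u : N n R) : N n K := ⟨u.1.map ι, by
  refine ⟨?_, fun i => by rw [Matrix.map_apply, u.2.2.1, map_one], fun i j hij => by
    rw [Matrix.map_apply, u.2.2.2 i j hij, map_zero]⟩
  have hA : antiDiag n K = (antiDiag n R).map ι := by
    ext i j
    simp only [antiDiag, Matrix.of_apply, Matrix.map_apply]
    split_ifs <;> simp
  rw [hA, ← Matrix.transpose_map, ← Matrix.map_mul, ← Matrix.map_mul, u.2.1]⟩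

/-- Base change for the torus. -/
def mapT (s : Fin (n / 2) → Rˣ) : Fin (n / 2) → Kˣ := fun k => Units.map (ι : R →* K) (s k)

/-- Base change for pairs `(s, u)`. -/
def mapTN : (Fin (n / 2) → Rˣ) × N n R → (Fin (n / 2) → Kˣ) × N n K := Prod.map (mapT ι) (mapN ι)

lemma mapW_apply (B : W n R) (i j : Fin n) : (mapW ι B).1 i j = ι (B.1 i j) := rfl

lemma mapN_apply (u : N n R) (i j : Fin n) : (mapN ι u).1 i j = ι (u.1 i j) := rfl

lemma sc_mapT (s : Fin (n / 2) → Rˣ) (k : ℕ) :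
    sc (mapT ι s) k = Units.map (ι : R →* K) (sc s k) := by
  unfold sc
  split_ifs
  · rfl
  · exact (map_one _).symm

lemma torusMult_mapT (s : Fin (n / 2) → Rˣ) :
    torusMult (mapT ι s) = Units.map (ι : R →* K) (torusMult s) := by
  unfold torusMult
  simp only [sc_mapT]
  split_ifs
  · exact (map_one _).symm
  · exact (map_mul _ _ _).symm

lemma torusHalf_mapT (s : Fin (n / 2) → Rˣ) (i : ℕ) :
    torusHalf (mapT ι s) i = Units.map (ι : R →* K) (torusHalf s i) := by
  unfold torusHalf
  simp only [sc_mapT]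
  split_ifs <;> simp only [map_prod, map_inv]

lemma torusEntry_mapT (s : Fin (n / 2) → Rˣ) (i : Fin n) :
    torusEntry (mapT ι s) i = Units.map (ι : R →* K) (torusEntry s i) := by
  unfold torusEntry
  simp only [torusHalf_mapT, torusMult_mapT]
  split_ifs
  · rfl
  · simp only [map_mul, map_inv]

lemma delta_mapT (hn3 : 3 ≤ n) (s : Fin (n / 2) → Rˣ) :
    delta (mapT ι s) = Units.map (ι : R →* K) (delta s) := by
  simp only [delta_eq hn3, torusEntry_mapT, map_prod, _root_.map_div]

lemma mapW_elt_smul (x : (Fin (n / 2) → Rˣ) × N n R) (B : W n R) :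
    mapW ι (elt x • B) = elt (mapTN ι x) • mapW ι B := by
  refine Subtype.ext (Matrix.ext fun i j => ?_)
  rw [mapW_apply, elt, elt, mul_smul, mul_smul, torus_smul_apply, torus_smul_apply, unip_smul,
    unip_smul]
  simp only [mapTN, Prod.map_fst, Prod.map_snd, torusMult_mapT, torusEntry_mapT, ← map_inv,
    ← map_mul, Units.coe_map, MonoidHom.coe_coe]
  simp only [Matrix.mul_apply, map_sum, map_mul, Matrix.transpose_apply]
  rfl

lemma mapTN_mulTN (x y : (Fin (n / 2) → Rˣ) × N n R) :
    mapTN ι (mulTN x y) = mulTN (mapTN ι x) (mapTN ι y) := by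
  refine Prod.ext (funext fun k => map_mul _ _ _) (Subtype.ext (Matrix.ext fun i j => ?_))
  simp only [mapTN, mulTN, Prod.map_snd, Prod.map_fst, mapN_apply, coe_mul_N, Matrix.mul_apply,
    conjN_apply, map_sum, map_mul, torusEntry_mapT, ← _root_.map_div, Units.coe_map,
    MonoidHom.coe_coe]

lemma mapTN_one : mapTN ι (1 : (Fin (n / 2) → Rˣ) × N n R) = 1 := by
  refine Prod.ext (funext fun k => map_one _) (Subtype.ext (Matrix.ext fun i j => ?_))
  simp only [mapTN, Prod.map_snd, Prod.snd_one, mapN_apply, coe_one_N, Matrix.one_apply]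
  split_ifs <;> simp

lemma inv_mapW (B : W n R) : inv (mapW ι B) = (inv B).map ι := by
  have h := (Polynomial.mapRingHom ι).map_det ((X : R[X]) • (antiDiag n R).map C + B.1.map C)
  unfold inv
  rw [← Polynomial.coe_mapRingHom, map_mul, h, map_pow, map_neg, map_one]
  congr 2
  ext1 i j
  simp only [antiDiag, mapW, RingHom.mapMatrix_apply, Matrix.map_apply, Matrix.add_apply,
    Matrix.smul_apply, Matrix.of_apply, smul_eq_mul, coe_mapRingHom, Polynomial.map_add,
    Polynomial.map_mul, map_X, map_C]
  split_ifs <;> simp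

lemma monicPoly_map (a : Fin n → R) : (monicPoly a).map ι = monicPoly fun i => ι (a i) := by
  simp [monicPoly, Polynomial.map_sum]

/-- Base change for `W₀`. -/
def mapW₀ (B : W₀ n R) : W₀ n K := ⟨mapW ι B.1, fun i j hij => by
  rw [mapW_apply, B.2 i j hij, map_zero]⟩

lemma mapW₀_W₀ofCoord (x : W₀Index n → R) :
    mapW₀ ι (W₀ofCoord x) = W₀ofCoord fun t => ι (x t) := by
  refine Subtype.ext (Subtype.ext (Matrix.ext fun i j => ?_))
  change ι ((W₀ofCoord x).1.1 i j) = _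
  simp only [W₀ofCoord, Matrix.of_apply]
  split_ifs
  · rfl
  · exact map_zero ι

lemma lam_mapW₀ (B : W₀ n R) : lam (mapW₀ ι B) = ι (lam B) := by
  have hb : ∀ i j, b (mapW₀ ι B).1 i j = ι (b B.1 i j) := by
    intro i j
    unfold b
    split_ifs
    · rfl
    · exact (map_zero ι).symm
  unfold lam
  simp only [hb]
  split_ifs <;> simp [map_prod]

end BaseChange

section BaseChangeMeasure

variable {n : ℕ} {R K : Type*} [NormedCommRing R] [CompleteSpace R] [SecondCountableTopology R]
  [MeasurableSpace R] [BorelSpace R]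
  [NontriviallyNormedField K] [CharZero K] [MeasurableSpace K] [BorelSpace K] [ProperSpace K]
  {ι : R →+* K} {μR : Measure R} [SigmaFinite μR] {μ : Measure K} [μ.IsAddHaarMeasure]

lemma isDomain_of_isometry (hnorm : ∀ x, ‖ι x‖ = ‖x‖) : IsDomain R :=
  Function.Injective.isDomain ι ((injective_iff_map_eq_zero ι).mpr fun x hx => by
    rwa [← norm_eq_zero, hnorm, norm_eq_zero] at hx)

lemma isRestriction_unitsMap (h : IsRestriction ι μR μ) (hnorm : ∀ x, ‖ι x‖ = ‖x‖) :
    IsRestriction (Units.map (ι : R →* K)) (dUnits μR) (dUnits μ) := by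
  have h1 := h.comp (measurableEmbedding_units_val.isRestriction_comap μR)
  have h2 := (measurableEmbedding_units_val (R := K)).isRestriction_comap μ
  have hm : Measurable (Units.map (ι : R →* K)) :=
    measurable_units_iff.mpr (h.emb.measurable.comp measurableEmbedding_units_val.measurable)
  have h3 := (h2.of_comp hm h1).withDensity fun s : Kˣ => ENNReal.ofReal ‖(s : K)‖⁻¹
  simp only [Units.coe_map, MonoidHom.coe_coe, hnorm] at h3
  exact h3

lemma isRestriction_mapT (h : IsRestriction ι μR μ) (hnorm : ∀ x, ‖ι x‖ = ‖x‖) :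
    IsRestriction (mapT ι) (ds n μR) (ds n μ) :=
  (isRestriction_unitsMap h hnorm).pi

lemma measurable_mapN (h : IsRestriction ι μR μ) : Measurable (mapN ι : N n R → N n K) :=
  measurable_N_iff.mpr fun i j => h.emb.measurable.comp (measurable_N_iff.mp measurable_id i j)

/-- The factor by which `du` differs from `∏ du_ij`. -/
noncomputable def duFactor (n : ℕ) (K : Type*) [NormedCommRing K] : ℝ≥0∞ :=
  if Odd n then ENNReal.ofReal (‖(2 : K)‖ ^ (n / 2))⁻¹ else 1

lemma isRestriction_mapN (h : IsRestriction ι μR μ) (hnorm : ∀ x, ‖ι x‖ = ‖x‖) :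
    IsRestriction (mapN ι) (du n μR) (duFactor n K • duFree μ n) := by
  have := isDomain_of_isometry hnorm
  have h2 : NeZero (2 : R) := ⟨fun h2 => by
    have := congrArg ι h2
    rw [map_ofNat, map_zero] at this
    exact two_ne_zero this⟩
  have h3 := (h.pi (ι := NIndex n)).comp (measurableEmbedding_NCoord.isRestriction_comap _)
  have h4 := (measurableEmbedding_NCoord (n := n) (R := K)).isRestriction_comap
    (Measure.pi fun _ => μ)
  have h5 := (h4.of_comp (measurable_mapN h) h3).smul (duFactor n K)
  have h6 : duFactor n K = duFactor n R := by
    rw [duFactor, duFactor, ← hnorm, map_ofNat]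
  rw [h6] at h5 ⊢
  exact h5

instance : SigmaFinite (duFactor n K • duFree μ n) := by
  unfold duFactor
  split_ifs
  · exact inferInstanceAs (SigmaFinite (Real.toNNReal _ • duFree μ n))
  · rw [one_smul]
    infer_instance

/-- The measure `|δ(s)|⁻¹ du d^×s` on pairs `(s, u)`. -/
noncomputable def dTN (n : ℕ) (μR : Measure R) : Measure ((Fin (n / 2) → Rˣ) × N n R) :=
  ((ds n μR).prod (du n μR)).withDensity fun x => ENNReal.ofReal ‖(((delta x.1)⁻¹ : Rˣ) : R)‖

/-- The measure on `𝒫(R)`, in coordinates, is the restriction of that on `𝒫(K)`. -/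
lemma isRestriction_mapTN (hn3 : 3 ≤ n) (h : IsRestriction ι μR μ) (hnorm : ∀ x, ‖ι x‖ = ‖x‖) :
    IsRestriction (mapTN ι) (dTN n μR) (duFactor n K • dhFree μ n) := by
  have : SigmaFinite (du n μR) := by
    refine SigmaFinite.of_map _ (measurable_mapN h).aemeasurable ?_
    rw [(isRestriction_mapN h hnorm).map_eq]
    infer_instance
  have h1 := ((isRestriction_mapT (n := n) h hnorm).prod
    (isRestriction_mapN (n := n) h hnorm)).withDensity
      fun x => ENNReal.ofReal ‖(((delta x.1)⁻¹ : Kˣ) : K)‖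
  simp only [Prod.map_fst, delta_mapT ι hn3, ← map_inv, Units.coe_map, MonoidHom.coe_coe,
    hnorm] at h1
  rw [dTN, dhFree, ← withDensity_smul_measure, ← Measure.prod_smul_right]
  exact h1

end BaseChangeMeasure


/-! ### Measurability on the quotient group -/

section GroupMeasurable

variable {n : ℕ} {R : Type*} [NormedCommRing R] [CompleteSpace R] [SecondCountableTopology R]
  [MeasurableSpace R] [BorelSpace R]

lemma measurable_similitudes_iff {Y : Type*} [MeasurableSpace Y] {f : Y → similitudes n R} :
    Measurable f ↔
      (∀ i j, Measurable fun y => (f y).1.1.val i j) ∧ Measurable fun y => (f y).1.2 := by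
  have h1 : Measurable f ↔ Measurable fun y => (f y).1 :=
    ⟨fun h => measurable_subtype_coe.comp h, fun h => h.subtype_mk⟩
  have h2 : ∀ g : Y → GL (Fin n) R, Measurable g ↔ ∀ i j, Measurable fun y => (g y).val i j :=
    fun g => measurable_comap_iff.trans measurable_matrix_iff
  have h3 : (Measurable fun y => (f y).1) ↔ (Measurable fun y => (f y).1.1) ∧
      Measurable fun y => (f y).1.2 := ⟨fun h => ⟨h.fst, h.snd⟩, fun h => h.1.prodMk h.2⟩
  rw [h1, h3, h2]

lemma measurable_elt : Measurable (elt : (Fin (n / 2) → Rˣ) × N n R → similitudes n R) := by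
  rw [measurable_similitudes_iff]
  constructor
  · intro i j
    have h : ∀ x : (Fin (n / 2) → Rˣ) × N n R, (elt x).1.1.val i j =
        (torusEntry x.1 i : R) * x.2.1 i j := fun x => Matrix.diagonal_mul _ _ _ _
    simp only [h]
    exact (measurableEmbedding_units_val.measurable.comp ((measurable_torusEntry i).comp
      measurable_fst)).mul (measurable_N_iff.mp measurable_snd i j)
  · exact (measurable_torusMult.comp measurable_fst).mul measurable_const

lemma measurable_toP : Measurable (toP : (Fin (n / 2) → Rˣ) × N n R → P n R) :=
  Measurable.subtype_mk (QuotientGroup.measurable_coe.comp measurable_elt)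

lemma measurable_P_smul (B : W₀ n R) : Measurable fun h : P n R => h • B := by
  have h1 : Measurable fun g : G n R => g • B.1 := by
    refine QuotientGroup.measurable_from_quotient.mpr ?_
    refine measurable_W_iff.mpr fun i j => ?_
    have h := measurable_similitudes_iff.mp (measurable_id (α := similitudes n R))
    change Measurable fun x : similitudes n R => (x • B.1).1 i j
    simp only [coe_smul_similitudes, Matrix.smul_apply, smul_eq_mul, Matrix.mul_apply,
      Matrix.transpose_apply]
    exact (measurableEmbedding_units_val.measurable.comp h.2.inv).mul
      (Finset.measurable_sum _ fun k _ => (Finset.measurable_sum _ fun l _ =>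
        (h.1 i l).mul measurable_const).mul (h.1 j k))
  exact Measurable.subtype_mk (h1.comp measurable_subtype_coe)

lemma measurable_P_mul_right (g : P n R) : Measurable fun h : P n R => h * g := by
  obtain ⟨_, y, hy, rfl⟩ := g
  have h1 : Measurable fun g : G n R => g * (y : G n R) := by
    refine QuotientGroup.measurable_from_quotient.mpr ?_
    change Measurable fun x : similitudes n R => ((x * y : similitudes n R) : G n R)
    refine QuotientGroup.measurable_coe.comp (measurable_similitudes_iff.mpr ?_)
    have h := measurable_similitudes_iff.mp (measurable_id (α := similitudes n R))
    constructor
    · intro i j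
      change Measurable fun x : similitudes n R => (x.1.1.val * y.1.1.val) i j
      simp only [Matrix.mul_apply]
      exact Finset.measurable_sum _ fun k _ => (h.1 i k).mul measurable_const
    · exact h.2.mul measurable_const
  exact Measurable.subtype_mk (h1.comp measurable_subtype_coe)

end GroupMeasurable

/-! ### Orbits over the ring -/

section OrbitSum

variable {n : ℕ} {R K : Type*} [NormedCommRing R] [CompleteSpace R] [SecondCountableTopology R]
  [MeasurableSpace R] [BorelSpace R]
  [NontriviallyNormedField K] [CharZero K] [MeasurableSpace K] [BorelSpace K] [ProperSpace K]
  {ι : R →+* K} {μR : Measure R} [SigmaFinite μR] {μ : Measure K} [μ.IsAddHaarMeasure]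

lemma measurePreserving_mulTN_factor (hn3 : 3 ≤ n) (y : (Fin (n / 2) → Kˣ) × N n K)
    (hμ : ∀ c : K, c ≠ 0 → μ.map (c * ·) = ENNReal.ofReal ‖c‖⁻¹ • μ) :
    MeasurePreserving (mulRightTN hn3 y) (duFactor n K • dhFree μ n)
      (duFactor n K • dhFree μ n) :=
  ⟨(mulRightTN hn3 y).measurable, by
    rw [Measure.map_smul, (measurePreserving_mulTN μ hn3 y hμ).map_eq]⟩

/-- Right invariance over the ring follows from that over the field, because the image of `𝒫(R)` in
`𝒫(K)` is stable under right translation by the elements of `𝒫(R)`. -/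
theorem isMulRightInvariant_dh (hn3 : 3 ≤ n) (h : IsRestriction ι μR μ)
    (hnorm : ∀ x, ‖ι x‖ = ‖x‖)
    (hμ : ∀ c : K, c ≠ 0 → μ.map (c * ·) = ENNReal.ofReal ‖c‖⁻¹ • μ) :
    (dh n μR).IsMulRightInvariant := by
  have hr := isRestriction_mapTN hn3 h hnorm
  refine ⟨fun g => ?_⟩
  obtain ⟨y, rfl⟩ := toP_surjective hn3 g
  have h1 : (dTN n μR).map (mulRightTN hn3 y) = dTN n μR := by
    have h2 : mapTN ι ∘ mulRightTN hn3 y = mulRightTN hn3 (mapTN ι y) ∘ mapTN ι :=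
      funext fun x => mapTN_mulTN ι x y
    refine Measure.ext fun s hs => ?_
    have key : ∀ τ : Measure ((Fin (n / 2) → Rˣ) × N n R),
        τ s = τ.map (mapTN ι) (mapTN ι '' s) := by
      intro τ
      rw [hr.emb.map_apply, hr.emb.injective.preimage_image]
    rw [key, key (dTN n μR)]
    congr 1
    rw [Measure.map_map hr.emb.measurable (mulRightTN hn3 y).measurable, h2,
      ← Measure.map_map (mulRightTN hn3 _).measurable hr.emb.measurable, hr.map_eq]
    have h3 : Set.range (mapTN ι : (Fin (n / 2) → Rˣ) × N n R → _) =
        mulRightTN hn3 (mapTN ι y) ⁻¹' Set.range (mapTN ι) := by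
      ext x
      constructor
      · rintro ⟨t, rfl⟩
        exact ⟨mulTN t y, mapTN_mulTN ι t y⟩
      · rintro ⟨t, ht⟩
        refine ⟨mulTN t (invTN y), ?_⟩
        have h4 : mulTN (mapTN ι y) (mapTN ι (invTN y)) = 1 := by
          rw [← mapTN_mulTN, mulTN_invTN, mapTN_one]
        rw [mapTN_mulTN, ht]
        change mulTN (mulTN x (mapTN ι y)) _ = x
        rw [mulTN_assoc hn3, h4, mulTN_one hn3]
    conv_lhs => rw [h3]
    rw [← Measure.restrict_map (mulRightTN hn3 _).measurable hr.emb.measurableSet_range,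
      (measurePreserving_mulTN_factor hn3 _ hμ).map_eq]
  have h5 : dh n μR = (dTN n μR).map toP := rfl
  rw [h5, Measure.map_map (measurable_P_mul_right _) measurable_toP]
  conv_rhs => rw [← h1, Measure.map_map measurable_toP (mulRightTN hn3 y).measurable]
  congr 1
  exact funext fun x => (toP_mulTN x y).symm

/-- `𝒫(R)` is open in `𝒫(K)`, since `R` is open in `K`. -/
lemma isOpen_range_mapTN (hι : Topology.IsOpenEmbedding ι) :
    IsOpen (Set.range (mapTN ι : (Fin (n / 2) → Rˣ) × N n R → _)) := by
  have h1 : Set.range (mapTN ι : (Fin (n / 2) → Rˣ) × N n R → _) =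
      (⋂ k, {x | (x.1 k : K) ∈ Set.range fun r : Rˣ => ι r}) ∩
        ⋂ i, ⋂ j, {x | x.2.1 i j ∈ Set.range ι} := by
    ext x
    simp only [Set.mem_inter_iff, Set.mem_iInter, Set.mem_ofPred_eq]
    constructor
    · rintro ⟨y, rfl⟩
      exact ⟨fun k => ⟨y.1 k, rfl⟩, fun i j => ⟨y.2.1 i j, rfl⟩⟩
    · rintro ⟨hs, hu⟩
      choose s hs using hs
      choose u hu using hu
      have hum : (Matrix.of u).map ι = x.2.1 := Matrix.ext hu
      refine ⟨(s, ⟨Matrix.of u, ?_, fun i => hι.injective ?_, fun i j hij => hι.injective ?_⟩),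
        Prod.ext (funext fun k => Units.ext (hs k)) (Subtype.ext hum)⟩
      · have hA : antiDiag n K = (antiDiag n R).map ι := by
          ext i j
          simp only [antiDiag, Matrix.of_apply, Matrix.map_apply]
          split_ifs <;> simp
        have h := x.2.2.1
        rw [← hum, hA, ← Matrix.transpose_map, ← Matrix.map_mul, ← Matrix.map_mul] at h
        exact Matrix.map_injective hι.injective h
      · rw [map_one, ← x.2.2.2.1 i]
        exact hu i i
      · rw [map_zero, ← x.2.2.2.2 i j hij]
        exact hu i j
  rw [h1]
  refine (isOpen_iInter_of_finite fun k => ?_).inter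
    (isOpen_iInter_of_finite fun i => isOpen_iInter_of_finite fun j => ?_)
  · refine IsOpen.preimage (f := fun x : (Fin (n / 2) → Kˣ) × N n K => (x.1 k : K))
      (Units.continuous_val.comp ((continuous_apply k).comp continuous_fst)) ?_
    exact (hι.comp Units.isOpenEmbedding_val).isOpen_range
  · exact IsOpen.preimage (f := fun x : (Fin (n / 2) → Kˣ) × N n K => x.2.1 i j)
      ((continuous_subtype_val.comp continuous_snd).matrix_elem i j) hι.isOpen_range

lemma continuous_mulRightTN (hn3 : 3 ≤ n) (y : (Fin (n / 2) → Kˣ) × N n K) :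
    Continuous (mulRightTN hn3 y) := by
  refine (continuous_fst.mul continuous_const).prodMk (Continuous.subtype_mk ?_ _)
  refine continuous_matrix fun i j => ?_
  simp only [Matrix.mul_apply, conjN_apply]
  exact continuous_finsetSum _ fun k _ => (continuous_const.mul
    ((continuous_subtype_val.comp continuous_snd).matrix_elem i k)).mul continuous_const

lemma secondCountable_TN : SecondCountableTopology ((Fin (n / 2) → Kˣ) × N n K) := by
  have h1 : SecondCountableTopology Kˣ :=
    (Units.isOpenEmbedding_val (R := K)).isEmbedding.secondCountableTopology
  have h2 : SecondCountableTopology (Matrix (Fin n) (Fin n) K) :=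
    inferInstanceAs (SecondCountableTopology (Fin n → Fin n → K))
  have h3 : SecondCountableTopology (N n K) :=
    Topology.IsEmbedding.subtypeVal.secondCountableTopology
  infer_instance

lemma measurableEmbedding_mapW (h : IsRestriction ι μR μ) :
    MeasurableEmbedding fun B : W₀ n R => mapW ι B.1 := by
  refine Measurable.measurableEmbedding (measurable_W_iff.mpr fun i j => ?_) fun B B' hB => ?_
  · exact h.emb.measurable.comp (measurable_W_iff.mp measurable_subtype_coe i j)
  · refine Subtype.ext (Subtype.ext (Matrix.ext fun i j => h.emb.injective ?_))
    exact congrArg (fun C : W n K => C.1 i j) hB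

/-- Extension by zero of a function on `W₀(R)` to `W(K)`. -/
noncomputable def extendW (ι : R →+* K) (φ : W₀ n R → ℝ≥0∞) : W n K → ℝ≥0∞ :=
  Function.extend (fun B : W₀ n R => mapW ι B.1) φ 0

lemma measurable_extendW (h : IsRestriction ι μR μ) {φ : W₀ n R → ℝ≥0∞} (hφ : Measurable φ) :
    Measurable (extendW ι φ) :=
  (measurableEmbedding_mapW h).measurable_extend hφ measurable_zero

lemma extendW_mapW (h : IsRestriction ι μR μ) (φ : W₀ n R → ℝ≥0∞) (B : W₀ n R) :
    extendW ι φ (mapW ι B.1) = φ B :=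
  (measurableEmbedding_mapW h).injective.extend_apply _ _ B

lemma exists_of_extendW_ne_zero {φ : W₀ n R → ℝ≥0∞} {B : W n K} (hB : extendW ι φ B ≠ 0) :
    ∃ B' : W₀ n R, mapW ι B'.1 = B := by
  by_contra hc
  exact hB (Function.extend_apply' _ _ _ hc)

/-- If two elements of a free orbit of `𝒫(K)` are translates of each other under `𝒫(R)`, then so are
their coordinates in the orbit. -/
lemma exists_mapTN_mulTN (hn3 : 3 ≤ n) {B B' : W₀ n R} {C : W n K} (hC : IsSlice C)
    {z z' : (Fin (n / 2) → Kˣ) × N n K} (hz : mapW ι B.1 = elt z • C)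
    (hz' : mapW ι B'.1 = elt z' • C) {h : P n R} (hB : h • B = B') :
    ∃ x, z' = mulTN (mapTN ι x) z := by
  obtain ⟨x, rfl⟩ := toP_surjective hn3 h
  refine ⟨x, elt_smul_sec_eq hn3 hC ?_⟩
  rw [← hz', elt_mulTN, mul_smul, ← hz, ← mapW_elt_smul, ← toP_smul, hB]

/-- The sum over the orbits of `𝒫(R)` unfolds to an integral over `𝒫(K)`: the orbits correspond to
disjoint open cosets of `𝒫(R)` in `𝒫(K)`. -/
theorem tsum_orbits_eq (hn3 : 3 ≤ n) (hι : Topology.IsOpenEmbedding ι)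
    (h : IsRestriction ι μR μ) (hnorm : ∀ x, ‖ι x‖ = ‖x‖)
    (hμ : ∀ c : K, c ≠ 0 → μ.map (c * ·) = ENNReal.ofReal ‖c‖⁻¹ • μ) {a : Fin n → R}
    (ha : ∀ B : W₀ n R, inv B.1 = monicPoly a →
      ∃ z : (Fin (n / 2) → Kˣ) × N n K, mapW ι B.1 = elt z • (sec fun i => ι (a i)).1)
    {φ : W₀ n R → ℝ≥0∞} (hφ : Measurable φ) :
    ∑' ω : Orbits₀ n (monicPoly a), ∫⁻ g, φ (g • rep ω) ∂(dh n μR) =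
      ∫⁻ z, extendW ι φ (elt z • (sec fun i => ι (a i)).1) ∂(duFactor n K • dhFree μ n) := by
  have hr := isRestriction_mapTN hn3 h hnorm
  set S := (sec fun i => ι (a i)).1 with hS
  have hslice : IsSlice S := isSlice_sec _
  have hrep : ∀ ω : Orbits₀ n (monicPoly a), ∃ z, mapW ι (rep ω).1 = elt z • S := fun ω =>
    ha _ (Quotient.out ω : fiber₀ (monicPoly a)).2
  choose z hz using hrep
  -- The elements of `𝒫(K)` that carry `S` into the orbit `ω`: a coset of `𝒫(R)`.
  let C : Orbits₀ n (monicPoly a) → Set ((Fin (n / 2) → Kˣ) × N n K) := fun ω =>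
    mulRightTN hn3 (z ω) '' Set.range (mapTN ι)
  have hCmem : ∀ ω x, x ∈ C ω → ∃ t, x = mulTN (mapTN ι t) (z ω) := by
    rintro ω _ ⟨_, ⟨t, rfl⟩, rfl⟩
    exact ⟨t, rfl⟩
  have hCsmul : ∀ ω t, elt (mulTN (mapTN ι t) (z ω)) • S = mapW ι (toP t • rep ω).1 := by
    intro ω t
    rw [elt_mulTN, mul_smul, ← hz, ← mapW_elt_smul, toP_smul]
  have hCmeas : ∀ ω, MeasurableSet (C ω) := fun ω =>
    (mulRightTN hn3 (z ω)).measurableSet_image.mpr hr.emb.measurableSet_range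
  have hCopen : ∀ ω, IsOpen (C ω) := by
    intro ω
    have h1 : C ω = mulRightTN hn3 (invTN (z ω)) ⁻¹' Set.range (mapTN ι) := by
      ext x
      constructor
      · intro hx
        obtain ⟨t, rfl⟩ := hCmem ω x hx
        refine ⟨t, ?_⟩
        change _ = mulTN (mulTN _ _) _
        rw [mulTN_assoc hn3, mulTN_invTN, mulTN_one hn3]
      · intro hx
        refine ⟨_, hx, ?_⟩
        change mulTN (mulTN _ _) _ = _
        rw [mulTN_assoc hn3, invTN_mulTN hn3, mulTN_one hn3]
    rw [h1]
    exact (isOpen_range_mapTN hι).preimage (continuous_mulRightTN hn3 _)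
  have hdisj : Pairwise (Function.onFun Disjoint C) := by
    intro ω ω' hne
    refine Set.disjoint_left.mpr fun x hx hx' => hne ?_
    obtain ⟨t, rfl⟩ := hCmem ω x hx
    obtain ⟨t', ht'⟩ := hCmem ω' _ hx'
    have h1 := hCsmul ω t
    rw [ht', hCsmul ω' t'] at h1
    have h2 : toP t • rep ω = toP t' • rep ω' :=
      ((measurableEmbedding_mapW (n := n) h).injective h1).symm
    rw [← Quotient.out_eq ω, ← Quotient.out_eq ω']
    refine Quotient.sound (MulAction.orbitRel_apply.mpr ⟨(toP t)⁻¹ * toP t', ?_⟩)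
    refine Subtype.ext ?_
    change ((toP t)⁻¹ * toP t') • rep ω' = rep ω
    rw [mul_smul, ← h2, inv_smul_smul]
  have hsc := secondCountable_TN (n := n) (K := K)
  -- Disjoint nonempty open sets in a second countable space are countable in number.
  have hcount : Countable (Orbits₀ n (monicPoly a)) :=
    hdisj.countable_of_isOpen_disjoint hCopen fun ω => ⟨_, _, ⟨1, rfl⟩, rfl⟩
  have hG : Measurable fun x => extendW ι φ (elt x • S) :=
    (measurable_extendW h hφ).comp
      (measurable_torus_unip_smul (x := fun x => x) measurable_id measurable_const)
  have h1 : ∀ ω, ∫⁻ g, φ (g • rep ω) ∂(dh n μR) =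
      ∫⁻ x in C ω, extendW ι φ (elt x • S) ∂(duFactor n K • dhFree μ n) := by
    intro ω
    have h2 : Measurable fun g : P n R => φ (g • rep ω) := hφ.comp (measurable_P_smul _)
    have h5 : dh n μR = (dTN n μR).map toP := rfl
    rw [h5, lintegral_map h2 measurable_toP,
      ← (measurePreserving_mulTN_factor hn3 (z ω) hμ).setLIntegral_comp_emb
        (mulRightTN hn3 (z ω)).measurableEmbedding, ← hr.lintegral_eq]
    refine lintegral_congr fun t => ?_
    change _ = extendW ι φ (elt (mulTN (mapTN ι t) (z ω)) • S)
    rw [hCsmul, extendW_mapW h]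
  simp only [h1]
  rw [← lintegral_iUnion hCmeas hdisj, ← lintegral_indicator (MeasurableSet.iUnion hCmeas)]
  refine lintegral_congr fun x => ?_
  by_cases hx : extendW ι φ (elt x • S) = 0
  · rw [hx]
    exact Set.indicator_apply_eq_zero.mpr fun _ => hx
  · refine Set.indicator_of_mem ?_ _
    -- The support of the extended function lies in the union of the cosets.
    obtain ⟨B, hB⟩ := exists_of_extendW_ne_zero hx
    have hinv : inv B.1 = monicPoly a := by
      refine Polynomial.map_injective ι hι.injective ?_
      rw [← inv_mapW, hB, inv_smul, hS, inv_sec, monicPoly_map]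
    let B' : fiber₀ (n := n) (monicPoly a) := ⟨B, hinv⟩
    let ω : Orbits₀ n (monicPoly a) := Quotient.mk _ B'
    obtain ⟨g, hg⟩ := MulAction.orbitRel_apply.mp
      ((MulAction.orbitRel (P n R) _).symm (Quotient.exact (Quotient.out_eq ω)))
    have hg' : g • rep ω = B := congrArg Subtype.val hg
    obtain ⟨t, ht⟩ := exists_mapTN_mulTN hn3 hslice (hz ω) hB hg'
    exact Set.mem_iUnion.mpr ⟨ω, _, ⟨t, rfl⟩, ht.symm⟩

end OrbitSum


/-! ### The discriminant -/

section SquareFactor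

variable {n : ℕ}

/-- If an entry of `B` on the line `i + j = n` vanishes, then `𝒜B` is block triangular; its first
and last diagonal blocks are exchanged by the reflection in the anti-diagonal, so that `inv B` has
a square factor. -/
lemma exists_sq_dvd_inv {R : Type*} [CommRing R] [Nontrivial R] {z : Fin (n / 2) → R}
    {y : NIndex n ⊕ Fin n → R} {k : Fin (n / 2)} (hz : z k = 0) :
    ∃ c : R[X], c.Monic ∧ 0 < c.natDegree ∧ c * c ∣ inv (mat z y).1 := by
  have hk := k.2
  set B := (mat z y).1 with hB
  have hzero : ∀ a b : Fin n, (a : ℕ) + b + 2 ≤ n →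
      (a : ℕ) + b + 2 = n → ((a : ℕ) = k ∨ (b : ℕ) = k) → B.1 a b = 0 := by
    intro a b _ h2 h3
    rcases h3 with h3 | h3
    · rw [hB, mat_apply_inl z y k h3 (by omega), hz]
    · rw [hB, mat_symm, mat_apply_inl z y k h3 (by omega), hz]
  -- The blocks consist of the first `k + 1`, the middle, and the last `k + 1` indices.
  let bl : Fin n → ℕ := fun i => if (i : ℕ) < k + 1 then 0 else if (i : ℕ) < n - k - 1 then 1 else 2
  have hbl0 : ∀ i, bl i = 0 ↔ (i : ℕ) < k + 1 := fun i => by simp only [bl]; split_ifs <;> simp_all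
  have hbl2 : ∀ i, bl i = 2 ↔ n - k - 1 ≤ (i : ℕ) := fun i => by
    simp only [bl]; split_ifs <;> simp <;> omega
  set M := -(antiDiag n R * B.1) with hM
  have hMa : ∀ i j, M i j = - B.1 i.rev j := fun i j => by
    rw [hM, Matrix.neg_apply, ← adj_apply, adj]
  have htri : M.BlockTriangular bl := by
    intro i j hij
    have hr := Fin.val_rev i
    have h1 : (i.rev : ℕ) + j + 2 ≤ n ∧
        ((i.rev : ℕ) + j + 2 = n → (i.rev : ℕ) = k ∨ (j : ℕ) = k) := by
      simp only [bl] at hij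
      split_ifs at hij <;> omega
    rw [hMa, neg_eq_zero]
    rcases h1.1.lt_or_eq with h2 | h2
    · exact (mat z y).2 _ _ (by omega)
    · exact hzero _ _ h1.1 h2 (h1.2 h2)
  let e : {i // bl i = 0} ≃ {i // bl i = 2} :=
    { toFun := fun i => ⟨i.1.rev, (hbl2 _).mpr (by
        have := (hbl0 _).mp i.2; rw [Fin.val_rev]; omega)⟩
      invFun := fun i => ⟨i.1.rev, (hbl0 _).mpr (by
        have := (hbl2 _).mp i.2; rw [Fin.val_rev]; omega)⟩
      left_inv := fun i => Subtype.ext (Fin.rev_rev _)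
      right_inv := fun i => Subtype.ext (Fin.rev_rev _) }
  -- By the symmetry of `B`, the last block is the transpose of the first one, up to reordering.
  have h02 : (M.toSquareBlock bl 2).charpoly = (M.toSquareBlock bl 0).charpoly := by
    rw [← Matrix.charpoly_transpose (M.toSquareBlock bl 0), ← Matrix.charpoly_reindex e]
    congr 1
    ext i j
    simp only [Matrix.reindex_apply, Matrix.submatrix_apply, Matrix.transpose_apply,
      Matrix.toSquareBlock_def, Matrix.of_apply, hMa]
    change -B.1 i.1.rev j.1 = -B.1 (j.1.rev).rev i.1.rev
    rw [Fin.rev_rev, B.2.apply]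
  refine ⟨(M.toSquareBlock bl 0).charpoly, Matrix.charpoly_monic _, ?_, ?_⟩
  · rw [Matrix.charpoly_natDegree_eq_dim]
    exact Fintype.card_pos_iff.mpr ⟨⟨⟨0, by omega⟩, (hbl0 _).mpr (by simp)⟩⟩
  · rw [inv_eq_charpoly, ← hM, htri.charpoly]
    have hsub : ({0, 2} : Finset ℕ) ⊆ Finset.image bl Finset.univ := by
      intro a ha
      rw [Finset.mem_insert, Finset.mem_singleton] at ha
      rw [Finset.mem_image]
      rcases ha with rfl | rfl
      · exact ⟨⟨0, by omega⟩, Finset.mem_univ _, (hbl0 _).mpr (by simp)⟩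
      · exact ⟨⟨n - 1, by omega⟩, Finset.mem_univ _, (hbl2 _).mpr (by simp only; omega)⟩
    refine dvd_trans (dvd_of_eq ?_) (Finset.prod_dvd_prod_of_subset _ _ _ hsub)
    rw [Finset.prod_pair (by norm_num), h02]

end SquareFactor

section Discriminant

variable {n : ℕ}

lemma monicPoly_monic {R : Type*} [CommRing R] [Nontrivial R] (a : Fin n → R) :
    (monicPoly a).Monic ∧ (monicPoly a).natDegree = n := by
  obtain ⟨d, hd⟩ : ∃ d : R[X], d = ∑ i : Fin n, C (a i) * X ^ (i : ℕ) := ⟨_, rfl⟩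
  have h : d.degree < n := by
    rw [hd]
    exact (degree_sum_le _ _).trans_lt ((Finset.sup_lt_iff (WithBot.bot_lt_coe n)).mpr fun i _ =>
      (degree_C_mul_X_pow_le _ _).trans_lt (WithBot.coe_lt_coe.mpr i.2))
  unfold monicPoly
  rw [← hd]
  exact ⟨monic_X_pow_add h, natDegree_eq_of_degree_eq_some (by
    rw [degree_add_eq_left_of_degree_lt (by rwa [degree_X_pow]), degree_X_pow])⟩

/-- The derivative has degree exactly `n - 1` in characteristic zero, so that the formal degrees of
the resultant are the true ones. -/
lemma resultant_derivative_ne_zero_iff {F : Type*} [Field F] [CharZero F] {f : F[X]} (hf : f ≠ 0)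
    (hd : f.natDegree = n) : resultant f f.derivative n (n - 1) ≠ 0 ↔ f.Separable := by
  subst hd
  rw [← natDegree_derivative, Ne, resultant_eq_zero_iff, Separable]
  simp [hf]

/-- Over a subring of a field of characteristic zero, nonvanishing of the discriminant means
separability. -/
lemma discr_monicPoly_ne_zero_iff (hn : 0 < n) {R K : Type*} [CommRing R] [Field K] [CharZero K]
    {ι : R →+* K} (hι : Function.Injective ι) (a : Fin n → R) :
    (monicPoly a).discr ≠ 0 ↔ ((monicPoly a).map ι).Separable := by
  have : Nontrivial R := ⟨1, 0, fun h => one_ne_zero (α := K) (by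
    rw [← map_one ι, h, map_zero])⟩
  obtain ⟨hm, hd⟩ := monicPoly_monic a
  have h1 := resultant_deriv (f := monicPoly a) (natDegree_pos_iff_degree_pos.mp (by omega))
  rw [hm.leadingCoeff, mul_one] at h1
  have h2 : (monicPoly a).discr = 0 ↔
      resultant (monicPoly a) (monicPoly a).derivative (monicPoly a).natDegree
        ((monicPoly a).natDegree - 1) = 0 := by
    rw [h1]
    exact ⟨fun h => by rw [h, mul_zero], fun h =>
      ((isUnit_one.neg.pow _).mul_right_eq_zero).mp h⟩
  rw [Ne, h2, ← map_eq_zero_iff ι hι, ← resultant_map_map, ← derivative_map, hd]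
  exact resultant_derivative_ne_zero_iff (hm.map ι).ne_zero (by rw [hm.natDegree_map, hd])

/-- If the discriminant is nonzero, the fibre lies, over the field, in the orbit of `sec`: the
entries on the line `i + j = n` are nonzero since the invariant polynomial is squarefree. -/
lemma exists_elt_smul_sec_eq (hn3 : 3 ≤ n) {R K : Type*} [CommRing R] [NontriviallyNormedField K]
    [CharZero K] [MeasurableSpace K] [BorelSpace K] [ProperSpace K] {ι : R →+* K}
    (hι : Function.Injective ι) {a : Fin n → R} (ha : (monicPoly a).discr ≠ 0) (B : W₀ n R)
    (hB : inv B.1 = monicPoly a) :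
    ∃ z : (Fin (n / 2) → Kˣ) × N n K, mapW ι B.1 = elt z • (sec fun i => ι (a i)).1 := by
  obtain ⟨z, y, hzy⟩ := exists_mat_eq (mapW₀ ι B)
  have hz : ∀ k, z k ≠ 0 := by
    intro k hk
    obtain ⟨c, hc, hc0, hdvd⟩ := exists_sq_dvd_inv (y := y) hk
    rw [← hzy] at hdvd
    change c * c ∣ inv (mapW ι B.1) at hdvd
    rw [inv_mapW, hB] at hdvd
    have h := ((discr_monicPoly_ne_zero_iff (by omega) hι a).mp ha).squarefree c hdvd
    rw [hc.isUnit_iff] at h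
    rw [h, natDegree_one] at hc0
    exact hc0.false
  let u : Fin (n / 2) → Kˣ := fun k => Units.mk0 (z k) (hz k)
  have hzy' : mapW₀ ι B = mat (fun k => (u k : K)) y := hzy
  obtain ⟨x, hx⟩ := exists_elt_smul_eq hn3 (isSlice_sec fun i => ι (a i))
    u y (by
      rw [← hzy', inv_sec, ← monicPoly_map, ← hB, ← inv_mapW]
      rfl)
  exact ⟨x, by rw [hx, ← hzy']; rfl⟩

end Discriminant

section Null

variable {n : ℕ} {R K : Type*} [NormedCommRing R] [CompleteSpace R] [SecondCountableTopology R]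
  [MeasurableSpace R] [BorelSpace R]
  [NontriviallyNormedField K] [CharZero K] [MeasurableSpace K] [BorelSpace K] [ProperSpace K]
  {ι : R →+* K} {μR : Measure R} [SigmaFinite μR] {μ : Measure K} [μ.IsAddHaarMeasure]

lemma continuous_resultant_monicPoly :
    Continuous fun a : Fin n → R => resultant (monicPoly a) (monicPoly a).derivative n (n - 1) := by
  have h1 : ∀ k, Continuous fun a : Fin n → R => (monicPoly a).coeff k := by
    intro k
    simp only [monicPoly, coeff_add, finsetSum_coeff, coeff_C_mul]
    exact continuous_const.add (continuous_finsetSum _ fun i _ =>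
      (continuous_apply i).mul continuous_const)
  refine Continuous.matrix_det (continuous_matrix fun i j => ?_)
  induction j using Fin.addCases with
  | left j =>
    simp only [sylvester, Matrix.of_apply, Fin.addCases_left, coeff_derivative]
    split_ifs
    · exact (h1 _).mul continuous_const
    · exact continuous_const
  | right j =>
    simp only [sylvester, Matrix.of_apply, Fin.addCases_right]
    split_ifs
    · exact h1 _
    · exact continuous_const

/-- The excluded constants are the values `-f x` at the roots `x` of the derivative of `f`. -/
lemma finite_not_separable_add_C {F : Type*} [Field F] [CharZero F] {f : F[X]}
    (hf : 0 < f.natDegree) : {c : F | ¬ (f + C c).Separable}.Finite := by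
  have hd : f.derivative ≠ 0 := fun h => by
    have := derivative_eq_zero.mp h
    omega
  let L := AlgebraicClosure F
  have hfin : ((fun x : L => -aeval x f) '' {x : L | aeval x f.derivative = 0}).Finite := by
    refine Set.Finite.image _ ?_
    classical
    refine ((f.derivative.aroots L).toFinset.finite_toSet).subset fun x hx => ?_
    rw [Finset.mem_coe, Multiset.mem_toFinset, mem_aroots]
    exact ⟨hd, hx⟩
  refine (hfin.preimage (f := algebraMap F L)
    (algebraMap F L).injective.injOn).subset fun c hc => ?_
  rw [Set.mem_ofPred_eq, separable_def,
    isCoprime_iff_aeval_ne_zero_of_isAlgClosed F L] at hc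
  push Not at hc
  obtain ⟨x, h1, h2⟩ := hc
  rw [derivative_add, derivative_C, add_zero] at h2
  refine ⟨x, h2, ?_⟩
  rw [map_add, aeval_C] at h1
  exact neg_eq_of_add_eq_zero_right h1

variable (μ) in
/-- The polynomials with discriminant zero form a null set: for fixed higher coefficients only
finitely many constant terms are excluded. -/
lemma ae_separable (hn : 0 < n) :
    ∀ᵐ a ∂(Measure.pi fun _ : Fin n => μ), (monicPoly a).Separable := by
  have hiff : ∀ a : Fin n → K, (monicPoly a).Separable ↔
      resultant (monicPoly a) (monicPoly a).derivative n (n - 1) ≠ 0 := by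
    intro a
    obtain ⟨hm, hd⟩ := monicPoly_monic a
    exact (resultant_derivative_ne_zero_iff hm.ne_zero hd).symm
  obtain ⟨m, rfl⟩ : ∃ m, n = m + 1 := ⟨n - 1, by omega⟩
  have hmeas : MeasurableSet {a : Fin (m + 1) → K | ¬ (monicPoly a).Separable} := by
    simp only [hiff, not_not]
    exact (isClosed_singleton.preimage continuous_resultant_monicPoly).measurableSet
  have hmp := (measurePreserving_piFinSuccAbove (fun _ : Fin (m + 1) => μ) 0).symm
  rw [ae_iff, ← hmp.measure_preimage hmeas.nullMeasurableSet,
    Measure.prod_apply_symm (hmp.measurable hmeas), lintegral_eq_zero_of_ae_eq_zero]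
  refine Filter.Eventually.of_forall fun y => ?_
  let f : K[X] := monicPoly (Fin.cons 0 y : Fin (m + 1) → K)
  have hf : 0 < f.natDegree := by
    rw [(monicPoly_monic (Fin.cons 0 y : Fin (m + 1) → K)).2]; omega
  refine ((finite_not_separable_add_C hf).subset fun c hc => ?_).measure_zero μ
  have h1 : monicPoly (Fin.cons c y : Fin (m + 1) → K) = f + C c := by
    simp only [f, monicPoly, Fin.sum_univ_succ, Fin.cons_zero, Fin.cons_succ]
    simp only [Fin.val_zero, pow_zero, mul_one, C_0, zero_add]
    ring
  have h2 : (MeasurableEquiv.piFinSuccAbove (fun _ : Fin (m + 1) => K) 0).symm (c, y) =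
      Fin.cons c y := by
    rw [MeasurableEquiv.piFinSuccAbove_symm_apply]
    exact Fin.insertNth_zero' c y
  rw [Set.mem_ofPred_eq, ← h1, ← h2]
  exact hc

end Null


section Restriction

variable {X Y : Type*} [MeasurableSpace X] [MeasurableSpace Y]

lemma IsRestriction.lintegral_eq_of_forall_mem {e : X → Y} {μ : Measure X} {ν : Measure Y}
    (h : IsRestriction e μ ν) {f : Y → ℝ≥0∞} (hf : ∀ y, f y ≠ 0 → y ∈ Set.range e) :
    ∫⁻ x, f (e x) ∂μ = ∫⁻ y, f y ∂ν := by
  rw [h.lintegral_eq, ← lintegral_indicator h.emb.measurableSet_range,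
    Set.indicator_eq_self.mpr fun y hy => hf y hy]

lemma IsRestriction.ae {e : X → Y} {μ : Measure X} {ν : Measure Y}
    (h : IsRestriction e μ ν) {p : Y → Prop} (hp : ∀ᵐ y ∂ν, p y) : ∀ᵐ x ∂μ, p (e x) := by
  rw [← h.emb.ae_map_iff, h.map_eq]
  exact ae_restrict_of_ae hp

end Restriction

/-! ### The change of variables over the ring -/

section ChangeOfVariables

variable {n : ℕ} {R K : Type*} [NormedCommRing R] [CompleteSpace R] [SecondCountableTopology R]
  [MeasurableSpace R] [BorelSpace R]
  [NontriviallyNormedField K] [CharZero K] [MeasurableSpace K] [BorelSpace K] [ProperSpace K]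
  {ι : R →+* K} {μR : Measure R} [SigmaFinite μR] {μ : Measure K} [μ.IsAddHaarMeasure]

/-- The formula over the field, applied to the extension by zero. Both outer integrals restrict to
the ring: an element of `W(K)` that comes from `W(R)` has its coordinates and the coefficients of
its invariant polynomial in `R`. -/
lemma lintegral_dB_eq_lintegral_df (hn3 : 3 ≤ n) (h : IsRestriction ι μR μ)
    (hnorm : ∀ x, ‖ι x‖ = ‖x‖)
    (hμ : ∀ c : K, c ≠ 0 → μ.map (c * ·) = ENNReal.ofReal ‖c‖⁻¹ • μ)
    {φ : W₀ n R → ℝ≥0∞} (hφ : Measurable φ) :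
    ∫⁻ B, φ B * ‖lam B‖ₑ ∂(dB n μR) = ENNReal.ofReal (‖(2 : K)‖⁻¹ ^ (n / 2)) *
      ∫⁻ a, ∫⁻ z, extendW ι φ (elt z • (sec fun i => ι (a i)).1) ∂(dhFree μ n) ∂(df n μR) := by
  have hF := measurable_extendW h hφ
  have hm : Measurable fun B : W₀ n R => φ B * ‖lam B‖ₑ := hφ.mul measurable_lam.enorm
  rw [dB, lintegral_map hm measurable_W₀ofCoord]
  have h1 : ∀ x : W₀Index n → R, φ (W₀ofCoord x) * ‖lam (W₀ofCoord x)‖ₑ =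
      extendW ι φ (W₀ofCoord fun t => ι (x t)).1 * ‖lam (W₀ofCoord fun t => ι (x t))‖ₑ := by
    intro x
    rw [← mapW₀_W₀ofCoord, lam_mapW₀, ← ofReal_norm (ι _), hnorm, ofReal_norm]
    congr 1
    exact (extendW_mapW h φ _).symm
  rw [lintegral_congr h1, h.pi.lintegral_eq_of_forall_mem
    (f := fun y => extendW ι φ (W₀ofCoord y).1 * ‖lam (W₀ofCoord y)‖ₑ), lintegral_W₀_eq μ hn3 hμ hF]
  · congr 1
    refine (h.pi.lintegral_eq_of_forall_mem (f := fun a => ∫⁻ z,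
      extendW ι φ (elt z • (sec a).1) ∂(dhFree μ n)) fun a ha => ?_).symm
    obtain ⟨z, hz⟩ : ∃ z, extendW ι φ (elt z • (sec a).1) ≠ 0 := by
      by_contra! hc
      exact ha ((lintegral_congr hc).trans lintegral_zero)
    obtain ⟨B, hB⟩ := exists_of_extendW_ne_zero hz
    have h2 : (inv B.1).map ι = monicPoly a := by rw [← inv_mapW, hB, inv_smul, inv_sec]
    exact ⟨fun k => (inv B.1).coeff k, funext fun k => by
      rw [← monicPoly_coeff a k, ← h2, coeff_map]⟩
  · intro y hy
    obtain ⟨B, hB⟩ := exists_of_extendW_ne_zero (left_ne_zero_of_mul hy)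
    refine ⟨fun t => B.1.1 t.1.1 t.1.2, funext fun t => ?_⟩
    change (mapW ι B.1).1 t.1.1 t.1.2 = y t
    rw [hB]
    simp only [W₀ofCoord, Matrix.of_apply]
    rw [dif_pos t.2.2]
    congr 1
    exact Subtype.ext (Prod.ext (min_eq_left t.2.1) (max_eq_right t.2.1))

lemma ae_discr_ne_zero (hn : 0 < n) (h : IsRestriction ι μR μ) :
    ∀ᵐ a ∂(df n μR), (monicPoly a).discr ≠ 0 := by
  filter_upwards [(h.pi (ι := Fin n)).ae (ae_separable μ hn)] with a ha
  rwa [discr_monicPoly_ne_zero_iff hn h.emb.injective, monicPoly_map]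

lemma restrict_discr_ne_zero (hn : 0 < n) (h : IsRestriction ι μR μ) :
    (df n μR).restrict {a | (monicPoly a).discr ≠ 0} = df n μR :=
  Measure.restrict_eq_self_of_ae_mem (ae_discr_ne_zero hn h)

lemma measurable_lintegral_extendW (h : IsRestriction ι μR μ) {φ : W₀ n R → ℝ≥0∞}
    (hφ : Measurable φ) : Measurable fun a : Fin n → R =>
      ∫⁻ z, extendW ι φ (elt z • (sec fun i => ι (a i)).1) ∂(dhFree μ n) := by
  have h1 : Measurable fun a : Fin n → R => fun i => ι (a i) :=
    measurable_pi_lambda _ fun i => h.emb.measurable.comp (measurable_pi_apply i)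
  have h2 : Measurable fun a : Fin n → K =>
      ∫⁻ z, extendW ι φ (elt z • (sec a).1) ∂(dhFree μ n) := by
    refine Measurable.lintegral_prod_right' (f := fun x : (Fin n → K) × _ =>
      extendW ι φ (elt x.2 • (sec x.1).1)) ?_
    exact (measurable_extendW h hφ).comp (measurable_torus_unip_smul
      (x := fun x : (Fin n → K) × _ => x.2) measurable_snd (measurable_sec.comp measurable_fst))
  exact h2.comp h1

lemma ae_tsum_orbits_eq (hn3 : 3 ≤ n) (hι : Topology.IsOpenEmbedding ι)
    (h : IsRestriction ι μR μ) (hnorm : ∀ x, ‖ι x‖ = ‖x‖)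
    (hμ : ∀ c : K, c ≠ 0 → μ.map (c * ·) = ENNReal.ofReal ‖c‖⁻¹ • μ)
    {φ : W₀ n R → ℝ≥0∞} (hφ : Measurable φ) :
    (fun a => ∑' ω : Orbits₀ n (monicPoly a), ∫⁻ g, φ (g • rep ω) ∂(dh n μR)) =ᵐ[df n μR]
      fun a => duFactor n K *
        ∫⁻ z, extendW ι φ (elt z • (sec fun i => ι (a i)).1) ∂(dhFree μ n) := by
  filter_upwards [ae_discr_ne_zero (by omega) h] with a ha
  rw [tsum_orbits_eq hn3 hι h hnorm hμ (exists_elt_smul_sec_eq hn3 hι.injective ha) hφ,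
    lintegral_smul_measure, smul_eq_mul]

/-- The change of variables for measurable functions; `κ` is the constant that remains after the
normalization of the measure on `N` is taken into account. -/
lemma aemeasurable_tsum_and_lintegral_dB_eq (hn3 : 3 ≤ n) (hι : Topology.IsOpenEmbedding ι)
    (h : IsRestriction ι μR μ) (hnorm : ∀ x, ‖ι x‖ = ‖x‖)
    (hμ : ∀ c : K, c ≠ 0 → μ.map (c * ·) = ENNReal.ofReal ‖c‖⁻¹ • μ)
    {κ : ℝ≥0} (hκ : ENNReal.ofReal (‖(2 : K)‖⁻¹ ^ (n / 2)) = κ * duFactor n K)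
    {φ : W₀ n R → ℝ≥0∞} (hφ : Measurable φ) :
    AEMeasurable (fun a => ∑' ω : Orbits₀ n (monicPoly a), ∫⁻ g, φ (g • rep ω) ∂(dh n μR))
      (df n μR) ∧
    ∫⁻ B, φ B * ‖lam B‖ₑ ∂(dB n μR) = κ * ∫⁻ a,
      (∑' ω : Orbits₀ n (monicPoly a), ∫⁻ g, φ (g • rep ω) ∂(dh n μR)) ∂(df n μR) := by
  have h1 := ae_tsum_orbits_eq hn3 hι h hnorm hμ hφ
  have h2 := measurable_lintegral_extendW h hφ
  refine ⟨⟨_, h2.const_mul _, h1⟩, ?_⟩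
  rw [lintegral_congr_ae h1, lintegral_const_mul _ h2,
    lintegral_dB_eq_lintegral_df hn3 h hnorm hμ hφ, hκ, mul_assoc]

end ChangeOfVariables

/-! ### Almost everywhere measurable and real-valued functions -/

section Completion

variable {n : ℕ} {R : Type*} [NormedCommRing R] [CompleteSpace R] [SecondCountableTopology R]
  [MeasurableSpace R] [BorelSpace R] {μR : Measure R} {κ : ℝ≥0}

/-- The change of variables for measurable functions with values in `[0, ∞]`. -/
def MeasurableChangeOfVariables (n : ℕ) (μR : Measure R) (κ : ℝ≥0) : Prop :=
  ∀ φ : W₀ n R → ℝ≥0∞, Measurable φ →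
    AEMeasurable (fun a => ∑' ω : Orbits₀ n (monicPoly a), ∫⁻ g, φ (g • rep ω) ∂(dh n μR))
      (df n μR) ∧
    ∫⁻ B, φ B * ‖lam B‖ₑ ∂(dB n μR) = κ * ∫⁻ a,
      (∑' ω : Orbits₀ n (monicPoly a), ∫⁻ g, φ (g • rep ω) ∂(dh n μR)) ∂(df n μR)

/-- Functions that agree almost everywhere on `W₀` agree almost everywhere on almost all orbits. -/
lemma MeasurableChangeOfVariables.ae_orbits (H : MeasurableChangeOfVariables n μR κ) (hκ : κ ≠ 0)
    {Z : Type*} {φ ψ : W₀ n R → Z} (hφψ : φ =ᵐ[dB n μR] ψ) :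
    ∀ᵐ a ∂(df n μR), ∀ ω : Orbits₀ n (monicPoly a),
      (fun g => φ (g • rep ω)) =ᵐ[dh n μR] fun g => ψ (g • rep ω) := by
  obtain ⟨E, hE, hEm, hE0⟩ := exists_measurable_superset_of_null (ae_iff.mp hφψ)
  -- The change of variables for the indicator function of an exceptional null set.
  obtain ⟨h1, h2⟩ := H (E.indicator 1) (measurable_one.indicator hEm)
  have h3 : ∫⁻ B, E.indicator 1 B * ‖lam B‖ₑ ∂(dB n μR) = 0 := by
    refine lintegral_eq_zero_of_ae_eq_zero ?_
    filter_upwards [compl_mem_ae_iff.mpr hE0] with B hB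
    rw [Set.indicator_of_notMem hB, zero_mul]
    rfl
  rw [h3, eq_comm, mul_eq_zero, or_iff_right (by exact_mod_cast hκ), lintegral_eq_zero_iff' h1]
    at h2
  filter_upwards [h2] with a ha ω
  have h4 := ENNReal.tsum_eq_zero.mp ha ω
  have hm : Measurable fun g : P n R => E.indicator (1 : W₀ n R → ℝ≥0∞) (g • rep ω) :=
    (measurable_one.indicator hEm).comp (measurable_P_smul _)
  rw [lintegral_eq_zero_iff hm] at h4
  filter_upwards [h4] with g hg
  by_contra hne
  have h5 : g • rep ω ∈ E := hE hne
  rw [Set.indicator_of_mem h5] at hg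
  exact one_ne_zero hg

/-- Passage from measurable functions to those that are only almost everywhere measurable. -/
lemma MeasurableChangeOfVariables.lintegral (H : MeasurableChangeOfVariables n μR κ) (hκ : κ ≠ 0)
    {φ : W₀ n R → ℝ≥0∞} (hφ : AEMeasurable φ (dB n μR)) :
    ∫⁻ B, φ B * ‖lam B‖ₑ ∂(dB n μR) = κ * ∫⁻ a,
      (∑' ω : Orbits₀ n (monicPoly a), ∫⁻ g, φ (g • rep ω) ∂(dh n μR)) ∂(df n μR) := by
  have h1 : ∫⁻ B, φ B * ‖lam B‖ₑ ∂(dB n μR) = ∫⁻ B, hφ.mk φ B * ‖lam B‖ₑ ∂(dB n μR) :=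
    lintegral_congr_ae (hφ.ae_eq_mk.mono fun B hB => by simp only [hB])
  rw [h1, (H _ hφ.measurable_mk).2]
  congr 1
  refine lintegral_congr_ae ?_
  filter_upwards [H.ae_orbits hκ hφ.ae_eq_mk] with a ha
  exact tsum_congr fun ω => (lintegral_congr_ae (ha ω)).symm

/-- Passage to absolutely integrable real-valued functions, by the positive and negative parts. -/
lemma MeasurableChangeOfVariables.integral (H : MeasurableChangeOfVariables n μR κ) (hκ : κ ≠ 0)
    {φ : W₀ n R → ℝ} (hφ : AEMeasurable φ (dB n μR))
    (hint : Integrable (fun B => φ B * ‖lam B‖) (dB n μR)) :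
    (∀ᵐ a ∂(df n μR),
      (∀ ω : Orbits₀ n (monicPoly a), Integrable (fun g => φ (g • rep ω)) (dh n μR)) ∧
      Summable fun ω : Orbits₀ n (monicPoly a) => ∫ g, φ (g • rep ω) ∂(dh n μR)) ∧
    Integrable (fun a => ∑' ω : Orbits₀ n (monicPoly a), ∫ g, φ (g • rep ω) ∂(dh n μR))
      (df n μR) ∧
    ∫ B, φ B * ‖lam B‖ ∂(dB n μR) = κ * ∫ a,
      (∑' ω : Orbits₀ n (monicPoly a), ∫ g, φ (g • rep ω) ∂(dh n μR)) ∂(df n μR) := by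
  have hmax : ∀ x : ℝ, ENNReal.ofReal (max x 0) = ENNReal.ofReal x := fun x => by
    rw [ENNReal.ofReal_max, ENNReal.ofReal_zero, max_eq_left zero_le]
  set ψ := hφ.mk φ with hψ
  have hψm : Measurable ψ := hφ.measurable_mk
  -- `S ψ` and `S (-ψ)` are the orbit integrals of the positive and negative parts of `ψ`, since
  -- `ENNReal.ofReal` is zero on negative numbers.
  let S : (W₀ n R → ℝ) → (Fin n → R) → ℝ≥0∞ := fun χ a =>
    ∑' ω : Orbits₀ n (monicPoly a), ∫⁻ g, ENNReal.ofReal (χ (g • rep ω)) ∂(dh n μR)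
  have hpart : ∀ χ : W₀ n R → ℝ, (χ = ψ ∨ χ = -ψ) → AEMeasurable (S χ) (df n μR) ∧
      ∫⁻ a, S χ a ∂(df n μR) ≠ ⊤ ∧
      (∫⁻ B, ENNReal.ofReal (χ B * ‖lam B‖) ∂(dB n μR)) = κ * ∫⁻ a, S χ a ∂(df n μR) := by
    intro χ hχ
    have hχm : Measurable χ := by
      rcases hχ with rfl | rfl
      exacts [hψm, hψm.neg]
    obtain ⟨h1, h2⟩ := H (fun B => ENNReal.ofReal (χ B)) hχm.ennreal_ofReal
    have h3 : (∫⁻ B, ENNReal.ofReal (χ B * ‖lam B‖) ∂(dB n μR)) = κ * ∫⁻ a, S χ a ∂(df n μR) := by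
      rw [← h2]
      refine lintegral_congr fun B => ?_
      rw [ENNReal.ofReal_mul' (norm_nonneg _), ofReal_norm]
    refine ⟨h1, fun htop => ?_, h3⟩
    have h4 : (∫⁻ B, ENNReal.ofReal (χ B * ‖lam B‖) ∂(dB n μR)) ≤
        ∫⁻ B, ‖φ B * ‖lam B‖‖ₑ ∂(dB n μR) := by
      refine lintegral_mono_ae ?_
      filter_upwards [hφ.ae_eq_mk] with B hB
      rw [← ofReal_norm, hB]
      refine ENNReal.ofReal_le_ofReal ?_
      rw [norm_mul, norm_norm]
      refine mul_le_mul_of_nonneg_right ?_ (norm_nonneg _)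
      rcases hχ with rfl | rfl
      exacts [Real.le_norm_self _, neg_le_abs _]
    rw [h3, htop, ENNReal.mul_top (by exact_mod_cast hκ)] at h4
    exact (hint.hasFiniteIntegral.trans_le (le_top.trans h4)).false
  obtain ⟨hp1, hp2, hp3⟩ := hpart ψ (.inl rfl)
  obtain ⟨hq1, hq2, hq3⟩ := hpart (-ψ) (.inr rfl)
  have hae : ∀ᵐ a ∂(df n μR),
      ((∀ ω : Orbits₀ n (monicPoly a), Integrable (fun g => φ (g • rep ω)) (dh n μR)) ∧
      Summable fun ω : Orbits₀ n (monicPoly a) => ∫ g, φ (g • rep ω) ∂(dh n μR)) ∧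
      ∑' ω : Orbits₀ n (monicPoly a), ∫ g, φ (g • rep ω) ∂(dh n μR) =
        (S ψ a).toReal - (S (-ψ) a).toReal := by
    filter_upwards [H.ae_orbits hκ hφ.ae_eq_mk, ae_lt_top' hp1 hp2, ae_lt_top' hq1 hq2]
      with a ha hpa hqa
    have hmeas : ∀ ω : Orbits₀ n (monicPoly a), Measurable fun g => ψ (g • rep ω) := fun ω =>
      hψm.comp (measurable_P_smul _)
    have hP : ∀ ω : Orbits₀ n (monicPoly a),
        ∫⁻ g, ENNReal.ofReal (ψ (g • rep ω)) ∂(dh n μR) ≠ ⊤ := ENNReal.ne_top_of_tsum_ne_top hpa.ne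
    have hQ : ∀ ω : Orbits₀ n (monicPoly a),
        ∫⁻ g, ENNReal.ofReal ((-ψ) (g • rep ω)) ∂(dh n μR) ≠ ⊤ :=
      ENNReal.ne_top_of_tsum_ne_top hqa.ne
    have hi : ∀ ω : Orbits₀ n (monicPoly a), Integrable (fun g => ψ (g • rep ω)) (dh n μR) := by
      intro ω
      have h1 : Integrable (fun g => max (ψ (g • rep ω)) 0) (dh n μR) := by
        refine (lintegral_ofReal_ne_top_iff_integrable
          ((hmeas ω).max measurable_const).aestronglyMeasurable
          (Filter.Eventually.of_forall fun _ => le_max_right _ _)).mp ?_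
        exact ne_of_eq_of_ne (lintegral_congr fun g => hmax _) (hP ω)
      have h2 : Integrable (fun g => max (-ψ (g • rep ω)) 0) (dh n μR) := by
        refine (lintegral_ofReal_ne_top_iff_integrable
          ((hmeas ω).neg.max measurable_const).aestronglyMeasurable
          (Filter.Eventually.of_forall fun _ => le_max_right _ _)).mp ?_
        exact ne_of_eq_of_ne (lintegral_congr fun g => hmax _) (hQ ω)
      refine (h1.sub h2).congr (Filter.Eventually.of_forall fun g => ?_)
      exact posPart_sub_negPart (ψ (g • rep ω))
    have hval : ∀ ω : Orbits₀ n (monicPoly a), ∫ g, φ (g • rep ω) ∂(dh n μR) =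
        (∫⁻ g, ENNReal.ofReal (ψ (g • rep ω)) ∂(dh n μR)).toReal -
          (∫⁻ g, ENNReal.ofReal ((-ψ) (g • rep ω)) ∂(dh n μR)).toReal := fun ω => by
      rw [integral_congr_ae (ha ω), integral_eq_lintegral_pos_part_sub_lintegral_neg_part (hi ω)]
      rfl
    have hs1 := ENNReal.summable_toReal hpa.ne
    have hs2 := ENNReal.summable_toReal hqa.ne
    refine ⟨⟨fun ω => (hi ω).congr (ha ω).symm, ?_⟩, ?_⟩
    · simp only [hval]
      exact hs1.sub hs2
    · simp only [hval]
      rw [hs1.tsum_sub hs2, ENNReal.tsum_toReal_eq hP, ENNReal.tsum_toReal_eq hQ]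
  have hip := integrable_toReal_of_lintegral_ne_top hp1 hp2
  have hiq := integrable_toReal_of_lintegral_ne_top hq1 hq2
  refine ⟨hae.mono fun a ha => ha.1, (hip.sub hiq).congr (hae.mono fun a ha => ha.2.symm), ?_⟩
  have hint' : Integrable (fun B => ψ B * ‖lam B‖) (dB n μR) :=
    hint.congr (hφ.ae_eq_mk.mono fun B hB => by simp only [hB, hψ])
  have h1 : ∫ B, φ B * ‖lam B‖ ∂(dB n μR) = ∫ B, ψ B * ‖lam B‖ ∂(dB n μR) :=
    integral_congr_ae (hφ.ae_eq_mk.mono fun B hB => by simp only [hB, hψ])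
  have h2 : ∀ B, -(ψ B * ‖lam B‖) = (-ψ) B * ‖lam B‖ := fun B => (neg_mul _ _).symm
  rw [h1, integral_eq_lintegral_pos_part_sub_lintegral_neg_part hint']
  simp only [h2]
  rw [hp3, hq3, integral_congr_ae (hae.mono fun a ha => ha.2), integral_sub hip hiq,
    integral_toReal hp1 (ae_lt_top' hp1 hp2), integral_toReal hq1 (ae_lt_top' hq1 hq2),
    ENNReal.toReal_mul, ENNReal.toReal_mul, mul_sub]
  rfl

end Completion

section Assembly

variable {n : ℕ} {R K : Type*} [NormedCommRing R] [CompleteSpace R] [SecondCountableTopology R]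
  [MeasurableSpace R] [BorelSpace R]
  [NontriviallyNormedField K] [CharZero K] [MeasurableSpace K] [BorelSpace K] [ProperSpace K]
  {ι : R →+* K} {μR : Measure R} [SigmaFinite μR] {μ : Measure K} [μ.IsAddHaarMeasure]

/-- The change of variables for a ring `R` with an isometric open embedding into a field `K`. The
constant `κ` accounts for the Jacobian `|2|^{-⌊n/2⌋}` and the normalization of `du`. -/
theorem changeOfVariables_of_isRestriction (hn3 : 3 ≤ n) (hι : Topology.IsOpenEmbedding ι)
    (h : IsRestriction ι μR μ) (hnorm : ∀ x, ‖ι x‖ = ‖x‖)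
    (hμ : ∀ c : K, c ≠ 0 → μ.map (c * ·) = ENNReal.ofReal ‖c‖⁻¹ • μ)
    {κ : ℝ≥0} (hκ0 : κ ≠ 0)
    (hκ : ENNReal.ofReal (‖(2 : K)‖⁻¹ ^ (n / 2)) = κ * duFactor n K) :
    ChangeOfVariables n μR κ := by
  have H : MeasurableChangeOfVariables n μR κ := fun φ hφ =>
    aemeasurable_tsum_and_lintegral_dB_eq hn3 hι h hnorm hμ hκ hφ
  have hr := restrict_discr_ne_zero (n := n) (by omega) h
  unfold ChangeOfVariables IntegrableOn
  rw [hr]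
  exact ⟨fun φ hφ => H.lintegral hκ0 hφ, fun φ hφ hint => H.integral hκ0 hφ hint⟩

end Assembly


/-! ### Haar measure on the `p`-adic numbers -/

section Padic

/-- The `p`-adic numbers carry their Borel sigma-algebra. -/
noncomputable instance instMeasurableSpacePadic (p : ℕ) [Fact p.Prime] : MeasurableSpace ℚ_[p] :=
  borel ℚ_[p]

instance instBorelSpacePadic (p : ℕ) [Fact p.Prime] : BorelSpace ℚ_[p] := ⟨rfl⟩

variable {p : ℕ} [hp : Fact p.Prime] (μ : Measure ℚ_[p]) [μ.IsAddHaarMeasure]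

lemma measure_ball_pos_lt_top (r : ℝ) (hr : 0 < r) :
    μ (Metric.ball 0 r) ≠ 0 ∧ μ (Metric.ball 0 r) ≠ ⊤ :=
  ⟨(Metric.measure_ball_pos μ 0 hr).ne', Metric.isBounded_ball.measure_lt_top.ne⟩

/-- Multiplication by `c` scales Haar measure by some factor, by uniqueness of Haar measure. -/
lemma exists_map_mul_left_eq_smul {c : ℚ_[p]} (hc : c ≠ 0) :
    ∃ d : ℝ≥0∞, μ.map (c * ·) = d • μ := by
  let e := Homeomorph.mulLeft₀ c hc
  have h : (μ.map (AddMonoidHom.mulLeft c)).IsAddHaarMeasure :=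
    μ.isAddHaarMeasure_map (AddMonoidHom.mulLeft c) e.continuous e.surjective
      e.isClosedEmbedding.tendsto_cocompact
  exact ⟨_, Measure.isAddLeftInvariant_eq_smul (μ.map (AddMonoidHom.mulLeft c)) μ⟩

lemma preimage_mul_left_ball {c : ℚ_[p]} (hc : c ≠ 0) (r : ℝ) :
    (c * ·) ⁻¹' Metric.ball (0 : ℚ_[p]) r = Metric.ball 0 (‖c‖⁻¹ * r) := by
  ext x
  rw [Set.mem_preimage, mem_ball_zero_iff, mem_ball_zero_iff, norm_mul,
    lt_inv_mul_iff₀ (norm_pos_iff.mpr hc)]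

/-- The ball of radius `p` is `ℤ_p`, and the ball of radius `1` is `pℤ_p`, so that the former is the
disjoint union of `p` translates of the latter. -/
lemma measure_ball_prime : μ (Metric.ball 0 (p : ℝ)) = p * μ (Metric.ball 0 1) := by
  have h1 : Metric.ball (0 : ℚ_[p]) p = ⋃ i ∈ Finset.range p, Metric.ball (i : ℚ_[p]) 1 := by
    ext x
    simp only [Set.mem_iUnion, Finset.mem_range, Metric.mem_ball, dist_zero_right, exists_prop]
    have hx : ‖x‖ < p ↔ ‖x‖ ≤ 1 := by
      have := (Padic.norm_le_pow_iff_norm_lt_pow_add_one x 0).symm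
      simpa using this
    rw [hx]
    constructor
    · intro h
      obtain ⟨i, hi, hm⟩ := PadicInt.exists_mem_range (⟨x, h⟩ : ℤ_[p])
      refine ⟨i, hi, ?_⟩
      rw [IsLocalRing.mem_maximalIdeal, PadicInt.mem_nonunits] at hm
      rw [dist_eq_norm]
      exact hm
    · rintro ⟨i, -, hi⟩
      rw [dist_eq_norm] at hi
      have h2 := Padic.nonarchimedean (x - (i : ℚ_[p])) (i : ℚ_[p])
      rw [sub_add_cancel] at h2
      exact h2.trans (max_le hi.le (Padic.norm_int_le_one (i : ℤ)))
  have hdisj : (Finset.range p : Set ℕ).PairwiseDisjoint fun i => Metric.ball (i : ℚ_[p]) 1 := by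
    intro i hi j hj hij
    refine Set.disjoint_left.mpr fun x hx hx' => hij ?_
    rw [Metric.mem_ball, dist_eq_norm] at hx hx'
    have h2 := Padic.nonarchimedean (x - (j : ℚ_[p])) (-(x - (i : ℚ_[p])))
    rw [norm_neg] at h2
    have h3 : ‖((i - j : ℤ) : ℚ_[p])‖ < 1 := by
      have h4 : ((i - j : ℤ) : ℚ_[p]) =
          x - (j : ℚ_[p]) + -(x - (i : ℚ_[p])) := by push_cast; ring
      rw [h4]
      exact h2.trans_lt (max_lt hx' hx)
    rw [Padic.norm_intCast_lt_one_iff] at h3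
    have h5 := Nat.modEq_iff_dvd.mpr h3
    have h6 := h5.eq_of_lt_of_lt (Finset.mem_range.mp hj) (Finset.mem_range.mp hi)
    exact h6.symm
  rw [h1, measure_biUnion_finset hdisj fun _ _ => measurableSet_ball]
  have h7 : ∀ i ∈ Finset.range p, μ (Metric.ball (i : ℚ_[p]) 1) = μ (Metric.ball 0 1) := by
    intro i _
    rw [← measure_preimage_add μ (-(i : ℚ_[p])) (Metric.ball 0 1)]
    congr 1
    ext x
    rw [Set.mem_preimage, mem_ball_zero_iff, Metric.mem_ball, dist_eq_norm, neg_add_eq_sub]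
  rw [Finset.sum_congr rfl h7, Finset.sum_const, Finset.card_range, nsmul_eq_mul]

lemma measure_ball_prime_mul (r : ℝ) :
    μ (Metric.ball 0 (p * r)) = p * μ (Metric.ball 0 r) := by
  have hp0 : (p : ℚ_[p]) ≠ 0 := Nat.cast_ne_zero.mpr hp.out.ne_zero
  obtain ⟨d, hd⟩ := exists_map_mul_left_eq_smul μ hp0
  have h1 : ∀ r : ℝ, μ (Metric.ball 0 (p * r)) = d * μ (Metric.ball 0 r) := by
    intro r
    have h := congrArg (fun ν : Measure ℚ_[p] => ν (Metric.ball 0 r)) hd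
    rw [Measure.map_apply (measurable_const_mul _) measurableSet_ball, preimage_mul_left_ball hp0,
      Padic.norm_p, inv_inv] at h
    exact h
  obtain ⟨h2, h3⟩ := measure_ball_pos_lt_top μ 1 one_pos
  have h4 := h1 1
  rw [mul_one, measure_ball_prime, ENNReal.mul_left_inj h2 h3] at h4
  rw [h1, h4]

lemma measure_ball_zpow (k : ℤ) :
    μ (Metric.ball 0 ((p : ℝ) ^ k)) = ENNReal.ofReal ((p : ℝ) ^ k) * μ (Metric.ball 0 1) := by
  have hp0 : (0 : ℝ) < p := Nat.cast_pos.mpr hp.out.pos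
  have hstep : ∀ k : ℤ, (p : ℝ) ^ (k + 1) = p * (p : ℝ) ^ k := fun k => zpow_one_add₀ hp0.ne' k ▸ by
    rw [add_comm]
  have hof : ∀ k : ℤ, ENNReal.ofReal ((p : ℝ) ^ (k + 1)) = p * ENNReal.ofReal ((p : ℝ) ^ k) := by
    intro k
    rw [hstep, ENNReal.ofReal_mul hp0.le, ENNReal.ofReal_natCast]
  have hpE : (p : ℝ≥0∞) ≠ 0 := Nat.cast_ne_zero.mpr hp.out.ne_zero
  induction k with
  | zero => simp
  | succ k ih => rw [hstep, measure_ball_prime_mul, ih, ← hstep, hof, mul_assoc]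
  | pred k ih =>
    have h1 := hstep (-(k : ℤ) - 1)
    have h2 := hof (-(k : ℤ) - 1)
    rw [sub_add_cancel] at h1 h2
    rw [h1, measure_ball_prime_mul, ← h1, h2, mul_assoc,
      ENNReal.mul_right_inj hpE (ENNReal.natCast_ne_top p)] at ih
    exact ih

/-- The scaling factor is found by comparing the measures of two balls. -/
lemma map_mul_left_padic (c : ℚ_[p]) (hc : c ≠ 0) :
    μ.map (c * ·) = ENNReal.ofReal ‖c‖⁻¹ • μ := by
  obtain ⟨d, hd⟩ := exists_map_mul_left_eq_smul μ hc
  obtain ⟨h2, h3⟩ := measure_ball_pos_lt_top μ 1 one_pos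
  have h := congrArg (fun ν : Measure ℚ_[p] => ν (Metric.ball 0 1)) hd
  rw [Measure.map_apply (measurable_const_mul _) measurableSet_ball, preimage_mul_left_ball hc,
    mul_one, Padic.norm_eq_zpow_neg_valuation hc, ← zpow_neg, measure_ball_zpow,
    Measure.smul_apply, smul_eq_mul, ENNReal.mul_left_inj h2 h3, zpow_neg,
    ← Padic.norm_eq_zpow_neg_valuation hc] at h
  rw [hd, h]

lemma isOpenEmbedding_padicInt (p : ℕ) [Fact p.Prime] :
    Topology.IsOpenEmbedding (PadicInt.Coe.ringHom : ℤ_[p] →+* ℚ_[p]) :=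
  PadicInt.isOpenEmbedding_coe

/-- The Haar measure on `ℚ_p` for which `ℤ_p` has measure `1`. -/
noncomputable def padicHaarField (p : ℕ) [Fact p.Prime] : Measure ℚ_[p] :=
  Measure.addHaarMeasure
    ⟨⟨Set.range (PadicInt.Coe.ringHom : ℤ_[p] →+* ℚ_[p]),
      isCompact_range (isOpenEmbedding_padicInt p).continuous⟩, by
      change (interior (Set.range (PadicInt.Coe.ringHom : ℤ_[p] →+* ℚ_[p]))).Nonempty
      rw [(isOpenEmbedding_padicInt p).isOpen_range.interior_eq]
      exact ⟨0, 0, map_zero _⟩⟩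

instance (p : ℕ) [Fact p.Prime] : (padicHaarField p).IsAddHaarMeasure := by
  unfold padicHaarField
  infer_instance

lemma isRestriction_padicHaar (p : ℕ) [Fact p.Prime] :
    IsRestriction (PadicInt.Coe.ringHom : ℤ_[p] →+* ℚ_[p]) (padicHaar p) (padicHaarField p) := by
  have hemb := isOpenEmbedding_padicInt p
  have h1 : ((padicHaarField p).comap (PadicInt.Coe.ringHom : ℤ_[p] →+* ℚ_[p])).IsAddHaarMeasure :=
    Measure.IsAddHaarMeasure.comap (mH := inferInstance) (padicHaarField p)
      (f := (PadicInt.Coe.ringHom : ℤ_[p] →+* ℚ_[p]).toAddMonoidHom) hemb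
  have h2 : IsProbabilityMeasure
      ((padicHaarField p).comap (PadicInt.Coe.ringHom : ℤ_[p] →+* ℚ_[p])) := ⟨by
    rw [hemb.measurableEmbedding.comap_apply, Set.image_univ]
    exact Measure.addHaarMeasure_self⟩
  have h3 : IsProbabilityMeasure (padicHaar p) := ⟨Measure.addHaarMeasure_self (K₀ := ⊤)⟩
  have h4 : (padicHaar p).IsAddHaarMeasure := by
    unfold padicHaar
    infer_instance
  rw [Measure.isAddHaarMeasure_eq_of_isProbabilityMeasure (padicHaar p)
    ((padicHaarField p).comap (PadicInt.Coe.ringHom : ℤ_[p] →+* ℚ_[p]))]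
  exact hemb.measurableEmbedding.isRestriction_comap _

instance (p : ℕ) [Fact p.Prime] : SigmaFinite (padicHaar p) := by
  unfold padicHaar
  infer_instance

end Padic

/-! ### The constant -/

section Constant

/-- The constant in the change of variables. The Jacobian of `theta` is `|2|^{-⌊n/2⌋}` up to
normalization; for odd `n` this factor is part of `du`. -/
def jacobian (n : ℕ) : ℚ := if Odd n then 1 else (1 / 2) ^ (n / 2)

lemma jacobian_ne_zero (n : ℕ) : jacobian n ≠ 0 := by
  unfold jacobian
  split_ifs <;> positivity

lemma nnnorm_jacobian_mul_duFactor (n : ℕ) (K : Type*) [NormedField K] [CharZero K] :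
    ENNReal.ofReal (‖(2 : K)‖⁻¹ ^ (n / 2)) = ‖(jacobian n : K)‖₊ * duFactor n K := by
  unfold jacobian duFactor
  split_ifs
  · simp [inv_pow]
  · rw [mul_one, ← enorm_eq_nnnorm, ← ofReal_norm]
    simp

lemma nnnorm_jacobian_ne_zero (n : ℕ) (K : Type*) [NormedField K] [CharZero K] :
    ‖(jacobian n : K)‖₊ ≠ 0 :=
  nnnorm_ne_zero_iff.mpr (Rat.cast_ne_zero.mpr (jacobian_ne_zero n))

lemma map_mul_left_volume (c : ℝ) (hc : c ≠ 0) :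
    (volume : Measure ℝ).map (c * ·) = ENNReal.ofReal ‖c‖⁻¹ • volume := by
  rw [Real.map_volume_mul_left hc, abs_inv, Real.norm_eq_abs]

lemma isRestriction_id : IsRestriction (RingHom.id ℝ) (volume : Measure ℝ) volume := by
  refine ⟨MeasurableEmbedding.id, ?_⟩
  rw [show (Set.range (RingHom.id ℝ)) = Set.univ from Set.range_id, Measure.restrict_univ]
  exact Measure.map_id

end Constant

end ReducibleOrbits

theorem mainTheorem8 (n : ℕ) (hn : 3 ≤ n) :
    ∃ J : ℚ, J ≠ 0 ∧
      ((ReducibleOrbits.dh n (volume : Measure ℝ)).IsMulRightInvariant ∧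
        ReducibleOrbits.ChangeOfVariables n (volume : Measure ℝ) ‖(J : ℝ)‖₊) ∧
      ∀ (p : ℕ) [Fact p.Prime],
        (ReducibleOrbits.dh n (ReducibleOrbits.padicHaar p)).IsMulRightInvariant ∧
          ReducibleOrbits.ChangeOfVariables n (ReducibleOrbits.padicHaar p) ‖(J : ℚ_[p])‖₊ := by
  open ReducibleOrbits in
  refine ⟨jacobian n, jacobian_ne_zero n, ⟨?_, ?_⟩, fun p _ => ⟨?_, ?_⟩⟩
  · exact isMulRightInvariant_dh hn isRestriction_id (fun _ => rfl) map_mul_left_volume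
  · exact changeOfVariables_of_isRestriction hn Topology.IsOpenEmbedding.id isRestriction_id
      (fun _ => rfl) map_mul_left_volume (nnnorm_jacobian_ne_zero n ℝ)
      (nnnorm_jacobian_mul_duFactor n ℝ)
  · exact isMulRightInvariant_dh hn (isRestriction_padicHaar p) (fun _ => rfl)
      (map_mul_left_padic (padicHaarField p))
  · exact changeOfVariables_of_isRestriction hn (isOpenEmbedding_padicInt p)
      (isRestriction_padicHaar p) (fun _ => rfl) (map_mul_left_padic (padicHaarField p))
      (nnnorm_jacobian_ne_zero n ℚ_[p]) (nnnorm_jacobian_mul_duFactor n ℚ_[p])
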